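/- Conventions. Let $\mathcal P$ be a small algebra: a finite-dimensional real unital $\mathbb Z_2$-graded commutative algebra with a unital algebra projection $\mathcal P\to\mathbb R$ whose kernel is nilpotent. A $\mathcal P$-supermanifold $\mathcal M=(M,\mathcal C^\infty_{\mathcal M})$ of super dimension $(m,n)$ is a smooth $m$-dimensional manifold $M$ (the body; Hausdorff, second countable, without boundary) with a sheaf $\mathcal C^\infty_{\mathcal M}$ of unital graded $\mathcal P$-algebras that is locally isomorphic to $\mathcal P\boxtimes(\mathcal C^\infty_M\otimes\bigwedge\mathbb R^n)$. A $\mathcal P$-supermorphism $\Phi:\mathcal M\to\mathcal N$ is a continuous map of the bodies together with a morphism $\Phi^*$ of the structure sheaves that is unital, multiplicative, grading preserving and $\mathcal P$-linear. A $\mathcal P$-point of $\mathcal M$ is a $\mathcal P$-supermorphism $p:(\{0\},\mathcal P)\to\mathcal M$, and $\Phi(p):=\Phi\circ p$. The super tangent bundle $sT\mathcal M$ is the sheaf of $\mathcal P$-linear super derivations of $\mathcal C^\infty_{\mathcal M}$; its sections are the super vector fields. The pullback $\Phi^*sT\mathcal N$ is identified with the sheaf of $\mathcal P$-linear super derivations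 $\mathcal C^\infty_{\mathcal N}\to\mathcal C^\infty_{\mathcal M}$ along $\Phi$, with $(\Phi^*S)h=\Phi^*(Sh)$, and $d\Phi:sT\mathcal M\to\Phi^*sT\mathcal N$ is $((d\Phi)X)h=X(\Phi^*h)$. For a $\mathcal P$-point $p$ put $sT_p\mathcal M:=p^*sT\mathcal M$ and $X(p):=p^*X$; the differential of $\Phi$ at $p$ is $(d\Phi)(p):sT_p\mathcal M\to sT_{\Phi(p)}\mathcal N$, $v\mapsto v\circ\Phi^*$. An affine $\mathcal P$-connection on $\mathcal M$ is an even $\mathcal P$-linear sheaf morphism $\nabla:sT\mathcal M\to sT^*\mathcal M\boxtimes sT\mathcal M$ with $\nabla(fS)=df\otimes S+f\nabla S$; write $\nabla_XS=\langle X,\nabla S\rangle$. Its pullback $\Phi^*\nabla$ is the unique connection on $\Phi^*sT\mathcal N$ (for $\Phi:\mathcal M\to\mathcal N$ and $\nabla$ an affine $\mathcal P$-connection on $\mathcal N$) such that $(\Phi^*\nabla)_X(\Phi^*S)=\langle(d\Phi)X,\Phi^*(\nabla S)\rangle$. A $\mathcal P$-supermorphism $\Xi:\mathcal M\to\mathcal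 N$ is affine with respect to $\nabla$ on $\mathcal M$ and $\nabla^{\mathcal N}$ on $\mathcal N$ if $(d\Xi)(\nabla_XY)=(\Xi^*\nabla^{\mathcal N})_X((d\Xi)Y)$ for all super vector fields $X,Y$ on $\mathcal M$. A homogeneous super vector field $X$ on $\mathcal M$ is infinitesimally affine if $[X,\nabla_YZ]=\nabla_{[X,Y]}Z+(-1)^{|X||Y|}\nabla_Y[X,Z]$ for all super vector fields $Y,Z$ with $Y$ homogeneous; a general one is infinitesimally affine if its even and odd parts are. A Riemannian $\mathcal P$-supermetric is an even, graded symmetric, $\mathcal C^\infty_{\mathcal M}$-bilinear form $g$ on $sT\mathcal M$ for which $T\mapsto g(\cdot,T)$ is an isomorphism $sT\mathcal M\to sT^*\mathcal M$; an isometry $\Xi:(\mathcal M,g)\to(\mathcal N,h)$ is a $\mathcal P$-supermorphism with $(\Xi^*h)((d\Xi)X,(d\Xi)Y)=g(X,Y)$ for all super vector fields $X,Y$ on $\mathcal M$, where $\Xi^*h$ is the bilinear form on $\Xi^*sT\mathcal N$ with $(\Xi^*h)(\Xi^*S,\Xi^*T)=\Xi^*(h(S,T))$. **Corollary 4.11 (Faithful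 linearization).** Let $\mathcal M$ and $\mathcal N$ be $\mathcal P$-supermanifolds, let the body $M$ of $\mathcal M$ be connected, and let $p$ be a $\mathcal P$-point of $\mathcal M$. (i) Let $\mathcal M$ and $\mathcal N$ carry affine $\mathcal P$-connections $\nabla$ and $\nabla^{\mathcal N}$. If $\Xi,\Sigma:\mathcal M\to\mathcal N$ are affine $\mathcal P$-supermorphisms with $\Xi(p)=\Sigma(p)$ and $(d\Xi)(p)=(d\Sigma)(p)$, then $\Xi=\Sigma$. (ii) Let $\mathcal M$ carry an affine $\mathcal P$-connection $\nabla$. If $X,X'$ are infinitesimally affine super vector fields on $\mathcal M$ with $X(p)=X'(p)$ and $(\nabla X)(p)=(\nabla X')(p)$, then $X=X'$. (iii) Let $\mathcal M$ and $\mathcal N$ carry Riemannian $\mathcal P$-supermetrics and have the same super dimension. If $\Xi,\Sigma:\mathcal M\to\mathcal N$ are isometries with $\Xi(p)=\Sigma(p)$ and $(d\Xi)(p)=(d\Sigma)(p)$, then $\Xi=\Sigma$. -/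

import Mathlib

open TopologicalSpace
open scoped Manifold ContDiff TensorProduct

namespace PSuper

universe u v w x y z t

noncomputable section

/-! ### Parities, signs and small algebras -/

/-- The Koszul sign `(-1)^(i j)` of two parities. -/
def sgn (i j : ZMod 2) : ℤ := if i = 1 ∧ j = 1 then -1 else 1

theorem sgn_comm (i j : ZMod 2) : sgn i j = sgn j i := by
  simp only [sgn, and_comm]

theorem sgn_add_left (i j k : ZMod 2) : sgn (i + j) k = sgn i k * sgn j k := by
  revert i j k; decide

theorem sgn_add_right (i j k : ZMod 2) : sgn i (j + k) = sgn i j * sgn i k := by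
  revert i j k; decide

theorem sgn_mul_self (i j : ZMod 2) : sgn i j * sgn i j = 1 := by
  revert i j; decide

/-- A small algebra: a finite-dimensional real unital graded commutative superalgebra `P` with a
unital algebra projection `P → ℝ` (the body map) whose kernel is nilpotent. The body map is
unique, and its kernel is the largest ideal of `P`. -/
class IsSmall {P : Type w} [Ring P] [Algebra ℝ P] (𝒢 : ZMod 2 → Submodule ℝ P)
    [GradedAlgebra 𝒢] : Prop where
  finite : FiniteDimensional ℝ P
  comm : ∀ (i j : ZMod 2) (a b : P), a ∈ 𝒢 i → b ∈ 𝒢 j → a * b = sgn i j • (b * a)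
  body : ∃ ε : P →ₐ[ℝ] ℝ, ∃ k : ℕ, ∀ a : Fin k → P,
    (∀ i, ε (a i) = 0) → (List.ofFn a).prod = 0

variable {P : Type w} [Ring P] [Algebra ℝ P]

/-! ### Spaces with a sheaf of graded commutative `P`-superalgebras -/

/-- A sheaf `Γ` of unital graded commutative `P`-superalgebras on a topological space `M`;
the homomorphism `ι` is the structure map of the `P`-algebra structure. -/
structure SuperSpace (𝒢 : ZMod 2 → Submodule ℝ P) (M : Type u) [TopologicalSpace M] where
  /-- sections over an open set -/
  Γ : Opens M → Type x
  [ring : ∀ U, Ring (Γ U)]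
  [algebra : ∀ U, Algebra ℝ (Γ U)]
  /-- even and odd sections -/
  gr : ∀ U, ZMod 2 → Submodule ℝ (Γ U)
  [graded : ∀ U, GradedAlgebra (gr U)]
  comm : ∀ (U) (i j : ZMod 2) (f g : Γ U), f ∈ gr U i → g ∈ gr U j → f * g = sgn i j • (g * f)
  /-- the structure map of the `P`-algebra of sections -/
  ι : ∀ U, P →ₐ[ℝ] Γ U
  ι_mem : ∀ (U) (i : ZMod 2) (a : P), a ∈ 𝒢 i → ι U a ∈ gr U i
  /-- restriction of sections -/
  res : ∀ {U V : Opens M}, V ≤ U → (Γ U →ₐ[ℝ] Γ V)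
  res_self : ∀ (U) (f : Γ U), res (le_refl U) f = f
  res_res : ∀ {U V W : Opens M} (hV : V ≤ U) (hW : W ≤ V) (f : Γ U),
    res hW (res hV f) = res (hW.trans hV) f
  res_mem : ∀ {U V : Opens M} (h : V ≤ U) (i : ZMod 2) (f : Γ U),
    f ∈ gr U i → res h f ∈ gr V i
  res_ι : ∀ {U V : Opens M} (h : V ≤ U) (a : P), res h (ι U a) = ι V a
  locality : ∀ {I : Type u} (U : I → Opens M) (f g : Γ (⨆ i, U i)),
    (∀ i, res (le_iSup U i) f = res (le_iSup U i) g) → f = g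
  gluing : ∀ {I : Type u} (U : I → Opens M) (f : ∀ i, Γ (U i)),
    (∀ i j, res (inf_le_left : U i ⊓ U j ≤ U i) (f i)
      = res (inf_le_right : U i ⊓ U j ≤ U j) (f j)) →
    ∃ g : Γ (⨆ i, U i), ∀ i, res (le_iSup U i) g = f i

attribute [instance] SuperSpace.ring SuperSpace.algebra SuperSpace.graded

variable {𝒢 : ZMod 2 → Submodule ℝ P}
variable {M : Type u} [TopologicalSpace M] {N : Type v} [TopologicalSpace N]
variable {K : Type z} [TopologicalSpace K]

/-- The homogeneous component of parity `i` of a section. -/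
def SuperSpace.pr (ℳ : SuperSpace.{u, w, x} 𝒢 M) (U : Opens M) (i : ZMod 2) :
    ℳ.Γ U →+ ℳ.Γ U where
  toFun f := (DirectSum.decompose (ℳ.gr U) f i : ℳ.Γ U)
  map_zero' := by simp
  map_add' f g := by simp

theorem SuperSpace.pr_mem (ℳ : SuperSpace.{u, w, x} 𝒢 M) (U : Opens M) (i : ZMod 2)
    (f : ℳ.Γ U) : ℳ.pr U i f ∈ ℳ.gr U i :=
  (DirectSum.decompose (ℳ.gr U) f i).2

/-- The continuous map `φ` maps the open set `W` into the open set `V`. -/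
def MapsInto (φ : C(M, N)) (W : Opens M) (V : Opens N) : Prop := ∀ q ∈ W, φ q ∈ V

theorem mapsInto_comap (φ : C(M, N)) (V : Opens N) : MapsInto φ (Opens.comap φ V) V :=
  fun _ hq => hq

theorem MapsInto.le_comap {φ : C(M, N)} {W : Opens M} {V : Opens N} (h : MapsInto φ W V) :
    W ≤ Opens.comap φ V :=
  fun q hq => h q hq

theorem MapsInto.mono {φ : C(M, N)} {W W' : Opens M} {V : Opens N} (h : MapsInto φ W V)
    (hW : W' ≤ W) : MapsInto φ W' V :=
  fun q hq => h q (hW hq)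

theorem MapsInto.inf {φ : C(M, N)} {W : Opens M} {V V' : Opens N} (h : MapsInto φ W V)
    (h' : MapsInto φ W V') : MapsInto φ W (V ⊓ V') :=
  fun q hq => ⟨h q hq, h' q hq⟩

theorem MapsInto.of_comp {ψ : C(M, N)} {φ : C(K, M)} {W : Opens K} {V : Opens N}
    (h : MapsInto (ψ.comp φ) W V) : MapsInto φ W (Opens.comap ψ V) :=
  fun q hq => h q hq

theorem MapsInto.le {W V : Opens M} (h : MapsInto (ContinuousMap.id M) W V) : W ≤ V :=
  fun q hq => h q hq

/-- A `P`-supermorphism: a continuous map `body` together with a morphism of sheaves of graded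
unital `P`-algebras `𝒪_N → body_* 𝒪_M`. The sheaf morphism is recorded through its composites
`pull V W : 𝒪_N(V) → 𝒪_M(W)` with the restrictions to the open sets `W ⊆ body⁻¹(V)`. -/
@[ext]
structure Hom (ℳ : SuperSpace.{u, w, x} 𝒢 M) (𝒩 : SuperSpace.{v, w, y} 𝒢 N) where
  body : C(M, N)
  pull : ∀ (V : Opens N) (W : Opens M), MapsInto body W V → (𝒩.Γ V →ₐ[ℝ] ℳ.Γ W)
  pull_mem : ∀ (V W) (h : MapsInto body W V) (i : ZMod 2) (f : 𝒩.Γ V),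
    f ∈ 𝒩.gr V i → pull V W h f ∈ ℳ.gr W i
  pull_ι : ∀ (V W) (h : MapsInto body W V) (a : P), pull V W h (𝒩.ι V a) = ℳ.ι W a
  res_pull : ∀ {V V' : Opens N} {W W' : Opens M} (h : MapsInto body W V)
    (h' : MapsInto body W' V') (hV : V' ≤ V) (hW : W' ≤ W) (f : 𝒩.Γ V),
    ℳ.res hW (pull V W h f) = pull V' W' h' (𝒩.res hV f)

/-- The identity supermorphism. -/
def Hom.id (ℳ : SuperSpace.{u, w, x} 𝒢 M) : Hom ℳ ℳ where
  body := ContinuousMap.id M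
  pull _ _ h := ℳ.res h.le
  pull_mem _ _ _ := ℳ.res_mem _
  pull_ι _ _ _ := ℳ.res_ι _
  res_pull _ _ _ _ _ := by rw [ℳ.res_res, ℳ.res_res]

theorem mapsInto_id (ℳ : SuperSpace.{u, w, x} 𝒢 M) {W V : Opens M} (h : W ≤ V) :
    MapsInto (Hom.id ℳ).body W V :=
  fun _ hq => h hq

theorem le_of_mapsInto_id {ℳ : SuperSpace.{u, w, x} 𝒢 M} {W V : Opens M}
    (h : MapsInto (Hom.id ℳ).body W V) : W ≤ V :=
  fun q hq => h q hq

/-- Composition `Ψ ∘ Φ` of supermorphisms. -/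
def Hom.comp {𝒦 : SuperSpace.{z, w, t} 𝒢 K} {ℳ : SuperSpace.{u, w, x} 𝒢 M}
    {𝒩 : SuperSpace.{v, w, y} 𝒢 N} (Ψ : Hom ℳ 𝒩) (Φ : Hom 𝒦 ℳ) : Hom 𝒦 𝒩 where
  body := Ψ.body.comp Φ.body
  pull V W h := (Φ.pull (Opens.comap Ψ.body V) W h.of_comp).comp
    (Ψ.pull V (Opens.comap Ψ.body V) (mapsInto_comap _ _))
  pull_mem V W h i f hf := Φ.pull_mem _ _ _ _ _ (Ψ.pull_mem _ _ _ _ _ hf)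
  pull_ι V W h a := by rw [AlgHom.comp_apply, Ψ.pull_ι, Φ.pull_ι]
  res_pull {V V' W W'} h h' hV hW f := by
    have hc : Opens.comap Ψ.body V' ≤ Opens.comap Ψ.body V := fun _ hx => hV hx
    rw [AlgHom.comp_apply, AlgHom.comp_apply, Φ.res_pull _ h'.of_comp hc hW,
      Ψ.res_pull _ (mapsInto_comap _ _) hV hc]

/-! ### `P`-supermanifolds -/

/-- The even and odd parts of the exterior algebra `Λ ℝⁿ`. -/
abbrev extGr (n : ℕ) : ZMod 2 → Submodule ℝ (ExteriorAlgebra ℝ (Fin n → ℝ)) :=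
  CliffordAlgebra.evenOdd (0 : QuadraticForm ℝ (Fin n → ℝ))

/-- The graded tensor product `P ⊠ Λ ℝⁿ`. -/
abbrev Fibre (𝒢 : ZMod 2 → Submodule ℝ P) [GradedAlgebra 𝒢] (n : ℕ) : Type w :=
  𝒢 ᵍ⊗[ℝ] (extGr n)

/-- The total grading of `P ⊠ Λ ℝⁿ`. -/
def fibreGr (𝒢 : ZMod 2 → Submodule ℝ P) [GradedAlgebra 𝒢] (n : ℕ) (k : ZMod 2) :
    Submodule ℝ (Fibre 𝒢 n) :=
  Submodule.span ℝ {t | ∃ i j : ZMod 2, i + j = k ∧ ∃ a ∈ 𝒢 i, ∃ b ∈ extGr n j,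
    t = GradedTensorProduct.tmul ℝ a b}

/-- Smoothness of a function with values in the finite-dimensional space `P ⊠ Λ ℝⁿ`: all
coordinates are smooth. Such functions on `V` form `P ⊠ (C^∞(V) ⊗ Λ ℝⁿ)`. -/
def IsSmoothFun (𝒢 : ZMod 2 → Submodule ℝ P) [GradedAlgebra 𝒢] (m n : ℕ)
    [ChartedSpace (EuclideanSpace ℝ (Fin m)) M] {V : Opens M} (F : V → Fibre 𝒢 n) : Prop :=
  ∀ φ : Fibre 𝒢 n →ₗ[ℝ] ℝ, ContMDiff (𝓡 m) 𝓘(ℝ, ℝ) ∞ (fun q : V => φ (F q))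

/-- An isomorphism of sheaves of graded `P`-algebras over the open set `U`, from the structure
sheaf onto the sheaf `V ↦ P ⊠ (C^∞(V) ⊗ Λ ℝⁿ)` of smooth functions with values in
`P ⊠ Λ ℝⁿ`. -/
structure Trivialization (ℳ : SuperSpace.{u, w, x} 𝒢 M) [GradedAlgebra 𝒢] (m n : ℕ)
    [ChartedSpace (EuclideanSpace ℝ (Fin m)) M] (U : Opens M) where
  toFun : ∀ V : Opens M, V ≤ U → (ℳ.Γ V →ₐ[ℝ] (V → Fibre 𝒢 n))
  injective : ∀ (V) (h : V ≤ U), Function.Injective (toFun V h)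
  range_eq : ∀ (V) (h : V ≤ U),
    Set.range (toFun V h) = {F : V → Fibre 𝒢 n | IsSmoothFun 𝒢 m n F}
  map_res : ∀ {V W : Opens M} (hV : V ≤ U) (hW : W ≤ V) (f : ℳ.Γ V) (q : W),
    toFun W (hW.trans hV) (ℳ.res hW f) q = toFun V hV f ⟨q, hW q.2⟩
  mem_gr_iff : ∀ (V) (h : V ≤ U) (k : ZMod 2) (f : ℳ.Γ V),
    f ∈ ℳ.gr V k ↔ ∀ q, toFun V h f q ∈ fibreGr 𝒢 n k
  map_ι : ∀ (V) (h : V ≤ U) (a : P) (q : V),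
    toFun V h (ℳ.ι V a) q = GradedTensorProduct.tmul ℝ a 1

/-- A `P`-supermanifold of super dimension `(m, n)` with body the `m`-dimensional smooth
manifold `M`. -/
structure PSupermanifold (𝒢 : ZMod 2 → Submodule ℝ P) [GradedAlgebra 𝒢] (m n : ℕ)
    (M : Type u) [TopologicalSpace M] [ChartedSpace (EuclideanSpace ℝ (Fin m)) M] extends
    SuperSpace.{u, w, x} 𝒢 M where
  locally_trivial : ∀ q : M, ∃ U : Opens M, q ∈ U ∧ Nonempty (Trivialization toSuperSpace m n U)

/-! ### Super derivations along a supermorphism -/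

section Derivations

variable {ℳ : SuperSpace.{u, w, x} 𝒢 M} {𝒩 : SuperSpace.{v, w, y} 𝒢 N}

/-- The sections over `U` of the sheaf `sder_Φ(𝒪_N, 𝒪_M) ≃ Φ^* sTN` of `P`-linear super
derivations along `Φ : ℳ → 𝒩`. Such a section is the sum of an even and an odd one;
`comp k` is the component of parity `k`, recorded on all `𝒪_N(V) → 𝒪_M(W)` with `W ⊆ U` and
`W ⊆ Φ⁻¹(V)`. Given the Leibniz rule, `P`-linearity means that constants are annihilated. -/
@[ext]
structure SDer (Φ : Hom ℳ 𝒩) (U : Opens M) where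
  comp : ZMod 2 → ∀ (V : Opens N) (W : Opens M), W ≤ U → MapsInto Φ.body W V →
    (𝒩.Γ V →+ ℳ.Γ W)
  comp_mem : ∀ (k V W hU hV) (i : ZMod 2) (f : 𝒩.Γ V),
    f ∈ 𝒩.gr V i → comp k V W hU hV f ∈ ℳ.gr W (k + i)
  leibniz : ∀ (k V W hU hV) (i : ZMod 2) (f g : 𝒩.Γ V), f ∈ 𝒩.gr V i →
    comp k V W hU hV (f * g) = comp k V W hU hV f * Φ.pull V W hV g
      + sgn k i • (Φ.pull V W hV f * comp k V W hU hV g)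
  comp_ι : ∀ (k V W hU hV) (a : P), comp k V W hU hV (𝒩.ι V a) = 0
  res_comp : ∀ (k) {V V' : Opens N} {W W' : Opens M} (hU : W ≤ U) (hU' : W' ≤ U)
    (h : MapsInto Φ.body W V) (h' : MapsInto Φ.body W' V') (hV : V' ≤ V)
    (hW : W' ≤ W) (f : 𝒩.Γ V),
    ℳ.res hW (comp k V W hU h f) = comp k V' W' hU' h' (𝒩.res hV f)

namespace SDer

variable {Φ : Hom ℳ 𝒩} {U : Opens M}

instance : Zero (SDer Φ U) where
  zero :=
    { comp := fun _ _ _ _ _ => 0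
      comp_mem := fun _ _ _ _ _ _ _ _ => by simp
      leibniz := fun _ _ _ _ _ _ _ _ _ => by simp
      comp_ι := fun _ _ _ _ _ _ => by simp
      res_comp := fun _ _ _ _ _ _ _ _ _ _ _ _ => by simp }

instance : Add (SDer Φ U) where
  add D E :=
    { comp := fun k V W hU hV => D.comp k V W hU hV + E.comp k V W hU hV
      comp_mem := fun k V W hU hV i f hf =>
        add_mem (D.comp_mem k V W hU hV i f hf) (E.comp_mem k V W hU hV i f hf)
      leibniz := fun k V W hU hV i f g hf => by
        simp only [AddMonoidHom.add_apply, D.leibniz k V W hU hV i f g hf,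
          E.leibniz k V W hU hV i f g hf, mul_add, add_mul, smul_add]
        abel
      comp_ι := fun k V W hU hV a => by simp [D.comp_ι, E.comp_ι]
      res_comp := fun k _ _ _ _ hU hU' h h' hV hW f => by
        simp only [AddMonoidHom.add_apply, map_add, D.res_comp k hU hU' h h' hV hW f,
          E.res_comp k hU hU' h h' hV hW f] }

instance : Neg (SDer Φ U) where
  neg D :=
    { comp := fun k V W hU hV => - D.comp k V W hU hV
      comp_mem := fun k V W hU hV i f hf => neg_mem (D.comp_mem k V W hU hV i f hf)
      leibniz := fun k V W hU hV i f g hf => by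
        simp only [AddMonoidHom.neg_apply, D.leibniz k V W hU hV i f g hf, neg_mul, mul_neg,
          smul_neg, neg_add]
      comp_ι := fun k V W hU hV a => by simp [D.comp_ι]
      res_comp := fun k _ _ _ _ hU hU' h h' hV hW f => by
        simp only [AddMonoidHom.neg_apply, map_neg, D.res_comp k hU hU' h h' hV hW f] }

theorem zero_comp (k V W hU hV) : (0 : SDer Φ U).comp k V W hU hV = 0 := rfl

theorem add_comp (D E : SDer Φ U) (k V W hU hV) :
    (D + E).comp k V W hU hV = D.comp k V W hU hV + E.comp k V W hU hV := rfl

theorem neg_comp (D : SDer Φ U) (k V W hU hV) :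
    (-D).comp k V W hU hV = - D.comp k V W hU hV := rfl

theorem ext' {D E : SDer Φ U} (h : ∀ k V W hU hV, D.comp k V W hU hV = E.comp k V W hU hV) :
    D = E :=
  SDer.ext (by funext k V W hU hV; exact h k V W hU hV)

instance : AddCommGroup (SDer Φ U) where
  add_assoc _ _ _ := ext' fun _ _ _ _ _ => by simp only [add_comp, add_assoc]
  zero_add _ := ext' fun _ _ _ _ _ => by simp only [add_comp, zero_comp, zero_add]
  add_zero _ := ext' fun _ _ _ _ _ => by simp only [add_comp, zero_comp, add_zero]
  add_comm _ _ := ext' fun _ _ _ _ _ => by simp only [add_comp, add_comm]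
  neg_add_cancel _ := ext' fun _ _ _ _ _ => by
    simp only [add_comp, neg_comp, zero_comp, neg_add_cancel]
  nsmul := nsmulRec
  zsmul := zsmulRec

/-- The left multiplication `(f D)(h) = f (D h)` of a derivation by a superfunction; the
component of parity `k` of `f D` is `f₀ D_k + f₁ D_{k-1}`. -/
instance : SMul (ℳ.Γ U) (SDer Φ U) where
  smul f D :=
    { comp := fun k V W hU hV => ∑ l : ZMod 2,
        (AddMonoidHom.mulLeft (ℳ.res hU (ℳ.pr U l f))).comp (D.comp (k - l) V W hU hV)
      comp_mem := fun k V W hU hV i h hh => by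
        simp only [AddMonoidHom.finsetSum_apply]
        refine sum_mem fun l _ => ?_
        have h1 := ℳ.res_mem hU l _ (ℳ.pr_mem U l f)
        have h2 := D.comp_mem (k - l) V W hU hV i h hh
        have h3 := SetLike.mul_mem_graded h1 h2
        have h4 : l + (k - l + i) = k + i := by ring
        rw [h4] at h3
        exact h3
      leibniz := fun k V W hU hV i h h' hh => by
        simp only [AddMonoidHom.finsetSum_apply, AddMonoidHom.comp_apply,
          AddMonoidHom.coe_mulLeft]
        rw [Finset.sum_mul, Finset.mul_sum, Finset.smul_sum, ← Finset.sum_add_distrib]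
        refine Finset.sum_congr rfl fun l _ => ?_
        have h1 := ℳ.res_mem hU l _ (ℳ.pr_mem U l f)
        have h2 := Φ.pull_mem V W hV i h hh
        have h3 := ℳ.comm W l i _ _ h1 h2
        have hs : sgn (k - l) i * sgn l i = sgn k i := by
          rw [← sgn_add_left, sub_add_cancel]
        rw [D.leibniz (k - l) V W hU hV i h h' hh, mul_add, ← mul_assoc, mul_smul_comm,
          ← mul_assoc _ (Φ.pull V W hV h), h3, smul_mul_assoc, smul_smul, hs, mul_assoc, mul_assoc]
      comp_ι := fun k V W hU hV a => by simp [D.comp_ι]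
      res_comp := fun k _ _ _ _ hU hU' h h' hV hW f' => by
        simp only [AddMonoidHom.finsetSum_apply, AddMonoidHom.comp_apply,
          AddMonoidHom.coe_mulLeft, map_sum, map_mul, ℳ.res_res]
        refine Finset.sum_congr rfl fun l _ => ?_
        rw [D.res_comp (k - l) hU hU' h h' hV hW f'] }

/-- The value `D h = D₀ h + D₁ h` of a derivation on a superfunction. -/
def apply (D : SDer Φ U) (V : Opens N) (W : Opens M) (hU : W ≤ U)
    (hV : MapsInto Φ.body W V) (h : 𝒩.Γ V) : ℳ.Γ W :=
  ∑ k : ZMod 2, D.comp k V W hU hV h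

/-- `D` is homogeneous of parity `k`. -/
def IsHomogeneous (D : SDer Φ U) (k : ZMod 2) : Prop :=
  ∀ j, j ≠ k → ∀ V W hU hV, D.comp j V W hU hV = 0

/-- The component of parity `k` as a derivation. -/
def part (D : SDer Φ U) (k : ZMod 2) : SDer Φ U where
  comp j V W hU hV := if j = k then D.comp j V W hU hV else 0
  comp_mem j V W hU hV i f hf := by
    split_ifs
    · exact D.comp_mem j V W hU hV i f hf
    · simp
  leibniz j V W hU hV i f g hf := by
    split_ifs
    · exact D.leibniz j V W hU hV i f g hf
    · simp
  comp_ι j V W hU hV a := by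
    split_ifs
    · exact D.comp_ι j V W hU hV a
    · simp
  res_comp j _ _ _ _ hU hU' h h' hV hW f := by
    split_ifs
    · exact D.res_comp j hU hU' h h' hV hW f
    · simp

/-- Restriction of a derivation to a smaller open set. -/
def restrict (D : SDer Φ U) {U' : Opens M} (h : U' ≤ U) : SDer Φ U' where
  comp k V W hU hV := D.comp k V W (hU.trans h) hV
  comp_mem k V W hU hV := D.comp_mem k V W (hU.trans h) hV
  leibniz k V W hU hV := D.leibniz k V W (hU.trans h) hV
  comp_ι k V W hU hV := D.comp_ι k V W (hU.trans h) hV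
  res_comp k _ _ _ _ hU hU' := D.res_comp k (hU.trans h) (hU'.trans h)

end SDer

/-- The `P`-super vector fields on `ℳ` over the open set `U`, i.e. the sections over `U` of the
super tangent bundle `sTℳ`. -/
abbrev VF (ℳ : SuperSpace.{u, w, x} 𝒢 M) (U : Opens M) := SDer (Hom.id ℳ) U

/-- The super commutator `[X, Y]`, which is `X Y - (-1)^{|X||Y|} Y X` for homogeneous vector
fields. -/
def bracket {U : Opens M} (X Y : VF ℳ U) : VF ℳ U where
  comp k V W hU hV := ∑ i : ZMod 2,
    ((X.comp i W W hU (mapsInto_id ℳ le_rfl)).comp (Y.comp (k - i) V W hU hV)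
      - sgn i (k - i) • (Y.comp (k - i) W W hU (mapsInto_id ℳ le_rfl)).comp (X.comp i V W hU hV))
  comp_mem k V W hU hV l f hf := by
    simp only [AddMonoidHom.finsetSum_apply]
    refine sum_mem fun i _ => ?_
    have h1 := X.comp_mem i W W hU (mapsInto_id ℳ le_rfl) _ _ (Y.comp_mem (k - i) V W hU hV l f hf)
    have h2 := Y.comp_mem (k - i) W W hU (mapsInto_id ℳ le_rfl) _ _ (X.comp_mem i V W hU hV l f hf)
    have e1 : i + (k - i + l) = k + l := by ring
    have e2 : k - i + (i + l) = k + l := by ring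
    rw [e1] at h1
    rw [e2] at h2
    exact sub_mem h1 (zsmul_mem h2 _)
  leibniz k V W hU hV l f g hf := by
    simp only [AddMonoidHom.finsetSum_apply]
    rw [Finset.sum_mul, Finset.mul_sum, Finset.smul_sum, ← Finset.sum_add_distrib]
    refine Finset.sum_congr rfl fun i _ => ?_
    obtain ⟨j, hj⟩ : ∃ j, j = k - i := ⟨_, rfl⟩
    have hk : k = i + j := by rw [hj]; ring
    rw [← hj, hk]
    have hself : ∀ f : ℳ.Γ W, (Hom.id ℳ).pull W W (mapsInto_id ℳ le_rfl) f = f := fun f => ℳ.res_self W f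
    have hYf := Y.comp_mem j V W hU hV l f hf
    have hXf := X.comp_mem i V W hU hV l f hf
    have hpf := (Hom.id ℳ).pull_mem V W hV l f hf
    have hXp : ∀ h : ℳ.Γ V, X.comp i W W hU (mapsInto_id ℳ le_rfl) ((Hom.id ℳ).pull V W hV h)
        = X.comp i V W hU hV h := fun h => by
      have := X.res_comp i hU hU hV (mapsInto_id ℳ le_rfl) (le_of_mapsInto_id hV) le_rfl h
      rw [ℳ.res_self] at this
      exact this.symm
    have hYp : ∀ h : ℳ.Γ V, Y.comp j W W hU (mapsInto_id ℳ le_rfl) ((Hom.id ℳ).pull V W hV h)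
        = Y.comp j V W hU hV h := fun h => by
      have := Y.res_comp j hU hU hV (mapsInto_id ℳ le_rfl) (le_of_mapsInto_id hV) le_rfl h
      rw [ℳ.res_self] at this
      exact this.symm
    simp only [AddMonoidHom.sub_apply, AddMonoidHom.smul_apply, AddMonoidHom.comp_apply]
    rw [Y.leibniz j V W hU hV l f g hf, X.leibniz i V W hU hV l f g hf]
    simp only [map_add, map_zsmul]
    rw [X.leibniz i W W hU (mapsInto_id ℳ le_rfl) _ _ _ hYf, X.leibniz i W W hU (mapsInto_id ℳ le_rfl) _ _ _ hpf,
      Y.leibniz j W W hU (mapsInto_id ℳ le_rfl) _ _ _ hXf, Y.leibniz j W W hU (mapsInto_id ℳ le_rfl) _ _ _ hpf]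
    simp only [hself, hXp, hYp, sgn_add_left, sgn_add_right, smul_add, smul_sub, sub_mul, mul_sub,
      smul_smul, smul_mul_assoc, mul_smul_comm]
    have hc : sgn j i = sgn i j := sgn_comm j i
    have hq : sgn i j * sgn i j = 1 := sgn_mul_self i j
    have e1 : sgn i j * (sgn j i * sgn j l) = sgn j l := by
      rw [hc, ← mul_assoc, hq, one_mul]
    have e2 : sgn i j * (sgn i l * sgn j l) = sgn i l * sgn j l * sgn i j := by ring
    have e3 : sgn j l * sgn i l = sgn i l * sgn j l := by ring
    rw [e1, e2, e3]
    abel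
  comp_ι k V W hU hV a := by simp [X.comp_ι, Y.comp_ι]
  res_comp k V V' W W' hU hU' h h' hV hW f := by
    simp only [AddMonoidHom.finsetSum_apply, AddMonoidHom.sub_apply, AddMonoidHom.smul_apply,
      AddMonoidHom.comp_apply, map_sum, map_sub, map_zsmul]
    refine Finset.sum_congr rfl fun i _ => ?_
    rw [X.res_comp i hU hU' _ (mapsInto_id ℳ le_rfl) hW hW, Y.res_comp (k - i) hU hU' h h' hV hW,
      Y.res_comp (k - i) hU hU' _ (mapsInto_id ℳ le_rfl) hW hW, X.res_comp i hU hU' h h' hV hW]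

/-- The super differential `dΦ : sTℳ → Φ^* sT𝒩`, `((dΦ) X) h = X (Φ^* h)`. -/
def differential (Φ : Hom ℳ 𝒩) {U : Opens M} (X : VF ℳ U) : SDer Φ U where
  comp k V W hU hV := (X.comp k (Opens.comap Φ.body V) W hU (mapsInto_id ℳ hV.le_comap)).comp
    (Φ.pull V (Opens.comap Φ.body V) (mapsInto_comap _ _) :
      𝒩.Γ V →+ ℳ.Γ (Opens.comap Φ.body V))
  comp_mem k V W hU hV i f hf := X.comp_mem _ _ _ _ _ _ _ (Φ.pull_mem _ _ _ _ _ hf)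
  leibniz k V W hU hV i f g hf := by
    have hp : ∀ f, (Hom.id ℳ).pull (Opens.comap Φ.body V) W (mapsInto_id ℳ hV.le_comap)
        (Φ.pull V (Opens.comap Φ.body V) (mapsInto_comap _ _) f) = Φ.pull V W hV f := fun f => by
      have := Φ.res_pull (mapsInto_comap _ _) hV le_rfl hV.le_comap f
      rw [𝒩.res_self] at this
      exact this
    have := X.leibniz k (Opens.comap Φ.body V) W hU (mapsInto_id ℳ hV.le_comap) i _
      (Φ.pull V (Opens.comap Φ.body V) (mapsInto_comap _ _) g)
      (Φ.pull_mem V (Opens.comap Φ.body V) (mapsInto_comap _ _) _ _ hf)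
    rw [hp, hp, ← map_mul] at this
    exact this
  comp_ι k V W hU hV a := by
    simp only [AddMonoidHom.comp_apply, AddMonoidHom.coe_coe]
    rw [Φ.pull_ι, X.comp_ι]
  res_comp k V V' W W' hU hU' h h' hV hW f := by
    have hc : Opens.comap Φ.body V' ≤ Opens.comap Φ.body V := fun _ hx => hV hx
    simp only [AddMonoidHom.comp_apply, AddMonoidHom.coe_coe]
    rw [X.res_comp k hU hU' _ (mapsInto_id ℳ h'.le_comap) hc hW,
      Φ.res_pull _ (mapsInto_comap _ _) hV hc]

/-- The pullback `Φ^* S` of a super vector field `S` on `𝒩` over `V`, over an open set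
`W ⊆ Φ⁻¹(V)`: `(Φ^* S) h = Φ^* (S h)`. -/
def pullVF (Φ : Hom ℳ 𝒩) {V : Opens N} (S : VF 𝒩 V) (W : Opens M)
    (hW : MapsInto Φ.body W V) : SDer Φ W where
  comp k V' W' hU hV' :=
    (Φ.pull (V ⊓ V') W' ((hW.mono hU).inf hV') : 𝒩.Γ (V ⊓ V') →+ ℳ.Γ W').comp
      (S.comp k V' (V ⊓ V') inf_le_left (mapsInto_id 𝒩 inf_le_right))
  comp_mem k V' W' hU hV' i f hf := Φ.pull_mem _ _ _ _ _ (S.comp_mem _ _ _ _ _ _ _ hf)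
  leibniz k V' W' hU hV' i f g hf := by
    have hp : ∀ f, Φ.pull (V ⊓ V') W' ((hW.mono hU).inf hV')
        ((Hom.id 𝒩).pull V' (V ⊓ V') (mapsInto_id 𝒩 inf_le_right) f)
        = Φ.pull V' W' hV' f := fun f => by
      have := Φ.res_pull hV' ((hW.mono hU).inf hV') inf_le_right le_rfl f
      rw [ℳ.res_self] at this
      exact this.symm
    simp only [AddMonoidHom.comp_apply, AddMonoidHom.coe_coe]
    rw [S.leibniz k V' (V ⊓ V') inf_le_left (mapsInto_id 𝒩 inf_le_right) i f g hf]
    simp only [map_add, map_mul, map_zsmul, hp]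
  comp_ι k V' W' hU hV' a := by
    simp only [AddMonoidHom.comp_apply, AddMonoidHom.coe_coe]
    rw [S.comp_ι, map_zero]
  res_comp k V₁ V₂ W₁ W₂ hU hU' h h' hV hW' f := by
    have hc : V ⊓ V₂ ≤ V ⊓ V₁ := inf_le_inf_left V hV
    simp only [AddMonoidHom.comp_apply, AddMonoidHom.coe_coe]
    rw [Φ.res_pull _ ((hW.mono hU').inf h') hc hW',
      S.res_comp k _ inf_le_left _ (mapsInto_id 𝒩 inf_le_right) hV hc]

end Derivations

/-! ### Connections and affine supermorphisms -/

section Connections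

variable {ℳ : SuperSpace.{u, w, x} 𝒢 M} {𝒩 : SuperSpace.{v, w, y} 𝒢 N}

/-- A `P`-connection `∇ : Φ^* sT𝒩 → sT^*ℳ ⊠ Φ^* sT𝒩` on the bundle `Φ^* sT𝒩`, given through
`∇_X S = ⟨X, ∇ S⟩` for sections `X` of `sTℳ` and `S` of `Φ^* sT𝒩` over open sets. -/
structure Connection (Φ : Hom ℳ 𝒩) where
  nabla : ∀ U : Opens M, VF ℳ U → SDer Φ U → SDer Φ U
  add_left : ∀ (U) (X Y : VF ℳ U) (S : SDer Φ U),
    nabla U (X + Y) S = nabla U X S + nabla U Y S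
  smul_left : ∀ (U) (f : ℳ.Γ U) (X : VF ℳ U) (S : SDer Φ U),
    nabla U (f • X) S = f • nabla U X S
  add_right : ∀ (U) (X : VF ℳ U) (S T : SDer Φ U),
    nabla U X (S + T) = nabla U X S + nabla U X T
  leibniz : ∀ (U) (i j : ZMod 2) (X : VF ℳ U) (f : ℳ.Γ U) (S : SDer Φ U),
    X.IsHomogeneous i → f ∈ ℳ.gr U j →
    nabla U X (f • S) = X.apply U U le_rfl (mapsInto_id ℳ le_rfl) f • S
      + sgn i j • (f • nabla U X S)
  even : ∀ (U) (i j : ZMod 2) (X : VF ℳ U) (S : SDer Φ U),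
    X.IsHomogeneous i → S.IsHomogeneous j → (nabla U X S).IsHomogeneous (i + j)
  restrict : ∀ {U V : Opens M} (h : V ≤ U) (X : VF ℳ U) (S : SDer Φ U),
    (nabla U X S).restrict h = nabla V (X.restrict h) (S.restrict h)

/-- An affine `P`-connection on `ℳ`, i.e. a `P`-connection on `sTℳ`. -/
abbrev AffineConnection (ℳ : SuperSpace.{u, w, x} 𝒢 M) := Connection (Hom.id ℳ)

/-- `∇'` is the pullback `Φ^* ∇` of the affine connection `∇` on `𝒩`, that is,
`(Φ^* ∇)_X (Φ^* S) = ⟨(dΦ) X, Φ^* (∇ S)⟩`. The right hand side is the `𝒪_M`-linear contraction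
with `⟨Φ^* Z, Φ^* (∇ S)⟩ = Φ^* (∇_Z S)`. Between supermanifolds there is exactly one such `∇'`. -/
def IsPullbackConnection {Φ : Hom ℳ 𝒩} (nab : AffineConnection 𝒩) (nab' : Connection Φ) : Prop :=
  ∀ (V : Opens N) (U : Opens M) (hU : MapsInto Φ.body U V) (X : VF ℳ U) (S : VF 𝒩 V)
    (r : ℕ) (a : Fin r → ℳ.Γ U) (Z : Fin r → VF 𝒩 V),
    differential Φ X = ∑ i, a i • pullVF Φ (Z i) U hU →
    nab'.nabla U X (pullVF Φ S U hU) = ∑ i, a i • pullVF Φ (nab.nabla V (Z i) S) U hU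

/-- `Φ` is affine with respect to affine connections on `ℳ` and `𝒩` if
`(dΦ)(∇_X Y) = (Φ^* ∇)_X ((dΦ) Y)` for all super vector fields `X`, `Y` on `ℳ`. -/
def IsAffine (nabM : AffineConnection ℳ) (nabN : AffineConnection 𝒩) (Φ : Hom ℳ 𝒩) : Prop :=
  ∃ nab' : Connection Φ, IsPullbackConnection nabN nab' ∧
    ∀ (U : Opens M) (X Y : VF ℳ U),
      differential Φ (nabM.nabla U X Y) = nab'.nabla U X (differential Φ Y)

/-- A global super vector field `X` is infinitesimally affine if its even and odd parts satisfy
`[X, ∇_Y Z] = ∇_{[X, Y]} Z + (-1)^{|X||Y|} ∇_Y [X, Z]` for all super vector fields `Y`, `Z`,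
`Y` homogeneous. -/
def IsInfinitesimallyAffine (nab : AffineConnection ℳ) (X : VF ℳ ⊤) : Prop :=
  ∀ (k j : ZMod 2) (U : Opens M) (Y Z : VF ℳ U), Y.IsHomogeneous j →
    bracket ((X.part k).restrict le_top) (nab.nabla U Y Z)
      = nab.nabla U (bracket ((X.part k).restrict le_top) Y) Z
        + sgn k j • nab.nabla U Y (bracket ((X.part k).restrict le_top) Z)

/-! ### Supermetrics and isometric supermorphisms -/

/-- An even `𝒪_M`-bilinear form on the bundle `Φ^* sT𝒩`, i.e. an even section of
`(Φ^* sT𝒩 ⊠ Φ^* sT𝒩)^*`. -/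
structure BilinForm (Φ : Hom ℳ 𝒩) where
  form : ∀ U : Opens M, SDer Φ U → SDer Φ U → ℳ.Γ U
  add_left : ∀ (U) (S S' T : SDer Φ U), form U (S + S') T = form U S T + form U S' T
  add_right : ∀ (U) (S T T' : SDer Φ U), form U S (T + T') = form U S T + form U S T'
  smul_left : ∀ (U) (f : ℳ.Γ U) (S T : SDer Φ U), form U (f • S) T = f * form U S T
  smul_right : ∀ (U) (i j : ZMod 2) (f : ℳ.Γ U) (S T : SDer Φ U),
    S.IsHomogeneous i → f ∈ ℳ.gr U j → form U S (f • T) = sgn i j • (f * form U S T)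
  even : ∀ (U) (i j : ZMod 2) (S T : SDer Φ U),
    S.IsHomogeneous i → T.IsHomogeneous j → form U S T ∈ ℳ.gr U (i + j)
  restrict : ∀ {U V : Opens M} (h : V ≤ U) (S T : SDer Φ U),
    ℳ.res h (form U S T) = form V (S.restrict h) (T.restrict h)

/-- The sections over `U` of the super cotangent bundle `sT^*ℳ`: the homomorphisms of sheaves of
left modules from `sTℳ` to `𝒪_M` over `U`. -/
structure OneForm (ℳ : SuperSpace.{u, w, x} 𝒢 M) (U : Opens M) where
  pair : ∀ W : Opens M, W ≤ U → (VF ℳ W →+ ℳ.Γ W)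
  smul : ∀ (W) (h : W ≤ U) (f : ℳ.Γ W) (X : VF ℳ W), pair W h (f • X) = f * pair W h X
  restrict : ∀ {W W' : Opens M} (h : W ≤ U) (h' : W' ≤ W) (X : VF ℳ W),
    ℳ.res h' (pair W h X) = pair W' (h'.trans h) (X.restrict h')

/-- A Riemannian `P`-supermetric on `ℳ`: a graded symmetric even bilinear form `g` on `sTℳ` such
that `T ↦ g(·, T)` is an isomorphism from `sTℳ` onto `sT^*ℳ`. -/
structure SuperMetric (ℳ : SuperSpace.{u, w, x} 𝒢 M) extends BilinForm (Hom.id ℳ) where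
  symm : ∀ (U) (i j : ZMod 2) (S T : VF ℳ U), S.IsHomogeneous i → T.IsHomogeneous j →
    form U S T = sgn i j • form U T S
  nondegenerate : ∀ (U : Opens M) (α : OneForm ℳ U), ∃! T : VF ℳ U,
    ∀ (W : Opens M) (h : W ≤ U) (S : VF ℳ W), α.pair W h S = form W S (T.restrict h)

/-- `h'` is the pullback `Φ^* h` of the supermetric `h` on `𝒩`: the bilinear form on `Φ^* sT𝒩`
with `(Φ^* h)(Φ^* S, Φ^* T) = Φ^* (h(S, T))`. Between supermanifolds there is exactly one. -/
def IsPullbackMetric {Φ : Hom ℳ 𝒩} (h : SuperMetric 𝒩) (h' : BilinForm Φ) : Prop :=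
  ∀ (V : Opens N) (U : Opens M) (hU : MapsInto Φ.body U V) (S T : VF 𝒩 V),
    h'.form U (pullVF Φ S U hU) (pullVF Φ T U hU) = Φ.pull V U hU (h.form V S T)

/-- `Φ` is isometric with respect to supermetrics `g` on `ℳ` and `h` on `𝒩` if
`(Φ^* h)((dΦ) X, (dΦ) Y) = g(X, Y)` for all super vector fields `X`, `Y` on `ℳ`. -/
def IsIsometric (g : SuperMetric ℳ) (h : SuperMetric 𝒩) (Φ : Hom ℳ 𝒩) : Prop :=
  ∃ h' : BilinForm Φ, IsPullbackMetric h h' ∧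
    ∀ (U : Opens M) (X Y : VF ℳ U),
      h'.form U (differential Φ X) (differential Φ Y) = g.form U X Y

end Connections

/-! ### `P`-points and values at `P`-points -/

section Points

/-- The grading of the algebra of `P`-valued functions on a set. -/
def funGr (𝒢 : ZMod 2 → Submodule ℝ P) (I : Type) (k : ZMod 2) : Submodule ℝ (I → P) where
  carrier := {f | ∀ q, f q ∈ 𝒢 k}
  add_mem' hf hg q := add_mem (hf q) (hg q)
  zero_mem' _ := zero_mem _
  smul_mem' c _ hf q := Submodule.smul_mem _ c (hf q)

/-- The decomposition of a `P`-valued function into its even and odd parts. -/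
def funDecompose (𝒢 : ZMod 2 → Submodule ℝ P) [GradedAlgebra 𝒢] (I : Type) :
    (I → P) →+ DirectSum (ZMod 2) (fun k => funGr 𝒢 I k) :=
  ∑ k : ZMod 2, (DirectSum.of (fun k => funGr 𝒢 I k) k).comp
    { toFun := fun f => ⟨fun q => (DirectSum.decompose 𝒢 (f q) k : P),
        fun q => (DirectSum.decompose 𝒢 (f q) k).2⟩
      map_zero' := Subtype.ext (funext fun q => by simp)
      map_add' := fun f g => Subtype.ext (funext fun q => by simp) }

instance funGraded (𝒢 : ZMod 2 → Submodule ℝ P) [GradedAlgebra 𝒢] (I : Type) :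
    GradedAlgebra (funGr 𝒢 I) where
  one_mem _ := SetLike.one_mem_graded 𝒢
  mul_mem _ _ _ _ hf hg q := SetLike.mul_mem_graded (hf q) (hg q)
  toDecomposition := DirectSum.Decomposition.ofAddHom (funGr 𝒢 I) (funDecompose 𝒢 I)
    (by
      classical
      ext f q
      simp only [funDecompose, AddMonoidHom.comp_apply, AddMonoidHom.finsetSum_apply, map_sum,
        DirectSum.coeAddMonoidHom_of, Finset.sum_apply, AddMonoidHom.id_apply]
      have := DirectSum.sum_support_decompose 𝒢 (f q)
      conv_rhs => rw [← this]
      refine (Finset.sum_subset (Finset.subset_univ _) fun k _ hk => ?_).symm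
      simpa using hk)
    (by
      refine DirectSum.addHom_ext fun i g => ?_
      simp only [funDecompose, AddMonoidHom.comp_apply, AddMonoidHom.finsetSum_apply,
        DirectSum.coeAddMonoidHom_of, AddMonoidHom.id_apply]
      rw [Finset.sum_eq_single i]
      · congr 1
        exact Subtype.ext (funext fun q => DirectSum.decompose_of_mem_same 𝒢 (g.2 q))
      · intro k _ hk
        rw [← map_zero (DirectSum.of (fun k => funGr 𝒢 I k) k)]
        congr 1
        exact Subtype.ext (funext fun q => DirectSum.decompose_of_mem_ne 𝒢 (g.2 q) hk.symm)
      · intro h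
        exact absurd (Finset.mem_univ _) h)

variable (𝒢) [GradedAlgebra 𝒢] [IsSmall 𝒢]

/-- The one-point `P`-supermanifold `{0}`, of super dimension `(0, 0)`: its sections over `U` are
all functions `U → P`. -/
def pointSpace : SuperSpace.{0, w, w} 𝒢 PUnit.{1} where
  Γ U := U → P
  gr U := funGr 𝒢 U
  comm U i j f g hf hg := funext fun q => IsSmall.comm i j (f q) (g q) (hf q) (hg q)
  ι U := 
    { toFun := fun a _ => a
      map_one' := rfl
      map_mul' := fun _ _ => rfl
      map_zero' := rfl
      map_add' := fun _ _ => rfl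
      commutes' := fun _ => rfl }
  ι_mem U i a ha q := ha
  res {U V} h :=
    { toFun := fun f q => f ⟨q, h q.2⟩
      map_one' := rfl
      map_mul' := fun _ _ => rfl
      map_zero' := rfl
      map_add' := fun _ _ => rfl
      commutes' := fun _ => rfl }
  res_self U f := rfl
  res_res _ _ _ := rfl
  res_mem h i f hf q := hf _
  res_ι _ _ := rfl
  locality U f g h := by
    funext ⟨q, hq⟩
    obtain ⟨i, hi⟩ := Opens.mem_iSup.1 hq
    exact congrFun (h i) ⟨q, hi⟩
  gluing U f h := by
    have hx : ∀ q : (⨆ i, U i : Opens PUnit), ∃ i, (q : PUnit) ∈ U i :=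
      fun q => Opens.mem_iSup.1 q.2
    choose c hc using hx
    refine ⟨fun q => f (c q) ⟨q, hc q⟩, fun i => funext fun q => ?_⟩
    have hq : (q : PUnit) ∈ (⨆ i, U i : Opens PUnit) := Opens.mem_iSup.2 ⟨i, q.2⟩
    exact congrFun (h (c ⟨q, hq⟩) i) ⟨q, hc ⟨q, hq⟩, q.2⟩

variable {𝒢}
variable {ℳ : SuperSpace.{u, w, x} 𝒢 M} {𝒩 : SuperSpace.{v, w, y} 𝒢 N}

/-- The `P`-points of `ℳ`: the `P`-supermorphisms `{0} → ℳ`. -/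
abbrev PPoint (ℳ : SuperSpace.{u, w, x} 𝒢 M) := Hom (pointSpace 𝒢) ℳ

/-- The super tangent space `sT_pℳ = p^* sTℳ` at a `P`-point `p`, as the super derivations
along `p`. -/
abbrev TangentSpaceAt (p : PPoint ℳ) := SDer p ⊤

/-- The body of a `P`-point. -/
def PPoint.pt (p : PPoint ℳ) : M := p.body PUnit.unit

theorem PPoint.mapsInto (p : PPoint ℳ) {U : Opens M} (h : p.pt ∈ U) :
    MapsInto p.body ⊤ U := fun _ _ => h

/-- The value `X(p) = p^* X` at `p` of a super vector field on a neighbourhood of `p`. -/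
def valueAt {U : Opens M} (X : VF ℳ U) (p : PPoint ℳ) (h : p.pt ∈ U) : TangentSpaceAt p :=
  pullVF p X ⊤ (p.mapsInto h)

/-- The value `(∇X)(p)` of the tensor field `∇X`: the map `Y ↦ (∇_Y X)(p)` on the super vector
fields `Y` defined near `p` (it depends on `Y(p)` only). -/
def nablaAt (nab : AffineConnection ℳ) (X : VF ℳ ⊤) (p : PPoint ℳ) :
    ∀ U : Opens M, p.pt ∈ U → VF ℳ U → TangentSpaceAt p :=
  fun U h Y => valueAt (nab.nabla U Y (X.restrict le_top)) p h

/-- The differential `(dΞ)(p) : sT_pℳ → sT_{Ξ(p)}𝒩` of `Ξ` at `p`: `v ↦ v ∘ Ξ^*`. -/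
def differentialAt (Ξ : Hom ℳ 𝒩) (p : PPoint ℳ) (v : TangentSpaceAt p) :
    TangentSpaceAt (Ξ.comp p) where
  comp k V W hU hV := (v.comp k (Opens.comap Ξ.body V) W hU hV.of_comp).comp
    (Ξ.pull V (Opens.comap Ξ.body V) (mapsInto_comap _ _) :
      𝒩.Γ V →+ ℳ.Γ (Opens.comap Ξ.body V))
  comp_mem k V W hU hV i f hf := v.comp_mem _ _ _ _ _ _ _ (Ξ.pull_mem _ _ _ _ _ hf)
  leibniz k V W hU hV i f g hf := by
    have := v.leibniz k (Opens.comap Ξ.body V) W hU hV.of_comp i _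
      (Ξ.pull V (Opens.comap Ξ.body V) (mapsInto_comap _ _) g)
      (Ξ.pull_mem V (Opens.comap Ξ.body V) (mapsInto_comap _ _) _ _ hf)
    rw [← map_mul] at this
    exact this
  comp_ι k V W hU hV a := by
    simp only [AddMonoidHom.comp_apply, AddMonoidHom.coe_coe]
    rw [Ξ.pull_ι, v.comp_ι]
  res_comp k V V' W W' hU hU' h h' hV hW f := by
    have hc : Opens.comap Ξ.body V' ≤ Opens.comap Ξ.body V := fun _ hx => hV hx
    simp only [AddMonoidHom.comp_apply, AddMonoidHom.coe_coe]
    rw [v.res_comp k hU hU' _ h'.of_comp hc hW, Ξ.res_pull _ (mapsInto_comap _ _) hV hc]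

/-- The linearization `(Ξ(p), (dΞ)(p))` of a supermorphism `Ξ : ℳ → 𝒩` at `p`. -/
def linearization (p : PPoint ℳ) (Ξ : Hom ℳ 𝒩) :
    Σ q : PPoint 𝒩, (TangentSpaceAt p → TangentSpaceAt q) :=
  ⟨Ξ.comp p, differentialAt Ξ p⟩

end Points

end

end PSuper

open TopologicalSpace
open scoped Manifold ContDiff TensorProduct

namespace PSuper

universe u v w x y z t

noncomputable section

set_option linter.unusedSectionVars false

/-! ### Small algebras -/

section Small

variable {P : Type w} [Ring P] [Algebra ℝ P]

/-! In charts, each kind of object satisfies a system that expresses all second derivatives, even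
and odd, through the 1-jet. For an affine supermorphism this is the equation with the Christoffel
symbols of both sides (`affine_second`). For an infinitesimally affine field it is the bracket
identity evaluated on coordinate fields (`infinitesimal_controlled`). For an isometry it is the
differentiated Gram equation, solved for the Hessian by the permutation of indices that proves the
Koszul formula (`hessLow_controlled`, `isometric_controlled`). The 1-jet of the difference of two
such objects therefore satisfies a first-order system of total differential equations which is
linear in the sense of an estimate, and Grönwall's inequality along segments gives uniqueness in a
chart. An open-closed argument on the connected body finishes the proof (`hom_eq_of_linearization`,
`vf_eq_zero_of_point`).

Two points go beyond the classical argument. First, the coefficients of the systems are pulled back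
along two different supermorphisms, so the difference of the pullbacks of an arbitrary function must
be estimated by the differences of the coordinates. Hadamard's lemma at the moving body point,
iterated until the remainder lies in a vanishing power of the nilpotent kernel of the body map,
gives this (`close_of_coord`). The estimate is recorded as `Controlled`: the function is an operator
applied to `u`, with a bound that is uniform on compact sets, and the operators preserve the
two-sided ideals contained in the kernel of the body map. Hence Grönwall's argument works modulo
every such ideal (`mem_of_controlled`).

Second, a `P`-point is not an ordinary point: the coordinates take values with nilpotent parts in
`P` there, and the vanishing of `u` at it does not directly give `u x₀ = 0` at its body `x₀`. The
gap is closed by induction on the powers of the maximal ideal of `P` (`eq_zero_of_point`). If `u`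
takes values in the ideal of the fibre generated by the `k`-th power, a Taylor expansion at `x₀`
shows that the projections of `u x₀` to `P` lie in the next power. The equations in the odd
directions make the ideal generated by the entries of `u x₀` stable under the odd partial
derivatives, so that it is contained in the ideal generated by its projection to `P`
(`le_top_mul_map_of_stable`). Thus `u x₀` lies in the next ideal, and Grönwall's argument modulo
that ideal spreads this to all points. -/

/-- A two-sided ideal of a real algebra, as a property of a subspace. -/
def IsTwoSided {F : Type v} [Ring F] [Algebra ℝ F] (J : Submodule ℝ F) : Prop :=
  ∀ a, ∀ f ∈ J, a * f ∈ J ∧ f * a ∈ J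

theorem isTwoSided_ker {F : Type v} [Ring F] [Algebra ℝ F] {B : Type y} [Ring B] [Algebra ℝ B]
    (ε : F →ₐ[ℝ] B) : IsTwoSided (LinearMap.ker ε.toLinearMap) := fun a f hf => by
  have hf' : ε f = 0 := hf
  constructor
  · change ε (a * f) = 0
    rw [map_mul, hf', mul_zero]
  · change ε (f * a) = 0
    rw [map_mul, hf', zero_mul]

/-- The subspace `⊤ * S * ⊤` serves as the two-sided ideal generated by `S`; this lemma and the next
two are its universal property. -/
theorem isTwoSided_top_mul_mul_top {F : Type v} [Ring F] [Algebra ℝ F] (S : Submodule ℝ F) :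
    IsTwoSided (⊤ * S * ⊤) := fun a f hf => by
  have ht : (⊤ : Submodule ℝ F) * ⊤ ≤ ⊤ := le_top
  constructor
  · have h := Submodule.mul_mem_mul (Submodule.mem_top (x := a)) hf
    rw [← mul_assoc, ← mul_assoc] at h
    exact mul_le_mul' (mul_le_mul' ht le_rfl) le_rfl h
  · have h := Submodule.mul_mem_mul hf (Submodule.mem_top (x := a))
    rw [mul_assoc] at h
    exact mul_le_mul' le_rfl ht h

theorem le_top_mul_mul_top {F : Type v} [Ring F] [Algebra ℝ F] (S : Submodule ℝ F) :
    S ≤ ⊤ * S * ⊤ := fun s hs => by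
  have h := Submodule.mul_mem_mul (Submodule.mul_mem_mul (Submodule.mem_top (x := (1 : F))) hs)
    (Submodule.mem_top (x := (1 : F)))
  simpa using h

theorem top_mul_mul_top_le {F : Type v} [Ring F] [Algebra ℝ F] {S J : Submodule ℝ F}
    (hJ : IsTwoSided J) (h : S ≤ J) : ⊤ * S * ⊤ ≤ J := by
  refine Submodule.mul_le.2 fun a ha b _ => (hJ b a ?_).2
  revert a
  change (⊤ * S ≤ J)
  exact Submodule.mul_le.2 fun a _ b hb => (hJ a b (h hb)).1

/-- A chosen body map of a small algebra. -/
def bodyMap (𝒢 : ZMod 2 → Submodule ℝ P) [GradedAlgebra 𝒢] [IsSmall 𝒢] : P →ₐ[ℝ] ℝ :=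
  (IsSmall.body (𝒢 := 𝒢)).choose

/-- The kernel of the body map. -/
def nil (𝒢 : ZMod 2 → Submodule ℝ P) [GradedAlgebra 𝒢] [IsSmall 𝒢] : Submodule ℝ P :=
  LinearMap.ker (bodyMap 𝒢).toLinearMap

variable (𝒢 : ZMod 2 → Submodule ℝ P) [GradedAlgebra 𝒢] [IsSmall 𝒢]

theorem mem_nil {a : P} : a ∈ nil 𝒢 ↔ bodyMap 𝒢 a = 0 := Iff.rfl

/-- A power of a subspace is spanned by the products of its elements, so the condition on products
of `k` elements in `IsSmall` becomes an identity between subspaces. -/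
theorem nil_pow_eq_bot : ∃ k : ℕ, nil 𝒢 ^ k = ⊥ := by
  obtain ⟨k, hk⟩ := (IsSmall.body (𝒢 := 𝒢)).choose_spec
  refine ⟨k, ?_⟩
  rw [Submodule.pow_eq_span_pow_set, Submodule.span_eq_bot]
  intro x hx
  obtain ⟨f, rfl⟩ := Set.mem_pow.1 hx
  exact hk _ fun i => (f i).2

/-- The ideal `𝔫^k` of a small algebra, with `𝔫^0` the whole algebra. -/
def nilPow (k : ℕ) : Submodule ℝ P := nil 𝒢 ^ k * ⊤

theorem nilPow_zero : nilPow 𝒢 0 = ⊤ := by simp [nilPow]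

theorem nilPow_succ (k : ℕ) : nilPow 𝒢 (k + 1) = nil 𝒢 * nilPow 𝒢 k := by
  rw [nilPow, nilPow, pow_succ', mul_assoc]

theorem exists_nilPow_eq_bot : ∃ k : ℕ, nilPow 𝒢 k = ⊥ := by
  obtain ⟨k, hk⟩ := nil_pow_eq_bot 𝒢
  exact ⟨k, by rw [nilPow, hk, Submodule.bot_mul]⟩

theorem isTwoSided_nilPow (k : ℕ) : IsTwoSided (nilPow 𝒢 k) := by
  intro a f hf
  constructor
  · cases k with
    | zero => rw [nilPow_zero]; trivial
    | succ k =>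
      rw [nilPow_succ] at hf ⊢
      have h := Submodule.mul_mem_mul (Submodule.mem_top (x := a)) hf
      rw [← mul_assoc] at h
      refine mul_le_mul' (Submodule.mul_le.2 fun a _ b hb => ?_) le_rfl h
      exact (isTwoSided_ker (bodyMap 𝒢) a b hb).1
  · have h := Submodule.mul_mem_mul hf (Submodule.mem_top (x := a))
    rw [nilPow, mul_assoc] at h
    exact (mul_le_mul' le_rfl le_top : nil 𝒢 ^ k * (⊤ * ⊤) ≤ nil 𝒢 ^ k * ⊤) h

/-- In `nilPow_succ` the new factor stands on the left. Since `P` is only graded commutative, a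
factor on the right needs its own induction; the base case uses that `nil` is two-sided. -/
theorem nilPow_mul_nil_le (k : ℕ) : nilPow 𝒢 k * nil 𝒢 ≤ nilPow 𝒢 (k + 1) := by
  induction k with
  | zero =>
    rw [nilPow_zero, nilPow_succ, nilPow_zero]
    refine Submodule.mul_le.2 fun a _ b hb => ?_
    have h := Submodule.mul_mem_mul ((isTwoSided_ker (bodyMap 𝒢) a b hb).1)
      (Submodule.mem_top (x := (1 : P)))
    rwa [mul_one] at h
  | succ k ih =>
    rw [nilPow_succ, nilPow_succ 𝒢 (k + 1), mul_assoc]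
    exact mul_le_mul' le_rfl ih

theorem nilPow_succ_le (k : ℕ) : nilPow 𝒢 (k + 1) ≤ nil 𝒢 := by
  rw [nilPow_succ]
  exact Submodule.mul_le.2 fun a ha b _ => (isTwoSided_ker (bodyMap 𝒢) b a ha).2

/-- An odd element has square zero, and so does its body, which is a real number. -/
theorem bodyMap_of_mem_odd {a : P} (ha : a ∈ 𝒢 1) : bodyMap 𝒢 a = 0 := by
  have h := IsSmall.comm (𝒢 := 𝒢) 1 1 a a ha ha
  have h2 : a * a + a * a = 0 := by
    nth_rewrite 1 [h]
    simp [sgn]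
  have h3 := congrArg (bodyMap 𝒢) h2
  rw [map_add, map_mul, map_zero] at h3
  nlinarith

end Small

/-! ### Models of the fibre algebra -/

/-- The structure of the graded tensor product `P ⊠ Λ ℝⁿ` on a real algebra `F`: the structure map
`ι` of the `P`-algebra, the odd generators `θ`, the projection `aug` along the ideal they
generate, the parity involution `γ` and the odd partial derivatives `δ`. -/
structure FibreModel {P : Type w} [Ring P] [Algebra ℝ P] (𝒢 : ZMod 2 → Submodule ℝ P) (n : ℕ)
    (F : Type v) [Ring F] [Algebra ℝ F] where
  gr : ZMod 2 → Submodule ℝ F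
  ι : P →ₐ[ℝ] F
  aug : F →ₐ[ℝ] P
  γ : F →ₐ[ℝ] F
  θ : Fin n → F
  δ : Fin n → F →ₗ[ℝ] F
  aug_ι : ∀ a, aug (ι a) = a
  aug_θ : ∀ i, aug (θ i) = 0
  ι_mem : ∀ i, ∀ a ∈ 𝒢 i, ι a ∈ gr i
  θ_mem : ∀ i, θ i ∈ gr 1
  δ_mem : ∀ i j f, f ∈ gr j → δ i f ∈ gr (1 + j)
  γ_of_mem : ∀ i f, f ∈ gr i → γ f = sgn 1 i • f
  sup_gr : gr 0 ⊔ gr 1 = ⊤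
  comm : ∀ i j f g, f ∈ gr i → g ∈ gr j → f * g = sgn i j • (g * f)
  δ_mul : ∀ i f g, δ i (f * g) = δ i f * g + γ f * δ i g
  δ_ι : ∀ i a, δ i (ι a) = 0
  δ_θ : ∀ i j, δ i (θ j) = if i = j then 1 else 0
  adjoin : Algebra.adjoin ℝ (Set.range ι ∪ Set.range θ) = ⊤

namespace FibreModel

variable {P : Type w} [Ring P] [Algebra ℝ P] {𝒢 : ZMod 2 → Submodule ℝ P} {n : ℕ}
variable {F : Type v} [Ring F] [Algebra ℝ F] (𝔐 : FibreModel 𝒢 n F)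

theorem exists_even_add_odd (f : F) : ∃ f₀ ∈ 𝔐.gr 0, ∃ f₁ ∈ 𝔐.gr 1, f₀ + f₁ = f :=
  Submodule.mem_sup.1 (𝔐.sup_gr ▸ Submodule.mem_top : f ∈ 𝔐.gr 0 ⊔ 𝔐.gr 1)

/-- The parity involution collects the Koszul signs, which makes the commutation rule available for
inhomogeneous `f`. -/
theorem θ_mul (i : Fin n) (f : F) : 𝔐.θ i * f = 𝔐.γ f * 𝔐.θ i := by
  obtain ⟨f₀, h₀, f₁, h₁, rfl⟩ := 𝔐.exists_even_add_odd f
  rw [map_add, 𝔐.γ_of_mem _ _ h₀, 𝔐.γ_of_mem _ _ h₁, mul_add, 𝔐.comm _ _ _ _ (𝔐.θ_mem i) h₀,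
    𝔐.comm _ _ _ _ (𝔐.θ_mem i) h₁, add_mul, smul_mul_assoc, smul_mul_assoc]

theorem γ_γ (f : F) : 𝔐.γ (𝔐.γ f) = f := by
  obtain ⟨f₀, h₀, f₁, h₁, rfl⟩ := 𝔐.exists_even_add_odd f
  rw [map_add, 𝔐.γ_of_mem _ _ h₀, 𝔐.γ_of_mem _ _ h₁, map_add, map_zsmul, map_zsmul,
    𝔐.γ_of_mem _ _ h₀, 𝔐.γ_of_mem _ _ h₁, smul_smul, smul_smul, sgn_mul_self, sgn_mul_self,
    one_smul, one_smul]

theorem mul_θ (i : Fin n) (f : F) : f * 𝔐.θ i = 𝔐.θ i * 𝔐.γ f := by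
  rw [θ_mul, γ_γ]

theorem mul_self_of_mem_odd {f : F} (hf : f ∈ 𝔐.gr 1) : f * f = 0 := by
  have h := 𝔐.comm 1 1 f f hf hf
  have h2 : (2 : ℝ) • (f * f) = 0 := by
    rw [two_smul]
    nth_rewrite 1 [h]
    simp [sgn]
  exact (smul_eq_zero.1 h2).resolve_left two_ne_zero

theorem θ_mul_θ (i : Fin n) : 𝔐.θ i * 𝔐.θ i = 0 := 𝔐.mul_self_of_mem_odd (𝔐.θ_mem i)

theorem δ_one (i : Fin n) : 𝔐.δ i 1 = 0 := by
  rw [← map_one 𝔐.ι, 𝔐.δ_ι]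

/-- The algebra endomorphism that puts the odd generator `θ i` equal to zero. -/
def kill (i : Fin n) : F →ₐ[ℝ] F :=
  -- If `f = g + θ i * h` with `g` and `h` free of `θ i`, then `δ i f = h`, and subtracting `θ i * δ
  -- i f` leaves `g`.
  AlgHom.ofLinearMap (LinearMap.id - LinearMap.mulLeft ℝ (𝔐.θ i) ∘ₗ 𝔐.δ i)
    (by simp [δ_one])
    (fun f g => by
      simp only [LinearMap.sub_apply, LinearMap.id_apply, LinearMap.comp_apply,
        LinearMap.mulLeft_apply, 𝔐.δ_mul, mul_add, sub_mul, mul_sub]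
      have h1 : 𝔐.θ i * 𝔐.δ i f * (𝔐.θ i * 𝔐.δ i g) = 0 := by
        rw [mul_assoc, ← mul_assoc (𝔐.δ i f), 𝔐.mul_θ, mul_assoc, ← mul_assoc, θ_mul_θ, zero_mul]
      have h2 : f * (𝔐.θ i * 𝔐.δ i g) = 𝔐.θ i * (𝔐.γ f * 𝔐.δ i g) := by
        rw [← mul_assoc, 𝔐.mul_θ, mul_assoc]
      rw [h1, h2, ← mul_assoc (𝔐.θ i) (𝔐.δ i f)]
      abel)

theorem kill_apply (i : Fin n) (f : F) : 𝔐.kill i f = f - 𝔐.θ i * 𝔐.δ i f := rfl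

theorem kill_ι (i : Fin n) (a : P) : 𝔐.kill i (𝔐.ι a) = 𝔐.ι a := by
  rw [kill_apply, 𝔐.δ_ι, mul_zero, sub_zero]

theorem kill_θ (i j : Fin n) : 𝔐.kill i (𝔐.θ j) = if i = j then 0 else 𝔐.θ j := by
  rw [kill_apply, 𝔐.δ_θ]
  split_ifs with h
  · rw [h, mul_one, sub_self]
  · rw [mul_zero, sub_zero]

/-- Puts the odd generators in the list `l` equal to zero. -/
def killList (l : List (Fin n)) : F →ₐ[ℝ] F :=
  l.foldr (fun i φ => φ.comp (𝔐.kill i)) (AlgHom.id ℝ F)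

theorem killList_cons (i : Fin n) (l : List (Fin n)) (f : F) :
    𝔐.killList (i :: l) f = 𝔐.killList l (𝔐.kill i f) := rfl

theorem killList_ι (l : List (Fin n)) (a : P) : 𝔐.killList l (𝔐.ι a) = 𝔐.ι a := by
  induction l with
  | nil => rfl
  | cons i l ih => rw [killList_cons, kill_ι, ih]

theorem killList_θ (l : List (Fin n)) (j : Fin n) :
    𝔐.killList l (𝔐.θ j) = if j ∈ l then 0 else 𝔐.θ j := by
  induction l with
  | nil => simp [killList]
  | cons i l ih =>
    rw [killList_cons, kill_θ]
    by_cases h : i = j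
    · simp [h]
    · simp [h, ih, Ne.symm h]

/-- Two algebra homomorphisms that agree on the generators: both fix the constants from `P` and
annihilate every `θ i`. -/
theorem killList_finRange : 𝔐.killList (List.finRange n) = 𝔐.ι.comp 𝔐.aug := by
  refine AlgHom.ext_of_adjoin_eq_top 𝔐.adjoin ?_
  rintro _ (⟨a, rfl⟩ | ⟨i, rfl⟩)
  · rw [killList_ι, AlgHom.comp_apply, 𝔐.aug_ι]
  · rw [killList_θ, AlgHom.comp_apply, 𝔐.aug_θ, map_zero, if_pos (List.mem_finRange i)]

/-- A subspace stable under the odd partial derivatives is contained in the ideal generated by its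
projection to `P`. -/
theorem le_top_mul_map_of_stable {I : Submodule ℝ F} (hI : ∀ i, ∀ f ∈ I, 𝔐.δ i f ∈ I) :
    I ≤ ⊤ * I.map (𝔐.ι.comp 𝔐.aug).toLinearMap := by
  rw [← killList_finRange]
  have key : ∀ i, I ≤ ⊤ * I.map (𝔐.kill i).toLinearMap := by
    intro i f hf
    -- Taylor expansion in the single odd variable `θ i`. Its coefficients are the images under
    -- `kill i` of `f` and `δ i f`, both of which lie in `I`.
    have h1 : f = 1 * 𝔐.kill i f + 𝔐.θ i * 𝔐.kill i (𝔐.δ i f) := by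
      rw [kill_apply, kill_apply, one_mul, mul_sub, ← mul_assoc (𝔐.θ i) (𝔐.θ i), θ_mul_θ]
      simp
    rw [h1]
    exact add_mem (Submodule.mul_mem_mul trivial ⟨f, hf, rfl⟩)
      (Submodule.mul_mem_mul trivial ⟨_, hI i f hf, rfl⟩)
  induction List.finRange n with
  | nil =>
    intro f hf
    have h0 : f ∈ I.map (𝔐.killList []).toLinearMap := ⟨f, hf, rfl⟩
    have := Submodule.mul_mem_mul (Submodule.mem_top (x := (1 : F))) h0
    rwa [one_mul] at this
  | cons i l ih =>
    refine ih.trans ?_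
    have h2 : (𝔐.killList (i :: l)).toLinearMap
        = (𝔐.killList l).toLinearMap ∘ₗ (𝔐.kill i).toLinearMap := rfl
    rw [h2, Submodule.map_comp]
    -- The expansion is needed for `I` itself only; it is pushed through `killList l`, so stability
    -- of the intermediate images is never required.
    have h3 := Submodule.map_mono (f := (𝔐.killList l).toLinearMap) (key i)
    rw [Submodule.map_mul] at h3
    refine (mul_le_mul' le_rfl h3).trans ?_
    rw [← mul_assoc]
    exact mul_le_mul' le_top le_rfl

/-- The kernel of `kill i` consists of multiples of `θ i`, hence products of two of its elements
vanish. If the image of `S` under `kill i` has vanishing `k`-th power, then `S ^ k` lies in this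
kernel and `S ^ (2 k)` vanishes. -/
theorem ker_killList_pow (l : List (Fin n)) :
    ∃ k : ℕ, LinearMap.ker (𝔐.killList l).toLinearMap ^ k = ⊥ := by
  induction l with
  | nil => exact ⟨1, by rw [pow_one, LinearMap.ker_eq_bot]; exact Function.injective_id⟩
  | cons i l ih =>
    obtain ⟨k, hk⟩ := ih
    refine ⟨k * 2, ?_⟩
    set S := LinearMap.ker (𝔐.killList (i :: l)).toLinearMap
    have h1 : S.map (𝔐.kill i).toLinearMap ≤ LinearMap.ker (𝔐.killList l).toLinearMap := by
      rintro _ ⟨f, hf, rfl⟩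
      exact hf
    have h2 : S ^ k ≤ LinearMap.ker (𝔐.kill i).toLinearMap := by
      intro f hf
      have h3 : 𝔐.kill i f ∈ (S ^ k).map (𝔐.kill i).toLinearMap := ⟨f, hf, rfl⟩
      rw [Submodule.map_pow] at h3
      have h4 := pow_le_pow_left' h1 k h3
      rwa [hk] at h4
    rw [pow_mul, pow_two, eq_bot_iff]
    refine (mul_le_mul' h2 h2).trans (Submodule.mul_le.2 fun f hf g hg => ?_)
    have e1 : f = 𝔐.θ i * 𝔐.δ i f := sub_eq_zero.1 hf
    have e2 : g = 𝔐.θ i * 𝔐.δ i g := sub_eq_zero.1 hg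
    rw [e1, e2, Submodule.mem_bot, mul_assoc, ← mul_assoc (𝔐.δ i f), 𝔐.mul_θ, mul_assoc,
      ← mul_assoc, θ_mul_θ, zero_mul]

variable [GradedAlgebra 𝒢] [IsSmall 𝒢]

/-- The body map of the fibre algebra. -/
def ε : F →ₐ[ℝ] ℝ := (bodyMap 𝒢).comp 𝔐.aug

/-- Nilpotency comes in two layers: a power of the kernel of `ε` is killed by `aug` because `nil` is
nilpotent, and the kernel of `aug` is nilpotent because finitely many odd generators generate it. -/
theorem ker_ε_pow : ∃ k : ℕ, LinearMap.ker 𝔐.ε.toLinearMap ^ k = ⊥ := by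
  obtain ⟨k, hk⟩ := nil_pow_eq_bot 𝒢
  obtain ⟨l, hl⟩ := 𝔐.ker_killList_pow (List.finRange n)
  refine ⟨k * l, ?_⟩
  set S := LinearMap.ker 𝔐.ε.toLinearMap
  have h1 : S.map 𝔐.aug.toLinearMap ≤ nil 𝒢 := by
    rintro _ ⟨f, hf, rfl⟩
    exact hf
  have h2 : S ^ k ≤ LinearMap.ker (𝔐.killList (List.finRange n)).toLinearMap := by
    intro f hf
    have h3 : 𝔐.aug f ∈ (S ^ k).map 𝔐.aug.toLinearMap := ⟨f, hf, rfl⟩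
    rw [Submodule.map_pow] at h3
    have h4 := pow_le_pow_left' h1 k h3
    rw [hk, Submodule.mem_bot] at h4
    change 𝔐.killList _ f = 0
    rw [killList_finRange, AlgHom.comp_apply, h4, map_zero]
  rw [pow_mul, eq_bot_iff, ← hl]
  exact pow_le_pow_left' h2 l

theorem ε_ι (a : P) : 𝔐.ε (𝔐.ι a) = bodyMap 𝒢 a := by
  rw [ε, AlgHom.comp_apply, 𝔐.aug_ι]

theorem ε_of_mem_odd {f : F} (hf : f ∈ 𝔐.gr 1) : 𝔐.ε f = 0 := by
  have h := congrArg 𝔐.ε (𝔐.mul_self_of_mem_odd hf)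
  rw [map_mul, map_zero] at h
  exact mul_self_eq_zero.1 h

end FibreModel

/-! ### Existence of the model -/

theorem eq_zero_or_eq_one (i : ZMod 2) : i = 0 ∨ i = 1 := by
  revert i; decide

theorem sgn_zero_left (j : ZMod 2) : sgn 0 j = 1 := by
  revert j; decide

theorem sgn_zero_right (j : ZMod 2) : sgn j 0 = 1 := by
  revert j; decide

theorem sgn_one_one : sgn 1 1 = -1 := rfl

/-! ### Signs and contractions in the exterior algebra -/

section Exterior

variable {V : Type v} [AddCommGroup V] [Module ℝ V]

/-- The Leibniz rule for the contraction in the exterior algebra. -/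
theorem contractLeft_mul (d : Module.Dual ℝ V) (b c : ExteriorAlgebra ℝ V) :
    CliffordAlgebra.contractLeft d (b * c) = CliffordAlgebra.contractLeft d b * c
      + CliffordAlgebra.involute b * CliffordAlgebra.contractLeft d c := by
  induction b using CliffordAlgebra.left_induction generalizing c with
  | algebraMap r =>
    rw [CliffordAlgebra.contractLeft_algebraMap_mul, CliffordAlgebra.contractLeft_algebraMap,
      AlgHom.commutes, zero_mul, zero_add]
  | add x y hx hy => simp only [add_mul, map_add, hx, hy]; abel
  | ι_mul x v hx =>
    rw [mul_assoc, CliffordAlgebra.contractLeft_ι_mul, hx, CliffordAlgebra.contractLeft_ι_mul,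
      map_mul, CliffordAlgebra.involute_ι, sub_mul, smul_mul_assoc, mul_add, neg_mul, neg_mul,
      ← mul_assoc, ← mul_assoc]
    abel

theorem mul_ι_eq_ι_mul_involute (b : ExteriorAlgebra ℝ V) (v : V) :
    b * ExteriorAlgebra.ι ℝ v = ExteriorAlgebra.ι ℝ v * CliffordAlgebra.involute b := by
  induction b using ExteriorAlgebra.induction with
  | algebraMap r => rw [AlgHom.commutes, Algebra.commutes]
  | ι x =>
    have h := ExteriorAlgebra.ι_add_mul_swap (R := ℝ) x v
    have h2 := CliffordAlgebra.involute_ι (Q := (0 : QuadraticForm ℝ V)) x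
    change CliffordAlgebra.involute (ExteriorAlgebra.ι ℝ x) = -ExteriorAlgebra.ι ℝ x at h2
    rw [h2, mul_neg]
    exact eq_neg_of_add_eq_zero_left h
  | mul a b ha hb => rw [mul_assoc, hb, ← mul_assoc, ha, mul_assoc, map_mul]
  | add a b ha hb => rw [add_mul, ha, hb, map_add, mul_add]

theorem involute_of_mem (i : ZMod 2) (b : ExteriorAlgebra ℝ V)
    (hb : b ∈ CliffordAlgebra.evenOdd (0 : QuadraticForm ℝ V) i) :
    CliffordAlgebra.involute b = sgn 1 i • b := by
  rcases eq_zero_or_eq_one i with rfl | rfl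
  · rw [sgn_zero_right, one_smul]
    exact CliffordAlgebra.involute_eq_of_mem_even hb
  · rw [sgn_one_one, neg_smul, one_smul]
    exact CliffordAlgebra.involute_eq_of_mem_odd hb

/-- Graded commutativity of the exterior algebra. -/
theorem exterior_mul_comm (i j : ZMod 2) (b c : ExteriorAlgebra ℝ V)
    (hb : b ∈ CliffordAlgebra.evenOdd (0 : QuadraticForm ℝ V) i)
    (hc : c ∈ CliffordAlgebra.evenOdd (0 : QuadraticForm ℝ V) j) :
    b * c = sgn i j • (c * b) := by
  -- Moving `b` past `c` applies the parity involution to `c` once if `b` is odd. This rule is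
  -- compatible with sums and products in `c`, so vectors suffice.
  have key : ∀ c : ExteriorAlgebra ℝ V,
      b * c = (if i = 1 then CliffordAlgebra.involute c else c) * b := by
    intro c
    induction c using ExteriorAlgebra.induction with
    | algebraMap r =>
      rw [AlgHom.commutes, ite_self, Algebra.commutes]
    | ι x =>
      have h2 := CliffordAlgebra.involute_ι (Q := (0 : QuadraticForm ℝ V)) x
      change CliffordAlgebra.involute (ExteriorAlgebra.ι ℝ x) = -ExteriorAlgebra.ι ℝ x at h2
      rw [mul_ι_eq_ι_mul_involute, involute_of_mem i b hb, h2]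
      rcases eq_zero_or_eq_one i with rfl | rfl
      · simp [sgn_zero_right]
      · simp [sgn_one_one]
    | mul a c ha hc =>
      rw [← mul_assoc, ha, mul_assoc, hc, map_mul]
      split_ifs <;> rw [mul_assoc]
    | add a c ha hc =>
      rw [mul_add, ha, hc, map_add]
      split_ifs <;> rw [add_mul]
  rw [key c, involute_of_mem j c hc]
  rcases eq_zero_or_eq_one i with rfl | rfl
  · simp [sgn_zero_left]
  · rw [if_pos rfl, smul_mul_assoc]

/-- Contraction anticommutes with the parity involution, whose eigenspaces are the even and odd
parts. The component of the wrong parity therefore equals its own negative. -/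
theorem contractLeft_mem (d : Module.Dual ℝ V) (j : ZMod 2) (b : ExteriorAlgebra ℝ V)
    (hb : b ∈ CliffordAlgebra.evenOdd (0 : QuadraticForm ℝ V) j) :
    CliffordAlgebra.contractLeft d b ∈ CliffordAlgebra.evenOdd (0 : QuadraticForm ℝ V) (1 + j) := by
  have key : ∀ b : ExteriorAlgebra ℝ V, CliffordAlgebra.involute (CliffordAlgebra.contractLeft d b)
      = - CliffordAlgebra.contractLeft d (CliffordAlgebra.involute b) := by
    intro b
    induction b using CliffordAlgebra.left_induction with
    | algebraMap r => simp
    | add x y hx hy => simp only [map_add, hx, hy]; abel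
    | ι_mul x v hx =>
      rw [CliffordAlgebra.contractLeft_ι_mul, map_sub, map_smul, map_mul, hx, map_mul,
        CliffordAlgebra.involute_ι, neg_mul, neg_mul, LinearMap.map_neg,
        CliffordAlgebra.contractLeft_ι_mul, mul_neg]
      abel
  obtain ⟨c, hc⟩ : ∃ c, c = CliffordAlgebra.contractLeft d b := ⟨_, rfl⟩
  have h1 := key b
  rw [involute_of_mem j b hb, map_zsmul, ← hc] at h1
  rw [← hc]
  have hdec : c ∈ CliffordAlgebra.evenOdd (0 : QuadraticForm ℝ V) 0 ⊔
      CliffordAlgebra.evenOdd (0 : QuadraticForm ℝ V) 1 := by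
    rw [(CliffordAlgebra.evenOdd_isCompl (0 : QuadraticForm ℝ V)).sup_eq_top]; trivial
  obtain ⟨c₀, h₀, c₁, h₁, e⟩ := Submodule.mem_sup.1 hdec
  have i₀ := involute_of_mem 0 c₀ h₀
  have i₁ := involute_of_mem 1 c₁ h₁
  rw [← e, map_add, i₀, i₁] at h1
  rcases eq_zero_or_eq_one j with rfl | rfl
  · have : (2 : ℝ) • c₀ = 0 := by
      rw [two_smul]
      rw [sgn_zero_right, sgn_one_one, one_smul, neg_smul, one_smul, one_smul] at h1
      have h : c₀ + c₀ = c₀ + -c₁ + (c₀ + c₁) := by abel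
      rw [h, h1, neg_add_cancel]
    rw [← e, (smul_eq_zero.1 this).resolve_left two_ne_zero, zero_add]
    exact h₁
  · have : (2 : ℝ) • c₁ = 0 := by
      rw [two_smul]
      rw [sgn_zero_right, sgn_one_one, one_smul, neg_smul, one_smul, neg_smul, one_smul,
        neg_neg] at h1
      have h : c₁ + c₁ = c₀ + c₁ - (c₀ + -c₁) := by abel
      rw [h, h1, sub_self]
    rw [← e, (smul_eq_zero.1 this).resolve_left two_ne_zero, add_zero]
    exact h₀

end Exterior

/-! ### The graded tensor product as a fibre model -/

section Existence

variable {P : Type w} [Ring P] [Algebra ℝ P] (𝒢 : ZMod 2 → Submodule ℝ P) [GradedAlgebra 𝒢]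
variable (n : ℕ)

/-- Translates the sign convention of `GradedTensorProduct` into `sgn`. -/
theorem zpow_smul_eq_sgn {A : Type v} [AddCommGroup A] (i j : ZMod 2) (a : A) :
    (-1 : ℤˣ) ^ (i * j) • a = sgn i j • a := by
  rw [Units.smul_def]
  congr 1
  revert i j
  decide

/-- The parity involution of a superalgebra as a linear map. -/
def parityLin : P →ₗ[ℝ] P := GradedAlgebra.proj 𝒢 0 - GradedAlgebra.proj 𝒢 1

theorem parityLin_of_mem (i : ZMod 2) (a : P) (ha : a ∈ 𝒢 i) : parityLin 𝒢 a = sgn 1 i • a := by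
  rw [parityLin, LinearMap.sub_apply, GradedAlgebra.proj_apply, GradedAlgebra.proj_apply]
  rcases eq_zero_or_eq_one i with rfl | rfl
  · have h0 : DirectSum.decompose 𝒢 a (0 : ZMod 2) = a := DirectSum.decompose_of_mem_same 𝒢 ha
    have h1 : (DirectSum.decompose 𝒢 a (1 : ZMod 2) : P) = 0 :=
      DirectSum.decompose_of_mem_ne 𝒢 ha (by decide)
    rw [h0, h1]
    simp [sgn_zero_right]
  · have h0 : DirectSum.decompose 𝒢 a (1 : ZMod 2) = a := DirectSum.decompose_of_mem_same 𝒢 ha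
    have h1 : (DirectSum.decompose 𝒢 a (0 : ZMod 2) : P) = 0 :=
      DirectSum.decompose_of_mem_ne 𝒢 ha (by decide)
    rw [h0, h1]
    simp [sgn_one_one]

/-- The parity involution of a superalgebra. -/
def parity : P →ₐ[ℝ] P :=
  AlgHom.ofLinearMap (parityLin 𝒢)
    (by rw [parityLin_of_mem 𝒢 0 1 (SetLike.one_mem_graded 𝒢)]; simp [sgn])
    (fun a b => by
      induction a using DirectSum.Decomposition.inductionOn 𝒢 with
      | zero => simp
      | add a a' ha ha' => rw [add_mul, map_add, ha, ha', map_add, add_mul]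
      | @homogeneous i a =>
        induction b using DirectSum.Decomposition.inductionOn 𝒢 with
        | zero => simp
        | add b b' hb hb' => rw [mul_add, map_add, hb, hb', map_add, mul_add]
        | @homogeneous j b =>
          rw [parityLin_of_mem 𝒢 _ _ (SetLike.mul_mem_graded a.2 b.2),
            parityLin_of_mem 𝒢 _ _ a.2, parityLin_of_mem 𝒢 _ _ b.2, sgn_add_right,
            smul_mul_assoc, mul_smul_comm, smul_smul])

theorem parity_of_mem (i : ZMod 2) (a : P) (ha : a ∈ 𝒢 i) : parity 𝒢 a = sgn 1 i • a :=
  parityLin_of_mem 𝒢 i a ha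

theorem tmul_mul_tmul {i j : ZMod 2} (a : P) {b : ExteriorAlgebra ℝ (Fin n → ℝ)}
    (hb : b ∈ extGr n i)
    {a' : P} (ha' : a' ∈ 𝒢 j) (b' : ExteriorAlgebra ℝ (Fin n → ℝ)) :
    (GradedTensorProduct.tmul ℝ a b * GradedTensorProduct.tmul ℝ a' b' : Fibre 𝒢 n)
      = sgn i j • GradedTensorProduct.tmul ℝ (a * a') (b * b') := by
  rw [← zpow_smul_eq_sgn]
  exact GradedTensorProduct.tmul_coe_mul_coe_tmul 𝒢 (extGr n) a ⟨b, hb⟩ ⟨a', ha'⟩ b'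

/-- On pure tensors with homogeneous factors every sign is explicit, and the remaining identities
between signs are finite checks. -/
theorem fibre_induction {p : Fibre 𝒢 n → Prop} (h0 : p 0) (hadd : ∀ x y, p x → p y → p (x + y))
    (h : ∀ (i j : ZMod 2), ∀ a ∈ 𝒢 i, ∀ b ∈ extGr n j, p (GradedTensorProduct.tmul ℝ a b))
    (x : Fibre 𝒢 n) : p x := by
  have key : ∀ y : P ⊗[ℝ] ExteriorAlgebra ℝ (Fin n → ℝ),
    p (GradedTensorProduct.of ℝ 𝒢 (extGr n) y) := by
    intro y
    induction y using TensorProduct.induction_on with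
    | zero => rw [map_zero]; exact h0
    | add y z hy hz => rw [map_add]; exact hadd _ _ hy hz
    | tmul a b =>
      induction a using DirectSum.Decomposition.inductionOn 𝒢 with
      | zero => rw [TensorProduct.zero_tmul, map_zero]; exact h0
      | add a a' ha ha' => rw [TensorProduct.add_tmul, map_add]; exact hadd _ _ ha ha'
      | @homogeneous i a =>
        induction b using DirectSum.Decomposition.inductionOn (extGr n) with
        | zero => rw [TensorProduct.tmul_zero, map_zero]; exact h0
        | add b b' hb hb' => rw [TensorProduct.tmul_add, map_add]; exact hadd _ _ hb hb'
        | @homogeneous j b => exact h i j a a.2 b b.2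
  exact key ((GradedTensorProduct.of ℝ 𝒢 (extGr n)).symm x)

theorem tmul_mem_fibreGr {i j k : ZMod 2} {a : P} (ha : a ∈ 𝒢 i)
    {b : ExteriorAlgebra ℝ (Fin n → ℝ)} (hb : b ∈ extGr n j) (h : i + j = k) :
    GradedTensorProduct.tmul ℝ a b ∈ fibreGr 𝒢 n k :=
  Submodule.subset_span ⟨i, j, h, a, ha, b, hb, rfl⟩

/-- The projection `P ⊠ Λ ℝⁿ → P`. -/
def fibreAug : Fibre 𝒢 n →ₐ[ℝ] P :=
  GradedTensorProduct.lift 𝒢 (extGr n) (AlgHom.id ℝ P)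
    ((Algebra.ofId ℝ P).comp ExteriorAlgebra.algebraMapInv) (by
      intro i j a b
      rw [zpow_smul_eq_sgn]
      simp only [AlgHom.comp_apply, AlgHom.id_apply, Algebra.ofId_apply]
      rw [← Algebra.commutes]
      -- The images must supercommute. An odd `b` has square zero, so its scalar part is zero; an
      -- even `b` produces no sign.
      by_cases hj : j = 1
      · have h1 : ExteriorAlgebra.algebraMapInv (b : ExteriorAlgebra ℝ (Fin n → ℝ)) = 0 := by
          have h2 := exterior_mul_comm 1 1 (b :
            ExteriorAlgebra ℝ (Fin n → ℝ)) b (hj ▸ b.2) (hj ▸ b.2)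
          have h3 := congrArg ExteriorAlgebra.algebraMapInv h2
          simp only [sgn, and_self, if_true, neg_smul, one_smul, map_neg, map_mul] at h3
          nlinarith
        rw [h1, map_zero, zero_mul, smul_zero]
      · have : sgn j i = 1 := by rw [sgn, if_neg (by tauto)]
        rw [this, one_smul])

theorem fibreAug_tmul (a : P) (b : ExteriorAlgebra ℝ (Fin n → ℝ)) :
    fibreAug 𝒢 n (GradedTensorProduct.tmul ℝ a b)
      = a * algebraMap ℝ P (ExteriorAlgebra.algebraMapInv b) :=
  GradedTensorProduct.lift_tmul 𝒢 (extGr n) _ _ _ a b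

/-- The parity involution of `P ⊠ Λ ℝⁿ`. -/
def fibreParity : Fibre 𝒢 n →ₐ[ℝ] Fibre 𝒢 n :=
  GradedTensorProduct.lift 𝒢 (extGr n)
    ((GradedTensorProduct.includeLeft 𝒢 (extGr n)).comp (parity 𝒢))
    ((GradedTensorProduct.includeRight 𝒢 (extGr n)).comp CliffordAlgebra.involute) (by
      intro i j a b
      rw [zpow_smul_eq_sgn]
      simp only [AlgHom.comp_apply]
      rw [parity_of_mem 𝒢 i a a.2, involute_of_mem j _ b.2]
      simp only [map_zsmul, smul_mul_assoc, mul_smul_comm, GradedTensorProduct.includeLeft_apply,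
        GradedTensorProduct.includeRight_apply]
      rw [tmul_mul_tmul 𝒢 n (a : P) (SetLike.one_mem_graded (extGr n)) (SetLike.one_mem_graded 𝒢) b,
        tmul_mul_tmul 𝒢 n 1 b.2 a.2 1]
      simp only [smul_smul, mul_one, one_mul]
      have hs : ∀ i j : ZMod 2, sgn 1 j * (sgn 1 i * sgn 0 0)
          = sgn j i * (sgn 1 i * (sgn 1 j * sgn j i)) := by decide
      rw [hs])

theorem fibreParity_tmul {i j : ZMod 2} {a : P} (ha : a ∈ 𝒢 i)
    {b : ExteriorAlgebra ℝ (Fin n → ℝ)} (hb : b ∈ extGr n j) :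
    fibreParity 𝒢 n (GradedTensorProduct.tmul ℝ a b)
      = sgn 1 (i + j) • GradedTensorProduct.tmul ℝ a b := by
  refine (GradedTensorProduct.lift_tmul 𝒢 (extGr n) _ _ _ a b).trans ?_
  simp only [AlgHom.comp_apply]
  rw [parity_of_mem 𝒢 i a ha, involute_of_mem j _ hb]
  simp only [map_zsmul, smul_mul_assoc, mul_smul_comm, GradedTensorProduct.includeLeft_apply,
    GradedTensorProduct.includeRight_apply]
  rw [tmul_mul_tmul 𝒢 n a (SetLike.one_mem_graded (extGr n)) (SetLike.one_mem_graded 𝒢) b,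
    sgn_add_right, smul_smul, smul_smul, mul_one, one_mul, sgn_zero_left, mul_one, mul_comm]

/-- The odd partial derivatives of `P ⊠ Λ ℝⁿ`. -/
def fibreDeriv (l : Fin n) : Fibre 𝒢 n →ₗ[ℝ] Fibre 𝒢 n :=
  (GradedTensorProduct.of ℝ 𝒢 (extGr n)).toLinearMap ∘ₗ
    -- The odd derivative acts on the right factor and has to pass the left one first; this is the
    -- twist by `parity`.
    TensorProduct.map (parity 𝒢).toLinearMap (CliffordAlgebra.contractLeft (LinearMap.proj l)) ∘ₗ
    (GradedTensorProduct.of ℝ 𝒢 (extGr n)).symm.toLinearMap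

theorem fibreDeriv_tmul (l : Fin n) (a : P) (b : ExteriorAlgebra ℝ (Fin n → ℝ)) :
    fibreDeriv 𝒢 n l (GradedTensorProduct.tmul ℝ a b)
      = GradedTensorProduct.tmul ℝ (parity 𝒢 a) (CliffordAlgebra.contractLeft (LinearMap.proj l) b) :=
  rfl

theorem smul_tmul' (c : ℤ) (a : P) (b : ExteriorAlgebra ℝ (Fin n → ℝ)) :
    (GradedTensorProduct.tmul ℝ (c • a) b : Fibre 𝒢 n) = c • GradedTensorProduct.tmul ℝ a b := by
  rw [GradedTensorProduct.tmul, ← Int.cast_smul_eq_zsmul ℝ, ← TensorProduct.smul_tmul',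
    Int.cast_smul_eq_zsmul, map_zsmul]

theorem tmul_add' (a : P) (b b' : ExteriorAlgebra ℝ (Fin n → ℝ)) :
    (GradedTensorProduct.tmul ℝ a (b + b') : Fibre 𝒢 n)
      = GradedTensorProduct.tmul ℝ a b + GradedTensorProduct.tmul ℝ a b' := by
  rw [GradedTensorProduct.tmul, TensorProduct.tmul_add, map_add]

/-- On homogeneous pure tensors this is the Leibniz rule for the contraction, up to two sign
identities settled by `decide`. -/
theorem fibreDeriv_mul (l : Fin n) (f g : Fibre 𝒢 n) :
    fibreDeriv 𝒢 n l (f * g) = fibreDeriv 𝒢 n l f * g + fibreParity 𝒢 n f * fibreDeriv 𝒢 n l g := by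
  induction f using fibre_induction with
  | h0 => simp
  | hadd x y hx hy => simp only [add_mul, map_add, hx, hy]; abel
  | h i j a ha b hb =>
    induction g using fibre_induction with
    | h0 => simp
    | hadd x y hx hy => simp only [mul_add, map_add, hx, hy]; abel
    | h i' j' a' ha' b' hb' =>
      rw [tmul_mul_tmul 𝒢 n a hb ha', map_zsmul, fibreDeriv_tmul, fibreDeriv_tmul, fibreDeriv_tmul,
        fibreParity_tmul 𝒢 n ha hb, parity_of_mem 𝒢 _ _ ha, parity_of_mem 𝒢 _ _ ha', map_mul,
        parity_of_mem 𝒢 _ _ ha, parity_of_mem 𝒢 _ _ ha', contractLeft_mul, involute_of_mem j b hb]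
      simp only [smul_mul_assoc, mul_smul_comm, smul_tmul']
      rw [tmul_mul_tmul 𝒢 n a (contractLeft_mem _ j b hb) ha', tmul_mul_tmul 𝒢 n a hb ha',
        tmul_add',
        ← Int.cast_smul_eq_zsmul ℝ (sgn 1 j) (b * _), GradedTensorProduct.tmul,
        GradedTensorProduct.tmul, TensorProduct.tmul_smul, map_smul, Int.cast_smul_eq_zsmul]
      simp only [smul_add, smul_smul]
      have hs : ∀ i j i' : ZMod 2, sgn j i' * (sgn 1 i' * sgn 1 i) = sgn 1 i * sgn (1 + j) i' := by
        decide
      have hs' : ∀ i j i' : ZMod 2, sgn j i' * (sgn 1 i' * (sgn 1 i * sgn 1 j))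
          = sgn 1 i' * (sgn 1 (i + j) * sgn j i') := by decide
      rw [hs, hs']

theorem fibreParity_of_mem (k : ZMod 2) (f : Fibre 𝒢 n) (hf : f ∈ fibreGr 𝒢 n k) :
    fibreParity 𝒢 n f = sgn 1 k • f := by
  refine Submodule.span_induction (p := fun f _ => fibreParity 𝒢 n f = sgn 1 k • f)
    ?_ ?_ ?_ ?_ hf
  · rintro _ ⟨i, j, rfl, a, ha, b, hb, rfl⟩
    exact fibreParity_tmul 𝒢 n ha hb
  · simp
  · intro x y _ _ hx hy
    rw [map_add, hx, hy, smul_add]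
  · intro c x _ hx
    rw [map_smul, hx, smul_comm]

theorem fibre_mul_comm [IsSmall 𝒢] (k l : ZMod 2) (f g : Fibre 𝒢 n) (hf : f ∈ fibreGr 𝒢 n k)
    (hg : g ∈ fibreGr 𝒢 n l) : f * g = sgn k l • (g * f) := by
  refine Submodule.span_induction (p := fun f _ => f * g = sgn k l • (g * f)) ?_ ?_ ?_ ?_ hf
  · rintro _ ⟨i, j, rfl, a, ha, b, hb, rfl⟩
    refine Submodule.span_induction (p := fun g _ => GradedTensorProduct.tmul ℝ a b * g
      = sgn (i + j) l • (g * GradedTensorProduct.tmul ℝ a b)) ?_ ?_ ?_ ?_ hg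
    · rintro _ ⟨i', j', rfl, a', ha', b', hb', rfl⟩
      rw [tmul_mul_tmul 𝒢 n a hb ha', tmul_mul_tmul 𝒢 n a' hb' ha, IsSmall.comm i i' a a' ha ha',
        exterior_mul_comm j j' b b' hb hb', smul_tmul',
        ← Int.cast_smul_eq_zsmul ℝ (sgn j j') (b' * _), GradedTensorProduct.tmul,
        GradedTensorProduct.tmul, TensorProduct.tmul_smul, map_smul, Int.cast_smul_eq_zsmul,
        smul_smul, smul_smul, smul_smul]
      have hs : ∀ i j i' j' : ZMod 2, sgn j i' * sgn i i' * sgn j j'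
          = sgn (i + j) (i' + j') * sgn j' i := by decide
      rw [hs]
    · simp
    · intro x y _ _ hx hy
      rw [mul_add, hx, hy, add_mul, smul_add]
    · intro c x _ hx
      rw [mul_smul_comm, hx, smul_mul_assoc, smul_comm]
  · simp
  · intro x y _ _ hx hy
    rw [add_mul, hx, hy, mul_add, smul_add]
  · intro c x _ hx
    rw [smul_mul_assoc, hx, mul_smul_comm, smul_comm]

/-- The model structure on `P ⊠ Λ ℝⁿ`. -/
def fibreModel [IsSmall 𝒢] : FibreModel 𝒢 n (Fibre 𝒢 n) where
  gr := fibreGr 𝒢 n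
  ι := GradedTensorProduct.includeLeft 𝒢 (extGr n)
  aug := fibreAug 𝒢 n
  γ := fibreParity 𝒢 n
  θ i := GradedTensorProduct.tmul ℝ 1 (ExteriorAlgebra.ι ℝ (Pi.single i 1))
  δ := fibreDeriv 𝒢 n
  aug_ι a := by
    rw [GradedTensorProduct.includeLeft_apply]
    exact (fibreAug_tmul 𝒢 n a 1).trans (by simp)
  aug_θ i := by
    rw [fibreAug_tmul]
    simp [ExteriorAlgebra.algebraMapInv]
  ι_mem i a ha := tmul_mem_fibreGr 𝒢 n ha (SetLike.one_mem_graded (extGr n)) (add_zero i)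
  θ_mem i := tmul_mem_fibreGr 𝒢 n (SetLike.one_mem_graded 𝒢)
    (CliffordAlgebra.ι_mem_evenOdd_one _ _) (zero_add 1)
  δ_mem l k f hf := by
    refine Submodule.span_induction (p := fun f _ => fibreDeriv 𝒢 n l f ∈ fibreGr 𝒢 n (1 + k))
      ?_ ?_ ?_ ?_ hf
    · rintro _ ⟨i, j, rfl, a, ha, b, hb, rfl⟩
      rw [fibreDeriv_tmul, parity_of_mem 𝒢 _ _ ha, smul_tmul']
      exact zsmul_mem (tmul_mem_fibreGr 𝒢 n ha (contractLeft_mem _ j b hb) (by ring)) _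
    · rw [map_zero]; exact zero_mem _
    · intro x y _ _ hx hy
      rw [map_add]; exact add_mem hx hy
    · intro c x _ hx
      rw [map_smul]; exact Submodule.smul_mem _ _ hx
  γ_of_mem := fibreParity_of_mem 𝒢 n
  sup_gr := by
    rw [eq_top_iff]
    rintro f -
    induction f using fibre_induction with
    | h0 => exact zero_mem _
    | hadd x y hx hy => exact add_mem hx hy
    | h i j a ha b hb =>
      have h := tmul_mem_fibreGr 𝒢 n ha hb rfl
      revert h
      generalize i + j = k
      intro h
      rcases eq_zero_or_eq_one k with rfl | rfl
      · exact Submodule.mem_sup_left h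
      · exact Submodule.mem_sup_right h
  comm := fibre_mul_comm 𝒢 n
  δ_mul := fibreDeriv_mul 𝒢 n
  δ_ι l a := by
    rw [GradedTensorProduct.includeLeft_apply]
    refine (fibreDeriv_tmul 𝒢 n l a 1).trans ?_
    rw [CliffordAlgebra.contractLeft_one, GradedTensorProduct.tmul, TensorProduct.tmul_zero,
      map_zero]
  δ_θ i j := by
    rw [fibreDeriv_tmul, map_one]
    have := CliffordAlgebra.contractLeft_ι (Q := (0 : QuadraticForm ℝ (Fin n → ℝ)))
      (LinearMap.proj i) (Pi.single j 1)
    refine (congrArg (GradedTensorProduct.tmul ℝ (1 : P)) this).trans ?_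
    by_cases h : i = j
    · subst h
      simp only [LinearMap.proj_apply, Pi.single_eq_same, map_one, if_true]
      rfl
    · simp only [LinearMap.proj_apply, Pi.single_eq_of_ne h, map_zero, if_neg h]
      rw [GradedTensorProduct.tmul, TensorProduct.tmul_zero, map_zero]
  adjoin := by
    rw [eq_top_iff]
    rintro f -
    induction f using fibre_induction with
    | h0 => exact zero_mem _
    | hadd x y hx hy => exact add_mem hx hy
    | h i j a ha b hb =>
      have h1 : (GradedTensorProduct.tmul ℝ a b : Fibre 𝒢 n)
          = GradedTensorProduct.includeLeft 𝒢 (extGr n) a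
            * GradedTensorProduct.includeRight 𝒢 (extGr n) b := by
        simp only [GradedTensorProduct.includeLeft_apply, GradedTensorProduct.includeRight_apply]
        exact (GradedTensorProduct.tmul_one_mul_one_tmul 𝒢 (extGr n) a b).symm
      rw [h1]
      refine mul_mem (Algebra.subset_adjoin (Set.mem_union_left _ (Set.mem_range_self a))) ?_
      clear h1 hb
      induction b using ExteriorAlgebra.induction with
      | algebraMap r => rw [AlgHom.commutes]; exact Subalgebra.algebraMap_mem _ _
      | mul b c hb hc => rw [map_mul]; exact mul_mem hb hc
      | add b c hb hc => rw [map_add]; exact add_mem hb hc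
      | ι v =>
        have hv : v = ∑ i, v i • (Pi.single i 1 : Fin n → ℝ) := by
          ext k
          simp [Finset.sum_apply, Pi.single_apply]
        rw [hv, map_sum, map_sum]
        refine sum_mem fun i _ => ?_
        rw [map_smul, map_smul]
        exact Subalgebra.smul_mem _ (Algebra.subset_adjoin (Set.mem_union_right _ (Set.mem_range_self i))) _

/-- Transport of a model along an isomorphism of algebras. -/
def FibreModel.transport {F : Type v} [Ring F] [Algebra ℝ F] {F' : Type x} [Ring F'] [Algebra ℝ F']
    (𝔐 : FibreModel 𝒢 n F) (e : F ≃ₐ[ℝ] F') : FibreModel 𝒢 n F' where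
  gr i := (𝔐.gr i).map e.toLinearMap
  ι := e.toAlgHom.comp 𝔐.ι
  aug := 𝔐.aug.comp e.symm.toAlgHom
  γ := (e.toAlgHom.comp 𝔐.γ).comp e.symm.toAlgHom
  θ i := e (𝔐.θ i)
  δ i := e.toLinearMap ∘ₗ 𝔐.δ i ∘ₗ e.symm.toLinearMap
  aug_ι a := by
    change 𝔐.aug (e.symm (e (𝔐.ι a))) = a
    rw [e.symm_apply_apply, 𝔐.aug_ι]
  aug_θ i := by
    change 𝔐.aug (e.symm (e (𝔐.θ i))) = 0
    rw [e.symm_apply_apply, 𝔐.aug_θ]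
  ι_mem i a ha := ⟨_, 𝔐.ι_mem i a ha, rfl⟩
  θ_mem i := ⟨_, 𝔐.θ_mem i, rfl⟩
  δ_mem i j := by
    rintro _ ⟨f, hf, rfl⟩
    refine ⟨_, 𝔐.δ_mem i j f hf, ?_⟩
    change e (𝔐.δ i f) = e (𝔐.δ i (e.symm (e f)))
    rw [e.symm_apply_apply]
  γ_of_mem i := by
    rintro _ ⟨f, hf, rfl⟩
    change e (𝔐.γ (e.symm (e f))) = sgn 1 i • e f
    rw [e.symm_apply_apply, 𝔐.γ_of_mem i f hf, map_zsmul]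
  sup_gr := by
    rw [← Submodule.map_sup, 𝔐.sup_gr, Submodule.map_top, LinearMap.range_eq_top]
    exact e.surjective
  comm i j := by
    rintro _ _ ⟨f, hf, rfl⟩ ⟨g, hg, rfl⟩
    change e f * e g = sgn i j • (e g * e f)
    rw [← map_mul, 𝔐.comm i j f g hf hg, map_zsmul, map_mul]
  δ_mul i f g := by
    change e (𝔐.δ i (e.symm (f * g))) = e (𝔐.δ i (e.symm f)) * g
      + e (𝔐.γ (e.symm f)) * e (𝔐.δ i (e.symm g))
    rw [map_mul, 𝔐.δ_mul, map_add, map_mul, map_mul, e.apply_symm_apply]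
  δ_ι i a := by
    change e (𝔐.δ i (e.symm (e (𝔐.ι a)))) = 0
    rw [e.symm_apply_apply, 𝔐.δ_ι, map_zero]
  δ_θ i j := by
    change e (𝔐.δ i (e.symm (e (𝔐.θ j)))) = _
    rw [e.symm_apply_apply, 𝔐.δ_θ]
    split_ifs <;> simp
  adjoin := by
    have h := congrArg (Subalgebra.map e.toAlgHom) 𝔐.adjoin
    rw [AlgHom.map_adjoin, Set.image_union, ← Set.range_comp, ← Set.range_comp,
      Algebra.map_top] at h
    refine Eq.trans ?_ (h.trans ((AlgHom.range_eq_top _).2 e.surjective))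
    rfl

instance finite_exterior : Module.Finite ℝ (ExteriorAlgebra ℝ (Fin n → ℝ)) :=
  Module.Finite.of_basis (Module.Basis.ExteriorAlgebra (Pi.basisFun ℝ (Fin n)))

attribute [local instance] Matrix.linftyOpNormedRing Matrix.linftyOpNormedAlgebra in
/-- The algebra `P ⊠ Λ ℝⁿ` is isomorphic to a finite-dimensional normed algebra. -/
theorem exists_normed_model [IsSmall 𝒢] :
    ∃ (F : Type) (_ : NormedRing F) (_ : NormedAlgebra ℝ F) (_ : FiniteDimensional ℝ F)
      (𝔐 : FibreModel 𝒢 n F) (e : Fibre 𝒢 n ≃ₐ[ℝ] F),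
      (∀ k f, f ∈ fibreGr 𝒢 n k ↔ e f ∈ 𝔐.gr k) ∧
      ∀ a, e (GradedTensorProduct.tmul ℝ a 1) = 𝔐.ι a := by
  have : FiniteDimensional ℝ P := IsSmall.finite 𝒢
  have : FiniteDimensional ℝ (Fibre 𝒢 n) :=
    Module.Finite.equiv (GradedTensorProduct.of ℝ 𝒢 (extGr n))
  have b := Module.finBasis ℝ (Fibre 𝒢 n)
  -- The left regular representation embeds the algebra into a real matrix algebra, from which the
  -- image inherits a submultiplicative norm. The image also lives in `Type`, whatever the universe
  -- of `P`.
  have e := AlgEquiv.ofInjective _ (Algebra.leftMulMatrix_injective b)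
  refine ⟨_, inferInstance, inferInstance, ?_, (fibreModel 𝒢 n).transport 𝒢 n e, e, ?_, ?_⟩
  · exact Module.Finite.equiv e.toLinearEquiv
  · intro k f
    constructor
    · exact fun h => ⟨f, h, rfl⟩
    · rintro ⟨g, hg, h⟩
      rwa [← e.injective h]
  · intro a
    rfl

end Existence

/-! ### Hadamard's lemma with parameters -/

section Hadamard

/-- Differentiation under the integral sign; the derivative is dominated by its bound on the compact
product of a closed ball and the unit interval. -/
theorem hasFDerivAt_integral_param {H : Type} [NormedAddCommGroup H] [NormedSpace ℝ H]
    [FiniteDimensional ℝ H] {E : Type} [NormedAddCommGroup E] [NormedSpace ℝ E]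
    {f : H × ℝ → E} (hf : ContDiff ℝ ∞ f) (x : H) :
    HasFDerivAt (fun x => ∫ t in (0 : ℝ)..1, f (x, t))
      (∫ t in (0 : ℝ)..1, (fderiv ℝ f (x, t)).comp (ContinuousLinearMap.inl ℝ H ℝ)) x := by
  have hc : Continuous f := hf.continuous
  have hd : Continuous (fderiv ℝ f) := hf.continuous_fderiv (by simp)
  have hd' : Continuous fun p : H × ℝ => (fderiv ℝ f p).comp (ContinuousLinearMap.inl ℝ H ℝ) := by
    fun_prop
  have hK : IsCompact (Metric.closedBall x 1 ×ˢ Set.Icc (0 : ℝ) 1) :=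
    (isCompact_closedBall x 1).prod isCompact_Icc
  obtain ⟨C, hC⟩ := (hK.image hd').isBounded.exists_norm_le
  refine intervalIntegral.hasFDerivAt_integral_of_dominated_of_fderiv_le (s := Metric.closedBall x 1)
    (bound := fun _ => C) (F := fun x t => f (x, t))
    (F' := fun x t => (fderiv ℝ f (x, t)).comp (ContinuousLinearMap.inl ℝ H ℝ))
    (Metric.closedBall_mem_nhds x one_pos) ?_ ?_ ?_ ?_ ?_ ?_
  · exact Filter.Eventually.of_forall fun y =>
      (hc.comp (by fun_prop : Continuous fun t : ℝ => (y, t))).aestronglyMeasurable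
  · exact (hc.comp (by fun_prop : Continuous fun t : ℝ => (x, t))).intervalIntegrable _ _
  · exact (hd'.comp (by fun_prop : Continuous fun t : ℝ => (x, t))).aestronglyMeasurable
  · refine Filter.Eventually.of_forall fun t ht y hy => ?_
    rw [Set.uIoc_of_le zero_le_one] at ht
    exact hC _ ⟨(y, t), ⟨hy, ht.1.le, ht.2⟩, rfl⟩
  · exact intervalIntegrable_const
  · refine Filter.Eventually.of_forall fun t _ y _ => ?_
    have h1 : HasFDerivAt f (fderiv ℝ f (y, t)) (y, t) :=
      (hf.differentiable (by simp) _).hasFDerivAt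
    have h2 : HasFDerivAt (fun y : H => (y, t)) (ContinuousLinearMap.inl ℝ H ℝ) y :=
      hasFDerivAt_prodMk_left y t
    exact h1.comp y h2

/-- The derivative of a parameter integral is again a parameter integral, with values in a space of
linear maps. This is why the target space `E` varies in the induction. -/
theorem contDiff_nat_integral_param {H : Type} [NormedAddCommGroup H] [NormedSpace ℝ H]
    [FiniteDimensional ℝ H] (n : ℕ) : ∀ {E : Type} [NormedAddCommGroup E] [NormedSpace ℝ E]
    {f : H × ℝ → E}, ContDiff ℝ ∞ f → ContDiff ℝ n (fun x => ∫ t in (0 : ℝ)..1, f (x, t)) := by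
  induction n with
  | zero =>
    intro E _ _ f hf
    refine contDiff_zero.2 ?_
    exact intervalIntegral.continuous_parametric_intervalIntegral_of_continuous'
      (f := fun x t => f (x, t)) hf.continuous 0 1
  | succ n ih =>
    intro E _ _ f hf
    rw [Nat.cast_add, Nat.cast_one, contDiff_succ_iff_fderiv]
    refine ⟨fun x => (hasFDerivAt_integral_param hf x).differentiableAt, by simp, ?_⟩
    have : fderiv ℝ (fun x => ∫ t in (0 : ℝ)..1, f (x, t)) = fun x =>
        ∫ t in (0 : ℝ)..1, (fderiv ℝ f (x, t)).comp (ContinuousLinearMap.inl ℝ H ℝ) :=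
      funext fun x => (hasFDerivAt_integral_param hf x).fderiv
    rw [this]
    have hd : ContDiff ℝ ∞ (fderiv ℝ f) := (contDiff_infty_iff_fderiv.1 hf).2
    exact ih (f := fun p => (fderiv ℝ f p).comp (ContinuousLinearMap.inl ℝ H ℝ)) (by fun_prop)

theorem contDiff_integral_param {H : Type} [NormedAddCommGroup H] [NormedSpace ℝ H]
    [FiniteDimensional ℝ H] {E : Type} [NormedAddCommGroup E] [NormedSpace ℝ E]
    {f : H × ℝ → E} (hf : ContDiff ℝ ∞ f) :
    ContDiff ℝ ∞ (fun x => ∫ t in (0 : ℝ)..1, f (x, t)) :=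
  contDiff_infty.2 fun n => contDiff_nat_integral_param n hf

/-- The Euclidean space of dimension `m`. -/
abbrev Euc (m : ℕ) := EuclideanSpace ℝ (Fin m)

/-- The `i`-th standard basis vector. -/
abbrev stdVec {m : ℕ} (i : Fin m) : Euc m := EuclideanSpace.single i 1

theorem eq_sum_stdVec {m : ℕ} (x : Euc m) : x = ∑ i, x i • stdVec i := by
  ext k
  simp [Finset.sum_apply, Pi.single_apply]

/-- Hadamard's lemma with a parameter. -/
theorem hadamard {r : ℕ} {G : Euc r × Euc r → ℝ} (hG : ContDiff ℝ ∞ G) :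
    ∃ H : Fin r → Euc r × Euc r → ℝ, (∀ i, ContDiff ℝ ∞ (H i)) ∧
      ∀ a y, G (a, y) = G (a, a) + ∑ i, (y i - a i) * H i (a, y) := by
  have hd : ContDiff ℝ ∞ (fderiv ℝ G) := (contDiff_infty_iff_fderiv.1 hG).2
  have hp : ContDiff ℝ ∞ fun p : (Euc r × Euc r) × ℝ =>
      (p.1.1, p.1.1 + p.2 • (p.1.2 - p.1.1)) := by fun_prop
  -- The partial derivative of `G` in the second argument, at the point with parameter `p.2` of the
  -- segment from `(a, a)` to `(a, y)`. Its integral over the segment is smooth in `a` and `y`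
  -- jointly, which permits moving base points later.
  let D : Fin r → (Euc r × Euc r) × ℝ → ℝ := fun i p =>
    fderiv ℝ G (p.1.1, p.1.1 + p.2 • (p.1.2 - p.1.1)) (0, stdVec i)
  have hD : ∀ i, ContDiff ℝ ∞ (D i) := fun i => (hd.comp hp).clm_apply contDiff_const
  refine ⟨fun i z => ∫ t in (0 : ℝ)..1, D i (z, t), fun i => contDiff_integral_param (hD i), ?_⟩
  intro a y
  have hder : ∀ t : ℝ, HasDerivAt (fun t : ℝ => G (a, a + t • (y - a)))
      (∑ i, (y i - a i) * D i ((a, y), t)) t := by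
    intro t
    have h1 : HasFDerivAt G (fderiv ℝ G (a, a + t • (y - a))) (a, a + t • (y - a)) :=
      (hG.differentiable (by simp) _).hasFDerivAt
    have h2 : HasDerivAt (fun t : ℝ => (a, a + t • (y - a))) (0, y - a) t := by
      refine (hasDerivAt_const t a).prodMk ?_
      simpa using ((hasDerivAt_id t).smul_const (y - a)).const_add a
    have h3 := h1.comp_hasDerivAt t h2
    have h4 : ((0 : Euc r), y - a) = ∑ i, (y i - a i) • ((0 : Euc r), stdVec i) := by
      rw [Prod.ext_iff]
      simp only [Prod.fst_sum, Prod.snd_sum, Prod.smul_fst, Prod.smul_snd, smul_zero,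
        Finset.sum_const_zero, true_and]
      exact eq_sum_stdVec (y - a)
    rw [h4, map_sum] at h3
    have h5 : ∑ i, fderiv ℝ G (a, a + t • (y - a)) ((y i - a i) • ((0 : Euc r), stdVec i))
        = ∑ i, (y i - a i) * D i ((a, y), t) :=
      Finset.sum_congr rfl fun i _ => by rw [map_smul, smul_eq_mul]
    rw [h5] at h3
    exact h3
  have hcont : ∀ i, Continuous fun t : ℝ => D i ((a, y), t) := fun i =>
    (hD i).continuous.comp (by fun_prop)
  have hint := intervalIntegral.integral_eq_sub_of_hasDerivAt (a := 0) (b := 1)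
    (fun t _ => hder t) (Continuous.intervalIntegrable (by fun_prop) _ _)
  rw [intervalIntegral.integral_finsetSum (f := fun i t => (y i - a i) * D i ((a, y), t))
    fun i _ => (continuous_const.mul (hcont i)).intervalIntegrable _ _] at hint
  simp only [intervalIntegral.integral_const_mul, one_smul, zero_smul, add_zero,
    add_sub_cancel] at hint
  rw [hint]
  ring

end Hadamard

/-! ### Controlled functions -/

section Controlled

variable {F : Type v} [NormedRing F] [NormedAlgebra ℝ F] (ε : F →ₐ[ℝ] ℝ)

/-- The operators `F^L → F` that preserve all two-sided ideals contained in the kernel of `ε`. -/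
def preserving (L : Type) [Fintype L] : Submodule ℝ ((L → F) →L[ℝ] F) where
  carrier := {Λ | ∀ J : Submodule ℝ F, IsTwoSided J → J ≤ LinearMap.ker ε.toLinearMap →
    ∀ v : L → F, (∀ l, v l ∈ J) → Λ v ∈ J}
  add_mem' h h' J hJ hε v hv := add_mem (h J hJ hε v hv) (h' J hJ hε v hv)
  zero_mem' J _ _ _ _ := zero_mem J
  smul_mem' c _ h J hJ hε v hv := Submodule.smul_mem _ c (h J hJ hε v hv)

variable {L : Type} [Fintype L] {T : Type y} [TopologicalSpace T]

/-- The function `f` is locally uniformly a combination of the functions `u l` and `ε ∘ u l`. -/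
def Controlled (u : T → L → F) (f : T → F) : Prop :=
  ∀ K : Set T, IsCompact K → ∃ C : ℝ, ∀ z ∈ K, ∃ Λ ∈ preserving ε L, ‖Λ‖ ≤ C ∧ f z = Λ (u z)

variable {ε} {u : T → L → F} {f g : T → F}

theorem Controlled.add (hf : Controlled ε u f) (hg : Controlled ε u g) :
    Controlled ε u (fun z => f z + g z) := fun K hK => by
  obtain ⟨C, hC⟩ := hf K hK
  obtain ⟨C', hC'⟩ := hg K hK
  refine ⟨C + C', fun z hz => ?_⟩
  obtain ⟨Λ, h1, h2, h3⟩ := hC z hz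
  obtain ⟨Λ', h1', h2', h3'⟩ := hC' z hz
  exact ⟨Λ + Λ', add_mem h1 h1', (ContinuousLinearMap.opNorm_add_le Λ Λ').trans (add_le_add h2 h2'),
    congrArg₂ (· + ·) h3 h3'⟩

theorem controlled_zero : Controlled ε u (fun _ => 0) := fun _ _ =>
  ⟨0, fun _ _ => ⟨0, zero_mem _, ContinuousLinearMap.opNorm_zero.le, rfl⟩⟩

theorem Controlled.sum {ι : Type*} {s : Finset ι} {f : ι → T → F}
    (h : ∀ i ∈ s, Controlled ε u (f i)) : Controlled ε u (fun z => ∑ i ∈ s, f i z) := by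
  classical
  induction s using Finset.induction_on with
  | empty => simpa using controlled_zero
  | insert a s ha ih =>
    simp only [Finset.sum_insert ha]
    exact (h a (Finset.mem_insert_self _ _)).add (ih fun i hi => h i (Finset.mem_insert_of_mem hi))

theorem Controlled.mul_left {a : T → F} (ha : Continuous a) (hf : Controlled ε u f) :
    Controlled ε u (fun z => a z * f z) := fun K hK => by
  obtain ⟨C, hC⟩ := hf K hK
  obtain ⟨A, hA⟩ := (hK.image ha).isBounded.exists_norm_le
  refine ⟨A * C, fun z hz => ?_⟩
  obtain ⟨Λ, h1, h2, h3⟩ := hC z hz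
  refine ⟨(ContinuousLinearMap.mul ℝ F (a z)).comp Λ, ?_, ?_, ?_⟩
  · exact fun J hJ hε v hv => (hJ (a z) _ (h1 J hJ hε v hv)).1
  · have hz' := hA _ ⟨z, hz, rfl⟩
    refine (ContinuousLinearMap.opNorm_comp_le _ _).trans ?_
    have := ContinuousLinearMap.opNorm_mul_apply_le ℝ F (a z)
    exact mul_le_mul (this.trans hz') h2 (norm_nonneg _) ((norm_nonneg _).trans hz')
  · exact congrArg (a z * ·) h3

theorem Controlled.mul_right {a : T → F} (ha : Continuous a) (hf : Controlled ε u f) :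
    Controlled ε u (fun z => f z * a z) := fun K hK => by
  obtain ⟨C, hC⟩ := hf K hK
  obtain ⟨A, hA⟩ := (hK.image ha).isBounded.exists_norm_le
  refine ⟨A * C, fun z hz => ?_⟩
  obtain ⟨Λ, h1, h2, h3⟩ := hC z hz
  refine ⟨((ContinuousLinearMap.mul ℝ F).flip (a z)).comp Λ, ?_, ?_, ?_⟩
  · exact fun J hJ hε v hv => (hJ (a z) _ (h1 J hJ hε v hv)).2
  · have hz' := hA _ ⟨z, hz, rfl⟩
    refine (ContinuousLinearMap.opNorm_comp_le _ _).trans ?_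
    have : ‖(ContinuousLinearMap.mul ℝ F).flip (a z)‖ ≤ ‖a z‖ :=
      ContinuousLinearMap.opNorm_le_bound _ (norm_nonneg _) fun y => by
        rw [mul_comm]; exact norm_mul_le _ _
    exact mul_le_mul (this.trans hz') h2 (norm_nonneg _) ((norm_nonneg _).trans hz')
  · exact congrArg (· * a z) h3

theorem Controlled.smul (c : ℝ) (hf : Controlled ε u f) : Controlled ε u (fun z => c • f z) := by
  have := hf.mul_left (continuous_const (y := algebraMap ℝ F c))
  simpa only [← Algebra.smul_def] using this

theorem Controlled.zsmul (c : ℤ) (hf : Controlled ε u f) : Controlled ε u (fun z => c • f z) := by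
  simpa only [Int.cast_smul_eq_zsmul] using hf.smul (c : ℝ)

theorem Controlled.neg (hf : Controlled ε u f) : Controlled ε u (fun z => - f z) := by
  simpa using hf.zsmul (-1)

theorem Controlled.sub (hf : Controlled ε u f) (hg : Controlled ε u g) :
    Controlled ε u (fun z => f z - g z) := by
  simpa only [sub_eq_add_neg] using hf.add hg.neg

theorem controlled_coord (l : L) : Controlled ε u (fun z => u z l) := fun _ _ =>
  ⟨‖ContinuousLinearMap.proj (R := ℝ) (φ := fun _ : L => F) l‖, fun _ _ =>
    ⟨ContinuousLinearMap.proj l, fun _ _ _ _ hv => hv l, le_rfl, rfl⟩⟩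

theorem Controlled.eq_zero (hf : Controlled ε u f) {z : T} (hz : u z = 0) : f z = 0 := by
  obtain ⟨C, hC⟩ := hf {z} isCompact_singleton
  obtain ⟨Λ, -, -, h⟩ := hC z rfl
  rw [h, hz, map_zero]

theorem Controlled.mem (hf : Controlled ε u f) {J : Submodule ℝ F} (hJ : IsTwoSided J)
    (hε : J ≤ LinearMap.ker ε.toLinearMap) {z : T} (hz : ∀ l, u z l ∈ J) : f z ∈ J := by
  obtain ⟨C, hC⟩ := hf {z} isCompact_singleton
  obtain ⟨Λ, h1, -, h⟩ := hC z rfl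
  rw [h]
  exact h1 J hJ hε _ hz

/-- A solution of a controlled linear system of total differential equations with initial value in
an ideal takes values in the ideal. -/
theorem mem_of_controlled [FiniteDimensional ℝ F] {m : ℕ} {u : Euc m → L → F}
    (hu : ∀ l, ContDiff ℝ ∞ fun z => u z l)
    (h : ∀ i l, Controlled ε u fun z => fderiv ℝ (fun z => u z l) z (stdVec i))
    {J : Submodule ℝ F} (hJ : IsTwoSided J) (hε : J ≤ LinearMap.ker ε.toLinearMap) {z₀ : Euc m}
    (h₀ : ∀ l, u z₀ l ∈ J) (z : Euc m) (l : L) : u z l ∈ J := by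
  -- A linear section of the quotient map gives a projection `π` of `F` with kernel exactly `J`;
  -- membership in `J` becomes the equation `π a = 0`, to which Grönwall's inequality applies.
  obtain ⟨σ,
    hσ⟩ := J.mkQ.exists_rightInverse_of_surjective (LinearMap.range_eq_top.2 J.mkQ_surjective)
  obtain ⟨π, hπ⟩ : ∃ π : F →L[ℝ] F, ∀ a, π a = σ (J.mkQ a) :=
    ⟨(σ ∘ₗ J.mkQ).toContinuousLinearMap, fun _ => rfl⟩
  have hπ0 : ∀ a ∈ J, π a = 0 := fun a ha => by
    rw [hπ, (Submodule.Quotient.mk_eq_zero J).2 ha |> fun h => (h : J.mkQ a = 0), map_zero]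
  have hπ1 : ∀ a, a - π a ∈ J := fun a => by
    rw [← Submodule.Quotient.mk_eq_zero, ← Submodule.mkQ_apply, map_sub, hπ]
    have := LinearMap.congr_fun hσ (J.mkQ a)
    rw [LinearMap.comp_apply, LinearMap.id_apply] at this
    rw [this, sub_self]
  have hπ2 : ∀ a, π a = 0 → a ∈ J := fun a ha => by
    have := hπ1 a
    rwa [ha, sub_zero] at this
  let c : ℝ → Euc m := fun t => z₀ + t • (z - z₀)
  have hc : Continuous c := by fun_prop
  have hK := isCompact_Icc (a := (0 : ℝ)) (b := 1) |>.image hc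
  choose C hC using fun i l => h i l _ hK
  have hC0 : ∀ i l, 0 ≤ C i l := fun i l => by
    obtain ⟨Λ, -, h2, -⟩ := hC i l (c 0) ⟨0, by simp, rfl⟩
    exact (ContinuousLinearMap.opNorm_nonneg Λ).trans h2
  -- A crude Lipschitz constant: the sum over all entries dominates the bound for each single one.
  let B : ℝ := ∑ i, ∑ l, |(z - z₀) i| * (‖π‖ * C i l)
  let f : ℝ → L → F := fun t l => π (u (c t) l)
  let f' : ℝ → L → F := fun t l => π (fderiv ℝ (fun z => u z l) (c t) (z - z₀))
  have hder : ∀ t, HasDerivAt f (f' t) t := by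
    intro t
    refine hasDerivAt_pi.2 fun l => ?_
    have h1 : HasFDerivAt (fun z => u z l) (fderiv ℝ (fun z => u z l) (c t)) (c t) :=
      ((hu l).differentiable (by simp) _).hasFDerivAt
    have h2 : HasDerivAt c (z - z₀) t := by
      have h3 := ((hasDerivAt_id t).smul_const (z - z₀)).const_add z₀
      rwa [one_smul] at h3
    exact π.hasFDerivAt.comp_hasDerivAt t (h1.comp_hasDerivAt t h2)
  have hbound : ∀ t ∈ Set.Ico (0 : ℝ) 1, ‖f' t‖ ≤ B * ‖f t‖ := by
    intro t ht
    have hBl : ∀ l, ∑ i, |(z - z₀) i| * (‖π‖ * C i l) ≤ B := fun l => by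
      refine Finset.sum_le_sum fun i _ => ?_
      exact Finset.single_le_sum (f := fun l => |(z - z₀) i| * (‖π‖ * C i l))
        (fun l _ => mul_nonneg (abs_nonneg _) (mul_nonneg (norm_nonneg _) (hC0 i l)))
        (Finset.mem_univ l)
    have hB0 : 0 ≤ B := Finset.sum_nonneg fun i _ => Finset.sum_nonneg fun l _ =>
      mul_nonneg (abs_nonneg _) (mul_nonneg (norm_nonneg _) (hC0 i l))
    refine (pi_norm_le_iff_of_nonneg (mul_nonneg hB0 (norm_nonneg _))).2 fun l => ?_
    have e1 : f' t l = ∑ i, (z - z₀) i • π (fderiv ℝ (fun z => u z l) (c t) (stdVec i)) := by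
      change π (fderiv ℝ (fun z => u z l) (c t) (z - z₀)) = _
      nth_rewrite 1 [eq_sum_stdVec (z - z₀)]
      rw [map_sum, map_sum]
      exact Finset.sum_congr rfl fun i _ => by rw [map_smul, map_smul]
    rw [e1]
    refine (norm_sum_le _ _).trans (le_trans ?_ (mul_le_mul_of_nonneg_right (hBl l) (norm_nonneg _)))
    rw [Finset.sum_mul]
    refine Finset.sum_le_sum fun i _ => ?_
    rw [norm_smul, Real.norm_eq_abs, mul_assoc]
    refine mul_le_mul_of_nonneg_left ?_ (abs_nonneg _)
    obtain ⟨Λ, h1, h2, h3⟩ := hC i l (c t) ⟨t, ⟨ht.1, ht.2.le⟩, rfl⟩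
    -- The differential inequality closes modulo `J`: the operator `Λ` maps `u - π u`, which has
    -- entries in `J`, into `J`, and `π` annihilates the result.
    have e2 : π (Λ (u (c t))) = π (Λ (f t)) := by
      rw [← sub_eq_zero, ← map_sub, ← map_sub]
      exact hπ0 _ (h1 J hJ hε _ fun l => hπ1 _)
    have h4 : fderiv ℝ (fun z => u z l) (c t) (stdVec i) = Λ (u (c t)) := h3
    rw [h4, e2, mul_assoc]
    refine (π.le_opNorm _).trans (mul_le_mul_of_nonneg_left ?_ (norm_nonneg _))
    exact (Λ.le_opNorm _).trans (mul_le_mul_of_nonneg_right h2 (norm_nonneg _))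
  have hf0 : f 0 = 0 := funext fun l => hπ0 _ (by simpa [c] using h₀ l)
  -- Grönwall's inequality with zero initial value, along the segment from `z₀` to `z`.
  have := eq_zero_of_abs_deriv_le_mul_abs_self_of_eq_zero_right
    (fun t _ => (hder t).continuousAt.continuousWithinAt)
    (fun t _ => (hder t).hasDerivWithinAt) hf0 hbound 1 (by simp)
  have h1 : π (u (c 1) l) = 0 := congrFun this l
  have hc1 : c 1 = z := by simp [c]
  rw [hc1] at h1
  exact hπ2 _ h1

end Controlled

/-! ### Algebras of smooth functions with values in a finite-dimensional algebra -/

section SmoothAlg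

/-- The algebra of smooth functions on `ℝʳ` with values in `F`. -/
def smoothAlg (r : ℕ) (F : Type v) [NormedRing F] [NormedAlgebra ℝ F] :
    Subalgebra ℝ (Euc r → F) where
  carrier := {f | ContDiff ℝ ∞ f}
  mul_mem' {f g} (hf : ContDiff ℝ ∞ f) (hg : ContDiff ℝ ∞ g) := hf.mul hg
  add_mem' {f g} (hf : ContDiff ℝ ∞ f) (hg : ContDiff ℝ ∞ g) := hf.add hg
  algebraMap_mem' c := (contDiff_const : ContDiff ℝ ∞ fun _ : Euc r => algebraMap ℝ F c)

variable {r : ℕ} {F : Type v} [NormedRing F] [NormedAlgebra ℝ F]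

theorem smoothAlg.contDiff (f : smoothAlg r F) : ContDiff ℝ ∞ (f : Euc r → F) := f.2

/-- Real functions as functions with values in `F`. -/
def ofReal : smoothAlg r ℝ →ₐ[ℝ] smoothAlg r F where
  toFun g := ⟨fun z => algebraMap ℝ F (g.1 z),
    (algebraMapCLM ℝ F).contDiff.comp (smoothAlg.contDiff g)⟩
  map_one' := Subtype.ext (funext fun _ => map_one _)
  map_mul' _ _ := Subtype.ext (funext fun _ => map_mul _ _ _)
  map_zero' := Subtype.ext (funext fun _ => map_zero _)
  map_add' _ _ := Subtype.ext (funext fun _ => map_add _ _ _)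
  commutes' _ := rfl

theorem ofReal_apply (g : smoothAlg r ℝ) (z : Euc r) :
    (ofReal g : smoothAlg r F).1 z = algebraMap ℝ F (g.1 z) := rfl

/-- Constant functions. -/
def constFn (r : ℕ) : F →ₐ[ℝ] smoothAlg r F where
  toFun w := ⟨fun _ => w, (contDiff_const : ContDiff ℝ ∞ fun _ : Euc r => w)⟩
  map_one' := rfl
  map_mul' _ _ := rfl
  map_zero' := rfl
  map_add' _ _ := rfl
  commutes' _ := rfl

/-- The coordinate functions. -/
def coordFn (i : Fin r) : smoothAlg r ℝ := ⟨fun z => z i, by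
  change ContDiff ℝ ∞ fun z : Euc r => z i
  fun_prop⟩

/-- Composition with a linear functional. -/
def compLin [FiniteDimensional ℝ F] {F' : Type w} [NormedRing F'] [NormedAlgebra ℝ F']
    (l : F →ₗ[ℝ] F') (f : smoothAlg r F) : smoothAlg r F' :=
  ⟨fun z => l (f.1 z), l.toContinuousLinearMap.contDiff.comp (smoothAlg.contDiff f)⟩

/-- Separates scalar functions from constants: a homomorphism or derivation only has to be studied
on `ofReal`, where Hadamard's lemma applies, and on `constFn`, where algebra generators suffice. -/
theorem smoothAlg_eq_sum [FiniteDimensional ℝ F] {I : Type*} [Fintype I] (b : Module.Basis I ℝ F)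
    (f : smoothAlg r F) : f = ∑ l, ofReal (compLin (b.coord l) f) * constFn r (b l) := by
  refine Subtype.ext (funext fun z => ?_)
  have h := (b.sum_repr (f.1 z)).symm
  rw [AddSubmonoidClass.coe_finsetSum, Finset.sum_apply]
  refine h.trans (Finset.sum_congr rfl fun l _ => ?_)
  exact Algebra.smul_def _ _

theorem hadamard_smoothAlg (g : smoothAlg r ℝ) (a : Euc r) :
    ∃ H : Fin r → smoothAlg r ℝ, g = algebraMap ℝ _ (g.1 a)
      + ∑ i, (coordFn i - algebraMap ℝ _ (a i)) * H i := by
  have hg : ContDiff ℝ ∞ fun p :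
    Euc r × Euc r => g.1 p.2 := (smoothAlg.contDiff g).comp contDiff_snd
  obtain ⟨H, hH, h⟩ := hadamard hg
  refine ⟨fun i => ⟨fun z => H i (a, z), (hH i).comp (contDiff_const.prodMk contDiff_id)⟩,
    Subtype.ext (funext fun z => ?_)⟩
  rw [Subalgebra.coe_add, AddSubmonoidClass.coe_finsetSum, Pi.add_apply, Finset.sum_apply]
  exact h a z

theorem hadamard_smoothAlg_vec [FiniteDimensional ℝ F] (f : smoothAlg r F) (a : Euc r) :
    ∃ H : Fin r → smoothAlg r F, f = constFn r (f.1 a)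
      + ∑ i, ofReal (coordFn i - algebraMap ℝ _ (a i)) * H i := by
  let b := Module.finBasis ℝ F
  choose H hH using fun l => hadamard_smoothAlg (compLin (b.coord l) f) a
  refine ⟨fun i => ∑ l, ofReal (H l i) * constFn r (b l), ?_⟩
  have h1 : f = ∑ l, ofReal (algebraMap ℝ _ ((compLin (b.coord l) f).1 a)
      + ∑ i, (coordFn i - algebraMap ℝ _ (a i)) * H l i) * constFn r (b l) := by
    conv_lhs => rw [smoothAlg_eq_sum b f]
    exact Finset.sum_congr rfl fun l _ => by rw [← hH l]
  have h2 : constFn r (f.1 a) = ∑ l, ofReal (algebraMap ℝ _ ((compLin (b.coord l) f).1 a))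
      * constFn r (b l) := by
    refine Subtype.ext (funext fun z => ?_)
    have := congrArg (fun f => f.1 a) (smoothAlg_eq_sum b f)
    simp only [AddSubmonoidClass.coe_finsetSum, Finset.sum_apply] at this ⊢
    exact this
  rw [h2]
  conv_lhs => rw [h1]
  simp only [map_add, add_mul, Finset.sum_add_distrib, map_sum, map_mul, Finset.sum_mul,
    Finset.mul_sum, mul_assoc]
  rw [Finset.sum_comm]

end SmoothAlg

/-! ### Powers of the kernel of the body map -/

section Nilpotent

variable {F : Type v} [Ring F] [Algebra ℝ F] (ε : F →ₐ[ℝ] ℝ)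

/-- The ideal `𝔯^k`, where `𝔯` is the kernel of `ε`, with `𝔯^0` the whole algebra. -/
def kerPow (k : ℕ) : Submodule ℝ F := LinearMap.ker ε.toLinearMap ^ k * ⊤

theorem mem_kerPow_zero (f : F) : f ∈ kerPow ε 0 := by simp [kerPow]

theorem mul_mem_kerPow {k : ℕ} {a f : F} (ha : ε a = 0) (hf : f ∈ kerPow ε k) :
    a * f ∈ kerPow ε (k + 1) := by
  rw [kerPow, pow_succ', mul_assoc]
  exact Submodule.mul_mem_mul ha hf

theorem eq_zero_of_mem_kerPow (hε : ∃ k : ℕ, LinearMap.ker ε.toLinearMap ^ k = ⊥) {f : F}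
    (h : ∀ k, f ∈ kerPow ε k) : f = 0 := by
  obtain ⟨k, hk⟩ := hε
  have := h k
  rwa [kerPow, hk, Submodule.bot_mul, Submodule.mem_bot] at this

end Nilpotent

/-! ### Derivations are determined by their values on coordinates -/

section Derivation

variable {P : Type w} [Ring P] [Algebra ℝ P] {𝒢 : ZMod 2 → Submodule ℝ P} {n r : ℕ}
variable {F : Type v} [NormedRing F] [NormedAlgebra ℝ F] [FiniteDimensional ℝ F]
  (𝔐 : FibreModel 𝒢 n F)
variable {B : Type x} [Ring B] [Algebra ℝ B] {ε : B →ₐ[ℝ] ℝ}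

/-- A derivation along a homomorphism vanishes if it vanishes on constants and coordinates. -/
theorem derivation_eq_zero (hε : ∃ k : ℕ, LinearMap.ker ε.toLinearMap ^ k = ⊥)
    (φ : smoothAlg r F →ₐ[ℝ] B) (σ : smoothAlg r F → B) {b : Euc r}
    (hb : ∀ g, ε (φ (ofReal g)) = g.1 b) (hσ : ∀ g, σ (ofReal g) = φ (ofReal g))
    (D : smoothAlg r F →+ B) (hD : ∀ f g, D (f * g) = D f * φ g + σ f * D g)
    (h1 : ∀ a, D (constFn r (𝔐.ι a)) = 0) (h2 : ∀ j, D (constFn r (𝔐.θ j)) = 0)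
    (h3 : ∀ i, D (ofReal (coordFn i)) = 0) (f : smoothAlg r F) : D f = 0 := by
  have hreal : ∀ c : ℝ, D (ofReal (algebraMap ℝ _ c)) = 0 := fun c => by
    have : (ofReal (algebraMap ℝ _ c) : smoothAlg r F) = constFn r (𝔐.ι (algebraMap ℝ P c)) := by
      simp only [AlgHom.commutes]
    rw [this, h1]
  have hconst : ∀ w, D (constFn r w) = 0 := by
    intro w
    have hw : w ∈ Algebra.adjoin ℝ (Set.range 𝔐.ι ∪ Set.range 𝔐.θ) := by
      rw [𝔐.adjoin]; trivial
    induction hw using Algebra.adjoin_induction with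
    | mem x hx =>
      rcases hx with ⟨a, rfl⟩ | ⟨j, rfl⟩
      exacts [h1 a, h2 j]
    | algebraMap c =>
      rw [← AlgHom.commutes 𝔐.ι]
      exact h1 _
    | add x y _ _ hx hy => rw [map_add, map_add, hx, hy, add_zero]
    | mul x y _ _ hx hy => rw [map_mul, hD, hx, hy, zero_mul, mul_zero, add_zero]
  -- Hadamard's lemma at the body point `b` turns `D g` into a sum of terms `φ (x i - b i) * D (H
  -- i)`, whose first factor lies in the kernel of `ε`. The bound for all functions at level `k`
  -- thus gives the bound at level `k + 1`, and nilpotency ends the induction.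
  have hofReal : ∀ k, ∀ g, D (ofReal g) ∈ kerPow ε k := by
    intro k
    induction k with
    | zero => exact fun g => mem_kerPow_zero ε _
    | succ k ih =>
      intro g
      obtain ⟨H, hH⟩ := hadamard_smoothAlg g b
      rw [hH, map_add, map_add, hreal, zero_add, map_sum, map_sum]
      refine sum_mem fun i _ => ?_
      rw [map_mul, hD, map_sub, map_sub, h3, hreal, sub_zero, zero_mul, zero_add, ← map_sub, hσ]
      refine mul_mem_kerPow ε ?_ (ih _)
      rw [hb]
      exact sub_self _
  have hofReal' : ∀ g, D (ofReal g) = 0 := fun g =>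
    eq_zero_of_mem_kerPow ε hε fun k => hofReal k g
  rw [smoothAlg_eq_sum (Module.finBasis ℝ F) f, map_sum]
  refine Finset.sum_eq_zero fun l _ => ?_
  rw [hD, hofReal', hconst, zero_mul, mul_zero, add_zero]

end Derivation

/-! ### Homomorphisms are controlled by their values on coordinates -/

section HomControl

variable {P : Type w} [Ring P] [Algebra ℝ P] {𝒢 : ZMod 2 → Submodule ℝ P} {n r : ℕ}
variable {F : Type v} [NormedRing F] [NormedAlgebra ℝ F] [FiniteDimensional ℝ F]
  (𝔐 : FibreModel 𝒢 n F)
variable {B : Type x} [NormedRing B] [NormedAlgebra ℝ B] [FiniteDimensional ℝ B] {ε : B →ₐ[ℝ] ℝ}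
variable {L : Type} [Fintype L] {T : Type y} [TopologicalSpace T] {u : T → L → B}

/-- This operation is the reason why `preserving` tests only ideals inside the kernel of `ε`: on
vectors with entries in such an ideal, taking the body after `Λ` gives zero. -/
theorem Controlled.body {f : T → B} (hf : Controlled ε u f) :
    Controlled ε u (fun z => algebraMap ℝ B (ε (f z))) := fun K hK => by
  obtain ⟨C, hC⟩ := hf K hK
  let S : B →L[ℝ] B := (Algebra.linearMap ℝ B ∘ₗ ε.toLinearMap).toContinuousLinearMap
  refine ⟨‖S‖ * C, fun z hz => ?_⟩
  obtain ⟨Λ, h1, h2, h3⟩ := hC z hz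
  refine ⟨S.comp Λ, fun J hJ hε v hv => ?_, ?_, ?_⟩
  · have h : ε (Λ v) = 0 := hε (h1 J hJ hε v hv)
    have : S (Λ v) = 0 := by
      change algebraMap ℝ B (ε (Λ v)) = 0
      rw [h, map_zero]
    rw [ContinuousLinearMap.comp_apply, this]
    exact zero_mem J
  · exact (ContinuousLinearMap.opNorm_comp_le _ _).trans
      (mul_le_mul_of_nonneg_left h2 (norm_nonneg _))
  · rw [ContinuousLinearMap.comp_apply, ← h3]
    rfl

variable (ε u) in
/-- Continuous functions with controlled difference. -/
structure Close (a b : T → B) : Prop where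
  left : Continuous a
  right : Continuous b
  diff : Controlled ε u fun z => a z - b z

theorem Close.refl {a : T → B} (ha : Continuous a) : Close ε u a a :=
  ⟨ha, ha, by simpa only [sub_self] using controlled_zero⟩

theorem Close.add {a b a' b' : T → B} (h : Close ε u a b) (h' : Close ε u a' b') :
    Close ε u (fun z => a z + a' z) (fun z => b z + b' z) :=
  ⟨h.left.add h'.left, h.right.add h'.right, by
    have := h.diff.add h'.diff
    convert this using 2 with z
    abel⟩

theorem Close.sub {a b a' b' : T → B} (h : Close ε u a b) (h' : Close ε u a' b') :
    Close ε u (fun z => a z - a' z) (fun z => b z - b' z) :=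
  ⟨h.left.sub h'.left, h.right.sub h'.right, by
    have := h.diff.sub h'.diff
    convert this using 2 with z
    abel⟩

/-- The difference of the products is `a (a' - b') + (a - b) b'`. Continuity of `a` and `b'` bounds
the coefficients on compact sets, which is why `Close` records it. -/
theorem Close.mul {a b a' b' : T → B} (h : Close ε u a b) (h' : Close ε u a' b') :
    Close ε u (fun z => a z * a' z) (fun z => b z * b' z) :=
  ⟨h.left.mul h'.left, h.right.mul h'.right, by
    have := (h'.diff.mul_left h.left).add (h.diff.mul_right h'.right)
    convert this using 2 with z
    simp only [mul_sub, sub_mul]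
    abel⟩

theorem Close.sum {ι : Type*} {s : Finset ι} {a b : ι → T → B}
    (h : ∀ i ∈ s, Close ε u (a i) (b i)) :
    Close ε u (fun z => ∑ i ∈ s, a i z) (fun z => ∑ i ∈ s, b i z) :=
  ⟨continuous_finsetSum _ fun i hi => (h i hi).left,
    continuous_finsetSum _ fun i hi => (h i hi).right, by
    simpa only [Finset.sum_sub_distrib] using Controlled.sum fun i hi => (h i hi).diff⟩

theorem continuous_body : Continuous ε := ε.toLinearMap.continuous_of_finiteDimensional

theorem Close.body {a b : T → B} (h : Close ε u a b) :
    Close ε u (fun z => algebraMap ℝ B (ε (a z))) (fun z => algebraMap ℝ B (ε (b z))) :=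
  ⟨(continuous_algebraMap ℝ B).comp (continuous_body.comp h.left),
    (continuous_algebraMap ℝ B).comp (continuous_body.comp h.right), by
    simpa only [map_sub] using h.diff.body⟩

/-- Smooth functions of close bodies are close. -/
theorem close_comp {b b' : T → Euc r}
    (hb : ∀ i, Close ε u (fun z => algebraMap ℝ B (b z i)) (fun z => algebraMap ℝ B (b' z i)))
    (hc : Continuous b) (hc' : Continuous b') {g : Euc r → ℝ} (hg : ContDiff ℝ ∞ g) :
    Close ε u (fun z => algebraMap ℝ B (g (b z))) (fun z => algebraMap ℝ B (g (b' z))) := by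
  refine ⟨(continuous_algebraMap ℝ B).comp (hg.continuous.comp hc),
    (continuous_algebraMap ℝ B).comp (hg.continuous.comp hc'), ?_⟩
  -- Hadamard's lemma with base point `b' z` and argument `b z`; joint smoothness of `H` makes the
  -- coefficients continuous in `z`.
  obtain ⟨H, hH, h⟩ := hadamard (hg.comp contDiff_snd : ContDiff ℝ ∞ fun p : Euc r × Euc r => g p.2)
  have : ∀ z, algebraMap ℝ B (g (b z)) - algebraMap ℝ B (g (b' z))
      = ∑ i, (algebraMap ℝ B (b z i) - algebraMap ℝ B (b' z i))
        * algebraMap ℝ B (H i (b' z, b z)) := fun z => by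
    have h1 := h (b' z) (b z)
    simp only [Function.comp_apply] at h1
    rw [h1]
    simp only [map_add, map_sum, map_mul, map_sub]
    abel
  simp only [this]
  exact Controlled.sum fun i _ => (hb i).diff.mul_right
    ((continuous_algebraMap ℝ B).comp ((hH i).continuous.comp (hc'.prodMk hc)))

/-- Two families of homomorphisms that are close on coordinates are close on all functions. -/
theorem close_of_coord (hε : ∃ k : ℕ, LinearMap.ker ε.toLinearMap ^ k = ⊥)
    (φ ψ : T → smoothAlg r F →ₐ[ℝ] B) (ι : P → B) {b b' : T → Euc r}
    (hb : ∀ z g, ε (φ z (ofReal g)) = g.1 (b z)) (hb' : ∀ z g, ε (ψ z (ofReal g)) = g.1 (b' z))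
    (hφ : ∀ f, Continuous fun z => φ z f) (hψ : ∀ f, Continuous fun z => ψ z f)
    (h1 : ∀ z a, φ z (constFn r (𝔐.ι a)) = ι a) (h1' : ∀ z a, ψ z (constFn r (𝔐.ι a)) = ι a)
    (h2 : ∀ j, Controlled ε u fun z => φ z (constFn r (𝔐.θ j)) - ψ z (constFn r (𝔐.θ j)))
    (h3 : ∀ i, Controlled ε u fun z => φ z (ofReal (coordFn i)) - ψ z (ofReal (coordFn i)))
    (f : smoothAlg r F) : Close ε u (fun z => φ z f) (fun z => ψ z f) := by
  have hy : ∀ i,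
    Close ε u (fun z => φ z (ofReal (coordFn i))) (fun z => ψ z (ofReal (coordFn i))) :=
    fun i => ⟨hφ _, hψ _, h3 i⟩
  have hbi : ∀ i, Close ε u (fun z => algebraMap ℝ B (b z i)) (fun z => algebraMap ℝ B (b' z i)) :=
    fun i => by
      have := (hy i).body
      simp only [hb, hb'] at this
      exact this
  have hbc : Continuous b := by
    refine (PiLp.continuous_toLp 2 _).comp (continuous_pi fun i => ?_)
    have := continuous_body (ε := ε) |>.comp (hφ (ofReal (coordFn i)))
    simp only [Function.comp_def, hb] at this
    exact this
  have hbc' : Continuous b' := by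
    refine (PiLp.continuous_toLp 2 _).comp (continuous_pi fun i => ?_)
    have := continuous_body (ε := ε) |>.comp (hψ (ofReal (coordFn i)))
    simp only [Function.comp_def, hb'] at this
    exact this
  have hconst : ∀ w, Close ε u (fun z => φ z (constFn r w)) (fun z => ψ z (constFn r w)) := by
    intro w
    have hw : w ∈ Algebra.adjoin ℝ (Set.range 𝔐.ι ∪ Set.range 𝔐.θ) := by
      rw [𝔐.adjoin]; trivial
    have hι : ∀ a, Close ε u (fun z => φ z (constFn r (𝔐.ι a)))
        (fun z => ψ z (constFn r (𝔐.ι a))) := fun a => by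
      simp only [h1, h1']
      exact Close.refl continuous_const
    induction hw using Algebra.adjoin_induction with
    | mem x hx =>
      rcases hx with ⟨a, rfl⟩ | ⟨j, rfl⟩
      exacts [hι a, ⟨hφ _, hψ _, h2 j⟩]
    | algebraMap c =>
      rw [← AlgHom.commutes 𝔐.ι]
      exact hι _
    | add x y _ _ hx hy => simpa only [map_add] using hx.add hy
    | mul x y _ _ hx hy => simpa only [map_mul] using hx.mul hy
  -- the second argument of `G` restricted to the bodies
  let slice : ∀ {G : Euc r × Euc r → ℝ}, ContDiff ℝ ∞ G → Euc r → smoothAlg r ℝ := fun {G} hG a =>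
    ⟨fun y => G (a, y), hG.comp (contDiff_const.prodMk contDiff_id)⟩
  -- Modulo the `k`-th power of the kernel of `ε`, the value of a homomorphism on a function is a
  -- Taylor polynomial in its values on the coordinates minus their bodies, with coefficients smooth
  -- in the body. Such expressions are visibly close for `φ` and `ψ`. Since the remainder functions
  -- depend on the base point, the induction must treat functions `G` of base point and argument.
  have key : ∀ k : ℕ, ∀ (G : Euc r × Euc r → ℝ) (hG : ContDiff ℝ ∞ G), ∃ a a' : T → B,
      Close ε u a a' ∧ ∀ z, φ z (ofReal (slice hG (b z))) - a z ∈ kerPow ε k ∧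
        ψ z (ofReal (slice hG (b' z))) - a' z ∈ kerPow ε k := by
    intro k
    induction k with
    | zero =>
      exact fun G hG => ⟨fun _ => 0, fun _ => 0, Close.refl continuous_const,
        fun z => ⟨mem_kerPow_zero ε _, mem_kerPow_zero ε _⟩⟩
    | succ k ih =>
      intro G hG
      obtain ⟨H, hH, h⟩ := hadamard hG
      choose a a' ha hm using fun i => ih (H i) (hH i)
      have hs : ∀ c : Euc r, slice hG c = algebraMap ℝ _ (G (c, c))
          + ∑ i, (coordFn i - algebraMap ℝ _ (c i)) * slice (hH i) c := fun c => by
        refine Subtype.ext (funext fun y => ?_)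
        rw [Subalgebra.coe_add, AddSubmonoidClass.coe_finsetSum, Pi.add_apply, Finset.sum_apply]
        exact h c y
      -- One step of the expansion: the previous error is multiplied by a coordinate minus its body,
      -- an element of the kernel of `ε`.
      have step : ∀ (χ : smoothAlg r F →ₐ[ℝ] B) (c : Euc r) (e : Fin r → B),
          (∀ g, ε (χ (ofReal g)) = g.1 c) →
          (∀ i, χ (ofReal (slice (hH i) c)) - e i ∈ kerPow ε k) →
          χ (ofReal (slice hG c)) - (algebraMap ℝ B (G (c, c))
            + ∑ i, (χ (ofReal (coordFn i)) - algebraMap ℝ B (c i)) * e i) ∈ kerPow ε (k + 1) := by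
        intro χ c e hχ he
        rw [hs c]
        simp only [map_add, map_sum, map_mul, map_sub, AlgHom.commutes]
        rw [add_sub_add_left_eq_sub, ← Finset.sum_sub_distrib]
        refine sum_mem fun i _ => ?_
        rw [← mul_sub]
        refine mul_mem_kerPow ε ?_ (he i)
        rw [map_sub, hχ, AlgHom.commutes]
        exact sub_self _
      refine ⟨_, _, ?_, fun z => ⟨step (φ z) (b z) (fun i => a i z) (hb z) fun i => (hm i z).1,
        step (ψ z) (b' z) (fun i => a' i z) (hb' z) fun i => (hm i z).2⟩⟩
      refine Close.add (close_comp hbi hbc hbc' (g := fun c => G (c, c))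
        (hG.comp (contDiff_id.prodMk contDiff_id))) (Close.sum fun i _ => ?_)
      exact ((hy i).sub (hbi i)).mul (ha i)
  have hreal : ∀ g, Close ε u (fun z => φ z (ofReal g)) (fun z => ψ z (ofReal g)) := by
    intro g
    obtain ⟨k, hk⟩ := hε
    -- The function `g`, regarded as independent of the base point; at the nilpotency exponent the
    -- Taylor polynomial is exact.
    have hG : ContDiff ℝ ∞ fun p :
      Euc r × Euc r => g.1 p.2 := (smoothAlg.contDiff g).comp contDiff_snd
    obtain ⟨a, a', h, hm⟩ := key k _ hG
    rw [kerPow, hk, Submodule.bot_mul] at hm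
    have e1 : (fun z => φ z (ofReal g)) = a := funext fun z => sub_eq_zero.1 (hm z).1
    have e2 : (fun z => ψ z (ofReal g)) = a' := funext fun z => sub_eq_zero.1 (hm z).2
    rwa [e1, e2]
  rw [smoothAlg_eq_sum (Module.finBasis ℝ F) f]
  simp only [map_sum, map_mul]
  exact Close.sum fun l _ => (hreal _).mul (hconst _)

end HomControl

/-! ### Controlled systems at a `P`-point -/

section Point

variable {P : Type w} [Ring P] [Algebra ℝ P] (𝒢 : ZMod 2 → Submodule ℝ P) [GradedAlgebra 𝒢]
  [IsSmall 𝒢] {n m : ℕ}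
variable {F : Type v} [NormedRing F] [NormedAlgebra ℝ F] [FiniteDimensional ℝ F]
  (𝔐 : FibreModel 𝒢 n F)

namespace FibreModel

/-- The ideal of the fibre algebra generated by the `k`-th power of the maximal ideal of `P`. -/
def idl (k : ℕ) : Submodule ℝ F := ⊤ * (nilPow 𝒢 k).map 𝔐.ι.toLinearMap * ⊤

theorem isTwoSided_idl (k : ℕ) : IsTwoSided (𝔐.idl 𝒢 k) := isTwoSided_top_mul_mul_top _

theorem exists_idl_eq_bot : ∃ k, 𝔐.idl 𝒢 k = ⊥ := by
  obtain ⟨k, hk⟩ := exists_nilPow_eq_bot 𝒢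
  exact ⟨k, by rw [idl, hk, Submodule.map_bot, Submodule.mul_bot, Submodule.bot_mul]⟩

theorem idl_zero : 𝔐.idl 𝒢 0 = ⊤ := by
  rw [idl, nilPow_zero, eq_top_iff]
  intro f _
  have h : (1 : F) ∈ (⊤ : Submodule ℝ P).map 𝔐.ι.toLinearMap := ⟨1, trivial, map_one 𝔐.ι⟩
  have := Submodule.mul_mem_mul (Submodule.mul_mem_mul (Submodule.mem_top (x := f)) h)
    (Submodule.mem_top (x := (1 : F)))
  rwa [mul_one, mul_one] at this

theorem idl_induction {k : ℕ} {p : F → Prop} (h : ∀ a b c, b ∈ nilPow 𝒢 k → p (a * 𝔐.ι b * c))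
    (hadd : ∀ f g, p f → p g → p (f + g)) {f : F} (hf : f ∈ 𝔐.idl 𝒢 k) : p f := by
  refine Submodule.mul_induction_on hf (fun f hf c _ => ?_) hadd
  refine Submodule.mul_induction_on hf ?_ (fun f g hf hg => by rw [add_mul]; exact hadd _ _ hf hg)
  rintro a - _ ⟨b, hb, rfl⟩
  exact h a b c hb

theorem idl_succ_le (k : ℕ) : 𝔐.idl 𝒢 (k + 1) ≤ LinearMap.ker 𝔐.ε.toLinearMap := by
  refine top_mul_mul_top_le (isTwoSided_ker _) ?_
  rintro _ ⟨a, ha, rfl⟩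
  exact (𝔐.ε_ι a).trans (nilPow_succ_le 𝒢 k ha)

end FibreModel

variable {𝒢}
variable {L : Type} [Fintype L]

/-- A smooth solution of a controlled system of total differential equations, in the even and odd
directions, vanishes if its value at a `P`-point vanishes. -/
theorem eq_zero_of_point (χ : smoothAlg m F →ₐ[ℝ] P) {x₀ : Euc m}
    (hx : ∀ g, bodyMap 𝒢 (χ (ofReal g)) = g.1 x₀) (h1 : ∀ a, χ (constFn m (𝔐.ι a)) = a)
    (h2 : ∀ j, bodyMap 𝒢 (χ (constFn m (𝔐.θ j))) = 0)
    (u : L → smoothAlg m F) (hγ : ∀ l z, ∃ c : ℤ, 𝔐.γ ((u l).1 z) = c • (u l).1 z)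
    (heven : ∀ i l, Controlled 𝔐.ε (fun z l => (u l).1 z)
      fun z => fderiv ℝ (u l).1 z (stdVec i))
    (hodd : ∀ j l, Controlled 𝔐.ε (fun z l => (u l).1 z) fun z => 𝔐.δ j ((u l).1 z))
    (hu : ∀ l, χ (u l) = 0) (l : L) : u l = 0 := by
  -- Two homomorphisms to `ℝ` that agree on the generators: on constants from `P` by `h1`, and on `θ
  -- j` because both values are zero.
  have hconst : ∀ w, bodyMap 𝒢 (χ (constFn m w)) = 𝔐.ε w := by
    have : ((bodyMap 𝒢).comp χ).comp (constFn m) = 𝔐.ε := by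
      refine AlgHom.ext_of_adjoin_eq_top 𝔐.adjoin ?_
      rintro _ (⟨a, rfl⟩ | ⟨j, rfl⟩)
      · simp only [AlgHom.comp_apply]
        rw [h1, 𝔐.ε_ι]
      · simp only [AlgHom.comp_apply]
        rw [h2, 𝔐.ε_of_mem_odd (𝔐.θ_mem j)]
    exact fun w => DFunLike.congr_fun this w
  have hmem : ∀ k, ∀ w ∈ 𝔐.idl 𝒢 k, χ (constFn m w) ∈ nilPow 𝒢 k := fun k w hw =>
    𝔐.idl_induction 𝒢 (p := fun w => χ (constFn m w) ∈ nilPow 𝒢 k) (fun a b c hb => by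
      rw [map_mul, map_mul, map_mul, map_mul, h1]
      exact (isTwoSided_nilPow 𝒢 k _ _ (isTwoSided_nilPow 𝒢 k _ _ hb).1).2)
      (fun f g hf hg => by rw [map_add, map_add]; exact add_mem hf hg) hw
  -- On constants `χ` and `aug` have the same body, so they differ by nilpotents. On a product `a *
  -- ι b * c` with `b` in the `k`-th power, both differences carry the factor `b` as well and gain
  -- one order.
  have hdiff : ∀ k, ∀ w ∈ 𝔐.idl 𝒢 k, χ (constFn m w) - 𝔐.aug w ∈ nilPow 𝒢 (k + 1) :=
    fun k w hw => by
    have hn : ∀ a, χ (constFn m a) - 𝔐.aug a ∈ nil 𝒢 := fun a => by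
      rw [mem_nil, map_sub, hconst]
      exact sub_self _
    refine 𝔐.idl_induction 𝒢 (p := fun w => χ (constFn m w) - 𝔐.aug w ∈ nilPow 𝒢 (k + 1))
      (fun a b c hb => ?_) (fun f g hf hg => ?_) hw
    · have e : χ (constFn m (a * 𝔐.ι b * c)) - 𝔐.aug (a * 𝔐.ι b * c)
          = (χ (constFn m a) - 𝔐.aug a) * (b * χ (constFn m c))
            + 𝔐.aug a * b * (χ (constFn m c) - 𝔐.aug c) := by
        simp only [map_mul, h1, 𝔐.aug_ι, sub_mul, mul_sub, mul_assoc]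
        abel
      rw [e]
      refine add_mem ?_ ?_
      · rw [nilPow_succ]
        exact Submodule.mul_mem_mul (hn a) (isTwoSided_nilPow 𝒢 k _ _ hb).2
      · exact nilPow_mul_nil_le 𝒢 k
          (Submodule.mul_mem_mul (isTwoSided_nilPow 𝒢 k _ _ hb).1 (hn c))
    · have := add_mem hf hg
      simp only [map_add]
      convert this using 1
      abel
  have hval : ∀ f : smoothAlg m F, bodyMap 𝒢 (χ f) = 𝔐.ε (f.1 x₀) := by
    intro f
    obtain ⟨H, hH⟩ := hadamard_smoothAlg_vec f x₀
    conv_lhs => rw [hH]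
    rw [map_add, map_add, hconst, map_sum, map_sum, Finset.sum_eq_zero, add_zero]
    intro i _
    rw [map_mul, map_mul, hx]
    have : (coordFn i - algebraMap ℝ (smoothAlg m ℝ) (x₀ i)).1 x₀ = 0 := sub_self _
    rw [this, zero_mul]
  have key : ∀ k, ∀ l z, (u l).1 z ∈ 𝔐.idl 𝒢 k := by
    intro k
    induction k with
    | zero => intro l z; rw [𝔐.idl_zero]; trivial
    | succ k ih =>
      -- The equation `χ (u l) = 0` is expanded at `x₀`. The remainder terms lie one power deeper,
      -- hence so does `χ` of the constant `u l x₀`, and by `hdiff` so does its projection to `P`.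
      have haug : ∀ l, 𝔐.aug ((u l).1 x₀) ∈ nilPow 𝒢 (k + 1) := by
        intro l
        obtain ⟨S, hS⟩ := Submodule.exists_isCompl (𝔐.idl 𝒢 k)
        let π : F →ₗ[ℝ] F := (𝔐.idl 𝒢 k).subtype ∘ₗ Submodule.projectionOnto _ _ hS
        have hπ : ∀ w, π w ∈ 𝔐.idl 𝒢 k := fun w => Subtype.prop _
        have hπ' : ∀ w ∈ 𝔐.idl 𝒢 k, π w = w := fun w hw =>
          congrArg Subtype.val (Submodule.projectionOnto_apply_left hS ⟨w, hw⟩)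
        obtain ⟨H, hH⟩ := hadamard_smoothAlg_vec (u l) x₀
        -- Hadamard's remainders need not take values in the current ideal; but `u l` does, so
        -- applying the projection `π` to the expansion makes them do so.
        have hH' : u l = constFn m ((u l).1 x₀)
            + ∑ i, ofReal (coordFn i - algebraMap ℝ _ (x₀ i)) * compLin π (H i) := by
          refine Subtype.ext (funext fun z => ?_)
          have h3 : (u l).1 z = (u l).1 x₀ + ∑ i, (z i - x₀ i) • (H i).1 z := by
            have h4 := congrArg (fun f => f.1 z) hH
            simp only [Subalgebra.coe_add, AddSubmonoidClass.coe_finsetSum, Pi.add_apply,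
              Finset.sum_apply] at h4
            refine h4.trans (congrArg _ (Finset.sum_congr rfl fun i _ => ?_))
            exact (Algebra.smul_def _ _).symm
          have h5 := congrArg π h3
          rw [map_add, hπ' _ (ih l z), hπ' _ (ih l x₀), map_sum] at h5
          rw [Subalgebra.coe_add, AddSubmonoidClass.coe_finsetSum, Pi.add_apply, Finset.sum_apply]
          refine h5.trans (congrArg _ (Finset.sum_congr rfl fun i _ => ?_))
          rw [map_smul, Algebra.smul_def]
          rfl
        have hcomp : ∀ f, χ (compLin π f) ∈ nilPow 𝒢 k := by
          intro f
          let b := Module.finBasis ℝ F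
          have h6 : compLin π f = ∑ j, ofReal (compLin (b.coord j) f) * constFn m (π (b j)) := by
            refine Subtype.ext (funext fun z => ?_)
            have h := congrArg π (b.sum_repr (f.1 z)).symm
            rw [AddSubmonoidClass.coe_finsetSum, Finset.sum_apply]
            rw [map_sum] at h
            refine h.trans (Finset.sum_congr rfl fun j _ => ?_)
            rw [map_smul]
            exact Algebra.smul_def _ _
          rw [h6, map_sum]
          refine sum_mem fun j _ => ?_
          rw [map_mul]
          exact (isTwoSided_nilPow 𝒢 k _ _ (hmem k _ (hπ _))).1
        have h7 := hu l
        rw [hH', map_add, map_sum] at h7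
        have h8 : χ (constFn m ((u l).1 x₀)) ∈ nilPow 𝒢 (k + 1) := by
          rw [eq_neg_of_add_eq_zero_left h7]
          refine neg_mem (sum_mem fun i _ => ?_)
          rw [map_mul, nilPow_succ]
          refine Submodule.mul_mem_mul ?_ (hcomp _)
          rw [mem_nil, hx]
          exact sub_self _
        have h9 := sub_mem h8 (hdiff k _ (ih l x₀))
        rwa [sub_sub_cancel] at h9
      -- The ideal generated by all entries at the body point; the aim is to show that it lies in
      -- the ideal of level `k + 1`.
      let S : Submodule ℝ F := Submodule.span ℝ (Set.range fun l => (u l).1 x₀)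
      let I : Submodule ℝ F := ⊤ * S * ⊤
      have hI : IsTwoSided I := isTwoSided_top_mul_mul_top S
      have hSI : ∀ l, (u l).1 x₀ ∈ I := fun l =>
        le_top_mul_mul_top S (Submodule.subset_span ⟨l, rfl⟩)
      have hIε : I ≤ LinearMap.ker 𝔐.ε.toLinearMap := by
        refine top_mul_mul_top_le (isTwoSided_ker _) (Submodule.span_le.2 ?_)
        rintro _ ⟨l, rfl⟩
        change 𝔐.ε ((u l).1 x₀) = 0
        rw [← hval, hu, map_zero]
      have hδ : ∀ i, ∀ f ∈ I, 𝔐.δ i f ∈ I := by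
        intro i f hf
        -- The odd equations put `δ i` of each entry back into `I`. The twisted term of the Leibniz
        -- rule needs `γ` of an entry, which is an integer multiple of that entry by `hγ`.
        have hS : ∀ s ∈ S, 𝔐.δ i s ∈ I ∧ 𝔐.γ s ∈ I := by
          intro s hs
          induction hs using Submodule.span_induction with
          | mem s hs =>
            obtain ⟨l, rfl⟩ := hs
            refine ⟨(hodd i l).mem hI hIε hSI, ?_⟩
            obtain ⟨c, hc⟩ := hγ l x₀
            simp only [hc]
            exact zsmul_mem (hSI l) c
          | zero => simp
          | add s t _ _ hs ht =>
            rw [map_add, map_add]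
            exact ⟨add_mem hs.1 ht.1, add_mem hs.2 ht.2⟩
          | smul c s _ hs =>
            rw [map_smul, map_smul]
            exact ⟨I.smul_mem _ hs.1, I.smul_mem _ hs.2⟩
        refine Submodule.mul_induction_on hf (fun f hf c _ => ?_) (fun f g hf hg => by
          rw [map_add]; exact add_mem hf hg)
        refine Submodule.mul_induction_on hf (fun a _ s hs => ?_)
          (fun f g hf hg => by rw [add_mul, map_add]; exact add_mem hf hg)
        rw [𝔐.δ_mul, 𝔐.δ_mul, map_mul, add_mul]
        have hsI : s ∈ I := le_top_mul_mul_top S hs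
        exact add_mem (add_mem (hI _ _ (hI _ _ hsI).1).2 (hI _ _ (hI _ _ (hS s hs).1).1).2)
          (hI _ _ (hI _ _ (hS s hs).2).1).2
      have hle : I ≤ 𝔐.idl 𝒢 (k + 1) := by
        -- An ideal stable under the odd derivatives is contained in the ideal generated by its
        -- projection to `P`, and that projection is controlled by `haug`.
        refine (𝔐.le_top_mul_map_of_stable hδ).trans ?_
        have h3 : I.map (𝔐.ι.comp 𝔐.aug).toLinearMap ≤ (nilPow 𝒢 (k + 1)).map 𝔐.ι.toLinearMap := by
          have h4 : I.map 𝔐.aug.toLinearMap ≤ nilPow 𝒢 (k + 1) := by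
            rw [Submodule.map_le_iff_le_comap]
            refine top_mul_mul_top_le ?_ (Submodule.span_le.2 ?_)
            · intro a f hf
              rw [Submodule.mem_comap] at hf
              constructor
              · change 𝔐.aug (a * f) ∈ nilPow 𝒢 (k + 1)
                rw [map_mul]
                exact (isTwoSided_nilPow 𝒢 (k + 1) (𝔐.aug a) _ hf).1
              · change 𝔐.aug (f * a) ∈ nilPow 𝒢 (k + 1)
                rw [map_mul]
                exact (isTwoSided_nilPow 𝒢 (k + 1) (𝔐.aug a) _ hf).2
            · rintro _ ⟨l, rfl⟩
              exact haug l
          have h5 : (𝔐.ι.comp 𝔐.aug).toLinearMap = 𝔐.ι.toLinearMap ∘ₗ 𝔐.aug.toLinearMap := rfl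
          rw [h5, Submodule.map_comp]
          exact Submodule.map_mono h4
        intro f hf
        have h6 := mul_le_mul' (le_refl (⊤ : Submodule ℝ F)) h3 hf
        have h7 := Submodule.mul_mem_mul h6 (Submodule.mem_top (x := (1 : F)))
        rwa [mul_one] at h7
      -- The improved membership at `x₀` spreads to every `z` through the even equations.
      exact fun l z => mem_of_controlled (u := fun z l => (u l).1 z) (fun l => (u l).2) heven
        (𝔐.isTwoSided_idl 𝒢 (k + 1)) (𝔐.idl_succ_le 𝒢 k) (fun l => hle (hSI l)) z l
  obtain ⟨k, hk⟩ := 𝔐.exists_idl_eq_bot 𝒢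
  refine Subtype.ext (funext fun z => ?_)
  have := key k l z
  rwa [hk, Submodule.mem_bot] at this

end Point

/-! ### Charts of supermanifolds -/

section Charts

/-- Multiplication by a bump function supported in `O` and equal to one near `z₀`. Local functions
can thus be represented by elements of the global algebra `smoothAlg`. -/
theorem exists_contDiff_extension {m : ℕ} {F : Type v} [NormedRing F] [NormedAlgebra ℝ F]
    {O : Set (Euc m)} (hO : IsOpen O) {z₀ : Euc m} (hz : z₀ ∈ O) {G : Euc m → F}
    (hG : ContDiffOn ℝ ∞ G O) :
    ∃ g : smoothAlg m F, ∃ O' : Set (Euc m), IsOpen O' ∧ z₀ ∈ O' ∧ O' ⊆ O ∧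
      ∀ z ∈ O', g.1 z = G z := by
  obtain ⟨R, hR, hRO⟩ := Metric.nhds_basis_closedBall.mem_iff.1 (hO.mem_nhds hz)
  let χ : ContDiffBump z₀ := ⟨R / 2, R, by positivity, by linarith⟩
  have hχ : tsupport χ ⊆ O := by
    rw [χ.tsupport_eq]
    exact hRO
  refine ⟨⟨fun z => χ z • G z, (?_ : ContDiff ℝ ∞ fun z => χ z • G z)⟩, Metric.ball z₀ (R / 2),
    Metric.isOpen_ball,
    Metric.mem_ball_self (by positivity), ?_, ?_⟩
  · refine contDiff_iff_contDiffAt.2 fun z => ?_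
    by_cases h : z ∈ tsupport χ
    · exact χ.contDiff.contDiffAt.smul (hG.contDiffAt (hO.mem_nhds (hχ h)))
    · have h0 : (fun z => χ z • G z) =ᶠ[nhds z] fun _ => 0 := by
        filter_upwards [(isClosed_tsupport χ).isOpen_compl.mem_nhds h] with y hy
        rw [image_eq_zero_of_notMem_tsupport hy, zero_smul]
      exact contDiffAt_const.congr_of_eventuallyEq h0
  · refine (Metric.ball_subset_closedBall.trans (Metric.closedBall_subset_closedBall ?_)).trans hRO
    linarith
  · intro z hz
    have : χ z = 1 := χ.one_of_mem_closedBall (Metric.ball_subset_closedBall hz)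
    simp only [this, one_smul]

variable {P : Type w} [Ring P] [Algebra ℝ P] {𝒢 : ZMod 2 → Submodule ℝ P} {n m : ℕ}
variable {F : Type v} [NormedRing F] [NormedAlgebra ℝ F] [FiniteDimensional ℝ F]
variable {M : Type u} [TopologicalSpace M]

/-- The function `φ` on `W` is locally a smooth function of the coordinates `coord`. -/
def LocallySmooth (coord : M → Euc m) (W : Opens M) (φ : W → F) : Prop :=
  ∀ q : W, ∃ g : smoothAlg m F, ∃ (W' : Opens M) (h : W' ≤ W), q.1 ∈ W' ∧
    ∀ q' (hq : q' ∈ W'), φ ⟨q', h hq⟩ = g.1 (coord q')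

/-- A chart of a supermanifold on `U`, with values in the whole space `ℝᵐ`: the structure sheaf
over `U` is identified with the sheaf of smooth functions with values in the algebra `F`. -/
structure SuperChart (ℳ : SuperSpace.{u, w, x} 𝒢 M) (𝔐 : FibreModel 𝒢 n F) (m : ℕ)
    (U : Opens M) where
  coord : M → Euc m
  inv : Euc m → M
  inv_mem : ∀ z, inv z ∈ U
  coord_inv : ∀ z, coord (inv z) = z
  inv_coord : ∀ q ∈ U, inv (coord q) = q
  continuous_inv : Continuous inv
  continuousOn_coord : ContinuousOn coord U
  ev : ∀ W, W ≤ U → (ℳ.Γ W →ₐ[ℝ] (W → F))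
  ev_injective : ∀ (W : Opens M) (h : W ≤ U), Function.Injective (ev W h)
  mem_range_ev : ∀ (W : Opens M) (h : W ≤ U) (φ : W → F),
    φ ∈ Set.range (ev W h) ↔ LocallySmooth coord W φ
  ev_res : ∀ {V W : Opens M} (hV : V ≤ U) (hW : W ≤ V) (f : ℳ.Γ V) (q : W),
    ev W (hW.trans hV) (ℳ.res hW f) q = ev V hV f ⟨q, hW q.2⟩
  mem_gr_iff : ∀ (W : Opens M) (h : W ≤ U) (k : ZMod 2) (f : ℳ.Γ W), f ∈ ℳ.gr W k ↔ ∀ q,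
    ev W h f q ∈ 𝔐.gr k
  ev_ι : ∀ (W : Opens M) (h : W ≤ U) (a : P) (q : W), ev W h (ℳ.ι W a) q = 𝔐.ι a

variable [ChartedSpace (EuclideanSpace ℝ (Fin m)) M] [IsManifold (𝓡 m) ∞ M]

/-- A manifold chart is shrunk to a ball, which is diffeomorphic to the whole of `ℝᵐ`. On such a
chart sections are global functions, and any two points are joined by a segment, as Grönwall's
argument requires. -/
theorem exists_coordinates (q : M) {U₀ : Opens M} (hq : q ∈ U₀) :
    ∃ (U : Opens M) (coord : M → Euc m) (inv : Euc m → M), q ∈ U ∧ U ≤ U₀ ∧ (∀ z, inv z ∈ U) ∧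
      (∀ z, coord (inv z) = z) ∧ (∀ q ∈ U, inv (coord q) = q) ∧
      ContMDiff (𝓡 m) (𝓡 m) ∞ inv ∧ ContMDiffOn (𝓡 m) (𝓡 m) ∞ coord U := by
  let e := chartAt (EuclideanSpace ℝ (Fin m)) q
  have hO : IsOpen (e.target ∩ e.symm ⁻¹' U₀) := e.isOpen_inter_preimage_symm U₀.2
  have hqs : q ∈ e.source := mem_chart_source _ q
  have hqO : e q ∈ e.target ∩ e.symm ⁻¹' U₀ :=
    ⟨e.map_source hqs, by rw [Set.mem_preimage, e.left_inv hqs]; exact hq⟩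
  obtain ⟨R, hR, hRO⟩ := Metric.isOpen_iff.1 hO _ hqO
  let B : OpenPartialHomeomorph (EuclideanSpace ℝ (Fin m)) (EuclideanSpace ℝ (Fin m)) :=
    OpenPartialHomeomorph.univBall (e q) R
  have hBt : B.target = Metric.ball (e q) R := OpenPartialHomeomorph.univBall_target _ hR
  have hBs : B.source = Set.univ := OpenPartialHomeomorph.univBall_source _ _
  have hB : ∀ z, B z ∈ Metric.ball (e q) R := fun z => by
    rw [← hBt]
    exact B.map_source (by rw [hBs]; trivial)
  refine ⟨⟨e.source ∩ e ⁻¹' Metric.ball (e q) R, e.isOpen_inter_preimage Metric.isOpen_ball⟩,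
    fun x => B.symm (e x), fun z => e.symm (B z), ⟨hqs, Metric.mem_ball_self hR⟩, ?_, ?_, ?_, ?_,
    ?_, ?_⟩
  · rintro x ⟨h1, h2⟩
    have := (hRO h2).2
    rwa [Set.mem_preimage, e.left_inv h1] at this
  · intro z
    have h1 := (hRO (hB z)).1
    exact ⟨e.map_target h1, by rw [Set.mem_preimage, e.right_inv h1]; exact hB z⟩
  · intro z
    simp only
    rw [e.right_inv (hRO (hB z)).1, B.left_inv (by rw [hBs]; trivial)]
  · rintro x ⟨h1, h2⟩
    simp only
    rw [B.right_inv (by rw [hBt]; exact h2), e.left_inv h1]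
  · have h1 : ContMDiffOn (𝓡 m) (𝓡 m) ∞ e.symm e.target := contMDiffOn_chart_symm
    have h2 : ContMDiff (𝓡 m) (𝓡 m) ∞ B := OpenPartialHomeomorph.contDiff_univBall.contMDiff
    exact h1.comp_contMDiff h2 fun z => (hRO (hB z)).1
  · have h1 : ContMDiffOn (𝓡 m) (𝓡 m) ∞ e e.source := contMDiffOn_chart
    have h2 : ContMDiffOn (𝓡 m) (𝓡 m) ∞ B.symm (Metric.ball (e q) R) :=
      OpenPartialHomeomorph.contDiffOn_univBall_symm.contMDiffOn
    exact h2.comp (h1.mono fun x hx => hx.1) fun x hx => hx.2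

variable [GradedAlgebra 𝒢] [IsSmall 𝒢]

/-- A local trivialization is composed with `e` and with coordinates onto `ℝᵐ`. The real work is to
compare smoothness tested by linear functionals on the manifold with `LocallySmooth`, which is
tested by global functions of the coordinates. -/
theorem exists_superChart (𝔐 : FibreModel 𝒢 n F) (e : Fibre 𝒢 n ≃ₐ[ℝ] F)
    (hgr : ∀ k f, f ∈ fibreGr 𝒢 n k ↔ e f ∈ 𝔐.gr k)
    (hι : ∀ a, e (GradedTensorProduct.tmul ℝ a 1) = 𝔐.ι a)
    (ℳ : PSupermanifold.{u, w, x} 𝒢 m n M) (q : M) {U₀ : Opens M} (hq : q ∈ U₀) :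
    ∃ U : Opens M, q ∈ U ∧ U ≤ U₀ ∧ Nonempty (SuperChart ℳ.toSuperSpace 𝔐 m U) := by
  obtain ⟨U₁, hq₁, ⟨τ⟩⟩ := ℳ.locally_trivial q
  obtain ⟨U, coord, inv, hqU, hU, hinv, h1, h2, hinvs, hcoord⟩ :=
    exists_coordinates (m := m) q (U₀ := U₀ ⊓ U₁) ⟨hq, hq₁⟩
  have hU₁ : U ≤ U₁ := hU.trans inf_le_right
  have hcoordAt : ∀ x ∈ U, ContMDiffAt (𝓡 m) (𝓡 m) ∞ coord x := fun x hx =>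
    hcoord.contMDiffAt (U.2.mem_nhds hx)
  have hrange : ∀ (W : Opens M) (_ : W ≤ U) (φ : W → Fibre 𝒢 n),
      IsSmoothFun 𝒢 m n φ ↔ LocallySmooth coord W (fun q => e (φ q)) := by
    intro W hW φ
    classical
    constructor
    · intro hφ q
      -- The coordinate expression of `φ`; the value zero outside the preimage of `W` is immaterial,
      -- since only points inside are used.
      let G : Euc m → F := fun z => if h : inv z ∈ W then e (φ ⟨inv z, h⟩) else 0
      have hO : IsOpen (inv ⁻¹' (W : Set M)) := W.2.preimage hinvs.continuous
      have hG : ContDiffOn ℝ ∞ G (inv ⁻¹' (W : Set M)) := by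
        have hl : ∀ l : F →ₗ[ℝ] ℝ, ContDiffOn ℝ ∞ (fun z => l (G z)) (inv ⁻¹' (W : Set M)) := by
          intro l z hz
          refine ContDiffAt.contDiffWithinAt ?_
          let f : M → ℝ := fun x => if h : x ∈ W then l (e (φ ⟨x, h⟩)) else 0
          have hf : ContMDiffAt (𝓡 m) 𝓘(ℝ, ℝ) ∞ f (inv z) := by
            have h3 := hφ (l ∘ₗ e.toLinearMap) ⟨inv z, hz⟩
            refine (contMDiffAt_subtype_iff (U := W) (x := ⟨inv z, hz⟩)).1 ?_
            convert h3 using 2 with x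
            exact dif_pos x.2
          have h4 := hf.comp z (hinvs z)
          have h5 : (fun z => l (G z)) = f ∘ inv := funext fun z => by
            simp only [G, f, Function.comp_apply]
            split_ifs
            · rfl
            · exact map_zero l
          rw [h5]
          exact h4.contDiffAt
        let b := Module.finBasis ℝ F
        have hb : G = fun z => ∑ l, b.coord l (G z) • b l := funext fun z => (b.sum_repr _).symm
        rw [hb]
        exact ContDiffOn.sum fun l _ => (hl (b.coord l)).smul contDiffOn_const
      have hq0 : coord q ∈ inv ⁻¹' (W : Set M) := by
        rw [Set.mem_preimage, h2 q (hW q.2)]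
        exact q.2
      obtain ⟨g, O', hO', hq', hsub, hg⟩ := exists_contDiff_extension hO hq0 hG
      refine ⟨g, ⟨W ∩ coord ⁻¹' O', ?_⟩, fun x hx => hx.1, ⟨q.2, hq'⟩, ?_⟩
      · exact (hcoord.continuousOn.mono hW).isOpen_inter_preimage W.2 hO'
      · rintro x ⟨hx, hx'⟩
        rw [hg _ hx']
        have h6 : inv (coord x) = x := h2 x (hW hx)
        simp only [G, h6]
        rw [dif_pos (show x ∈ W from hx)]
    · intro hφ l q
      obtain ⟨g, W', hW', hq', hg⟩ := hφ q
      let f : M → ℝ := fun x => if h : x ∈ W then l (φ ⟨x, h⟩) else 0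
      have hf : ContMDiffAt (𝓡 m) 𝓘(ℝ, ℝ) ∞ f q := by
        have h3 : f =ᶠ[nhds q.1] fun x => (l ∘ₗ e.symm.toLinearMap).toContinuousLinearMap
            (g.1 (coord x)) := by
          filter_upwards [W'.2.mem_nhds hq'] with x hx
          simp only [f]
          rw [dif_pos (hW' hx), ← hg x hx]
          exact congrArg l (e.symm_apply_apply _).symm
        refine ContMDiffAt.congr_of_eventuallyEq ?_ h3
        have h4 : ContMDiff (𝓡 m) 𝓘(ℝ, ℝ) ∞ fun z =>
            (l ∘ₗ e.symm.toLinearMap).toContinuousLinearMap (g.1 z) :=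
          (((l ∘ₗ e.symm.toLinearMap).toContinuousLinearMap.contDiff).comp
            (smoothAlg.contDiff g)).contMDiff
        exact (h4 _).comp q.1 (hcoordAt q.1 (hW q.2))
      have h5 := (contMDiffAt_subtype_iff (U := W) (x := q)).2 hf
      convert h5 using 2 with x
      simp only [f]
      rw [dif_pos x.2]
  refine ⟨U, hqU, hU.trans inf_le_left, ⟨{
    coord := coord
    inv := inv
    inv_mem := hinv
    coord_inv := h1
    inv_coord := h2
    continuous_inv := hinvs.continuous
    continuousOn_coord := hcoord.continuousOn
    ev := fun W h => (AlgHom.compLeft e.toAlgHom W).comp (τ.toFun W (h.trans hU₁))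
    ev_injective := fun W h f g hfg => τ.injective W (h.trans hU₁)
      (funext fun q => e.injective (congrFun hfg q))
    mem_range_ev := ?_
    ev_res := fun hV hW f q => congrArg e (τ.map_res (hV.trans hU₁) hW f q)
    mem_gr_iff := fun W h k f => by
      rw [τ.mem_gr_iff W (h.trans hU₁) k f]
      exact forall_congr' fun q => hgr k _
    ev_ι := fun W h a q => by
      rw [← hι, ← τ.map_ι W (h.trans hU₁) a q]
      rfl }⟩⟩
  intro W h φ
  have h3 := hrange W h fun q => e.symm (φ q)
  simp only [AlgEquiv.apply_symm_apply] at h3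
  rw [← h3]
  have h4 : IsSmoothFun 𝒢 m n (fun q => e.symm (φ q)) ↔
      (fun q => e.symm (φ q)) ∈ Set.range (τ.toFun W (h.trans hU₁)) := by
    rw [τ.range_eq W (h.trans hU₁)]
    exact Iff.rfl
  rw [h4]
  constructor
  · rintro ⟨f, rfl⟩
    exact ⟨f, funext fun q => (e.symm_apply_apply _).symm⟩
  · rintro ⟨f, hf⟩
    exact ⟨f, funext fun q => by
      have := congrFun hf q
      change e (τ.toFun W (h.trans hU₁) f q) = φ q
      rw [this, e.apply_symm_apply]⟩

end Charts

/-! ### Partial derivatives of smooth functions with values in the fibre algebra -/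

section Partial

variable {P : Type w} [Ring P] [Algebra ℝ P] {𝒢 : ZMod 2 → Submodule ℝ P} {n m : ℕ}
variable {F : Type v} [NormedRing F] [NormedAlgebra ℝ F] [FiniteDimensional ℝ F]
  (𝔐 : FibreModel 𝒢 n F)

/-- The parity of a coordinate: even for `inl i`, odd for `inr j`. -/
def par : Fin m ⊕ Fin n → ZMod 2 := Sum.elim (fun _ => 0) (fun _ => 1)

/-- The coordinate functions. -/
def FibreModel.cfn : Fin m ⊕ Fin n → smoothAlg m F :=
  Sum.elim (fun i => ofReal (coordFn i)) (fun j => constFn m (𝔐.θ j))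

/-- The parity involution fixes `1`, so the odd part of `1` equals its own negative. -/
theorem FibreModel.one_mem : (1 : F) ∈ 𝔐.gr 0 := by
  obtain ⟨f₀, h₀, f₁, h₁, h⟩ := 𝔐.exists_even_add_odd 1
  have hγ := map_one 𝔐.γ
  rw [← h, map_add, 𝔐.γ_of_mem _ _ h₀, 𝔐.γ_of_mem _ _ h₁, sgn_zero_right, sgn_one_one, one_smul,
    neg_smul, one_smul] at hγ
  have h2 : (2 : ℝ) • f₁ = 0 := by
    rw [two_smul]
    have := add_left_cancel hγ
    nth_rewrite 1 [← this]
    exact neg_add_cancel f₁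
  rw [(smul_eq_zero.1 h2).resolve_left two_ne_zero, add_zero] at h
  rwa [← h]

theorem FibreModel.cfn_mem (a : Fin m ⊕ Fin n) (z : Euc m) : (𝔐.cfn a).1 z ∈ 𝔐.gr (par a) := by
  rcases a with i | j
  · change algebraMap ℝ F (z i) ∈ 𝔐.gr 0
    rw [Algebra.algebraMap_eq_smul_one]
    exact Submodule.smul_mem _ _ 𝔐.one_mem
  · exact 𝔐.θ_mem j

/-- The partial derivatives. -/
def FibreModel.pd (a : Fin m ⊕ Fin n) : smoothAlg m F →+ smoothAlg m F where
  toFun f := Sum.elim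
    (fun i => ⟨fun z => fderiv ℝ f.1 z (stdVec i),
      ((contDiff_infty_iff_fderiv.1 (smoothAlg.contDiff f)).2.clm_apply contDiff_const :
        ContDiff ℝ ∞ fun z => fderiv ℝ f.1 z (stdVec i))⟩)
    (fun j => compLin (𝔐.δ j) f) a
  map_zero' := by
    refine Subtype.ext (funext fun z => ?_)
    rcases a with i | j
    · change fderiv ℝ (fun _ : Euc m => (0 : F)) z (stdVec i) = 0
      simp
    · exact map_zero (𝔐.δ j)
  map_add' f g := by
    refine Subtype.ext (funext fun z => ?_)
    have hf : DifferentiableAt ℝ f.1 z := (smoothAlg.contDiff f).differentiable (by simp) z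
    have hg : DifferentiableAt ℝ g.1 z := (smoothAlg.contDiff g).differentiable (by simp) z
    rcases a with i | j
    · change fderiv ℝ (f.1 + g.1) z (stdVec i) = _
      rw [fderiv_add hf hg]
      rfl
    · exact map_add (𝔐.δ j) _ _

theorem FibreModel.pd_inl (i : Fin m) (f : smoothAlg m F) (z : Euc m) :
    (𝔐.pd (Sum.inl i) f).1 z = fderiv ℝ f.1 z (stdVec i) := rfl

theorem FibreModel.pd_inr (j : Fin n) (f : smoothAlg m F) (z : Euc m) :
    (𝔐.pd (Sum.inr j : Fin m ⊕ Fin n) f).1 z = 𝔐.δ j (f.1 z) := rfl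

theorem FibreModel.pd_congr (a : Fin m ⊕ Fin n) {f g : smoothAlg m F} {O : Set (Euc m)}
    (hO : IsOpen O) (h : ∀ z ∈ O, f.1 z = g.1 z) {z : Euc m} (hz : z ∈ O) :
    (𝔐.pd a f).1 z = (𝔐.pd a g).1 z := by
  rcases a with i | j
  · rw [𝔐.pd_inl, 𝔐.pd_inl]
    have : f.1 =ᶠ[nhds z] g.1 := by
      filter_upwards [hO.mem_nhds hz] with y hy using h y hy
    rw [this.fderiv_eq]
  · rw [𝔐.pd_inr, 𝔐.pd_inr, h z hz]

/-- In an even direction the derivative of a function with values in the subspace `gr k` stays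
there: a linear map with kernel `gr k` vanishes along the function. Odd directions are covered by
`δ_mem`. -/
theorem FibreModel.pd_mem (a : Fin m ⊕ Fin n) {f : smoothAlg m F} {O : Set (Euc m)}
    (hO : IsOpen O) {k : ZMod 2} (h : ∀ z ∈ O, f.1 z ∈ 𝔐.gr k) {z : Euc m} (hz : z ∈ O) :
    (𝔐.pd a f).1 z ∈ 𝔐.gr (par a + k) := by
  rcases a with i | j
  · rw [𝔐.pd_inl]
    have h0 : par (Sum.inl i : Fin m ⊕ Fin n) + k = k := zero_add k
    rw [h0]
    obtain ⟨S, hS⟩ := Submodule.exists_isCompl (𝔐.gr k)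
    let p : F →ₗ[ℝ] 𝔐.gr k := Submodule.projectionOnto _ _ hS
    let q : F →L[ℝ] F := (LinearMap.id - (𝔐.gr k).subtype ∘ₗ p).toContinuousLinearMap
    have hq : ∀ f, q f = f - p f := fun _ => rfl
    have hp : ∀ f ∈ 𝔐.gr k, q f = 0 := fun f hf => by
      rw [hq, show p f = ⟨f, hf⟩ from Submodule.projectionOnto_apply_left hS ⟨f, hf⟩, sub_self]
    have hp' : ∀ f, q f = 0 → f ∈ 𝔐.gr k := fun f hf => by
      rw [hq, sub_eq_zero] at hf
      rw [hf]
      exact (p f).2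
    have hf : DifferentiableAt ℝ f.1 z := (smoothAlg.contDiff f).differentiable (by simp) z
    have h1 : (fun z => q (f.1 z)) =ᶠ[nhds z] fun _ => 0 := by
      filter_upwards [hO.mem_nhds hz] with y hy
      exact hp _ (h y hy)
    have h2 := (q.hasFDerivAt.comp z hf.hasFDerivAt).congr_of_eventuallyEq h1.symm
    have h3 := DFunLike.congr_fun (h2.unique (hasFDerivAt_const _ _)) (stdVec i)
    exact hp' _ h3
  · rw [𝔐.pd_inr]
    exact 𝔐.δ_mem j k _ (h z hz)

theorem FibreModel.pd_mul (a : Fin m ⊕ Fin n) (f g : smoothAlg m F) {k : ZMod 2} {z : Euc m}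
    (h : f.1 z ∈ 𝔐.gr k) : (𝔐.pd a (f * g)).1 z
      = (𝔐.pd a f).1 z * g.1 z + sgn (par a) k • (f.1 z * (𝔐.pd a g).1 z) := by
  rcases a with i | j
  · have hf : DifferentiableAt ℝ f.1 z := (smoothAlg.contDiff f).differentiable (by simp) z
    have hg : DifferentiableAt ℝ g.1 z := (smoothAlg.contDiff g).differentiable (by simp) z
    rw [𝔐.pd_inl, 𝔐.pd_inl, 𝔐.pd_inl]
    change fderiv ℝ (f.1 * g.1) z (stdVec i) = _
    rw [fderiv_mul' hf hg]
    have : sgn (par (Sum.inl i : Fin m ⊕ Fin n)) k = 1 := sgn_zero_left k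
    rw [this, one_smul, add_comm]
    rfl
  · rw [𝔐.pd_inr, 𝔐.pd_inr, 𝔐.pd_inr]
    change 𝔐.δ j (f.1 z * g.1 z) = _
    rw [𝔐.δ_mul, 𝔐.γ_of_mem _ _ h, smul_mul_assoc]
    rfl

theorem FibreModel.pd_const_ι (a : Fin m ⊕ Fin n) (b : P) : 𝔐.pd a (constFn m (𝔐.ι b)) = 0 := by
  refine Subtype.ext (funext fun z => ?_)
  rcases a with i | j
  · change fderiv ℝ (fun _ : Euc m => 𝔐.ι b) z (stdVec i) = 0
    simp
  · exact 𝔐.δ_ι j b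

theorem FibreModel.pd_cfn (a b : Fin m ⊕ Fin n) : 𝔐.pd a (𝔐.cfn b) = if a = b then 1 else 0 := by
  refine Subtype.ext (funext fun z => ?_)
  rcases a with i | j <;> rcases b with i' | j'
  · rw [𝔐.pd_inl]
    have h : HasFDerivAt (fun z : Euc m => algebraMap ℝ F (z i'))
        ((algebraMapCLM ℝ F).comp (EuclideanSpace.proj i' : Euc m →L[ℝ] ℝ)) z :=
      (algebraMapCLM ℝ F).hasFDerivAt.comp z
        (EuclideanSpace.proj i' : Euc m →L[ℝ] ℝ).hasFDerivAt
    have h' : fderiv ℝ (𝔐.cfn (Sum.inl i' : Fin m ⊕ Fin n)).1 z = _ := h.fderiv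
    rw [h']
    simp only [ContinuousLinearMap.comp_apply]
    have h2 : (EuclideanSpace.proj i' : Euc m →L[ℝ] ℝ) (stdVec i) = if i = i' then 1 else 0 := by
      simp [eq_comm]
    rw [h2]
    by_cases hi : i = i'
    · simp [hi]
    · simp [hi]
  · change fderiv ℝ (fun _ : Euc m => 𝔐.θ j') z (stdVec i) = _
    simp
  · change 𝔐.δ j (algebraMap ℝ F (z i')) = _
    rw [← AlgHom.commutes 𝔐.ι, 𝔐.δ_ι]
    simp
  · change 𝔐.δ j (𝔐.θ j') = _
    rw [𝔐.δ_θ]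
    by_cases hj : j = j'
    · simp [hj]
    · simp [hj]

end Partial

/-! ### Sections over charts -/

section Sections

variable {P : Type w} [Ring P] [Algebra ℝ P] {𝒢 : ZMod 2 → Submodule ℝ P} {n m : ℕ}
variable {F : Type y} [NormedRing F] [NormedAlgebra ℝ F] [FiniteDimensional ℝ F]
variable {M : Type u} [TopologicalSpace M]

/-- The locality axiom, freed from the requirement that the domain be literally a supremum: the
restrictions in both directions between `W` and the union of the neighbourhoods are mutually
inverse. -/
theorem SuperSpace.ext_local (ℳ : SuperSpace.{u, w, x} 𝒢 M) {W : Opens M} {f g : ℳ.Γ W}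
    (h : ∀ q ∈ W, ∃ (W' : Opens M) (hW : W' ≤ W), q ∈ W' ∧ ℳ.res hW f = ℳ.res hW g) :
    f = g := by
  choose W' hW hq he using fun q : W => h q q.2
  have hS : ⨆ q, W' q ≤ W := iSup_le hW
  have hS' : W ≤ ⨆ q, W' q := fun q hqW => Opens.mem_iSup.2 ⟨⟨q, hqW⟩, hq _⟩
  have key : ℳ.res hS f = ℳ.res hS g := ℳ.locality _ _ _ fun i => by
    rw [ℳ.res_res, ℳ.res_res]
    exact he i
  have := congrArg (ℳ.res hS') key
  rwa [ℳ.res_res, ℳ.res_res, ℳ.res_self, ℳ.res_self] at this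

namespace SuperChart

variable {ℳ : SuperSpace.{u, w, x} 𝒢 M} {𝔐 : FibreModel 𝒢 n F} {U : Opens M}
  (C : SuperChart ℳ 𝔐 m U)

/-- The smooth function `g` represents the section `f` near `q`. -/
def IsGerm {W : Opens M} (h : W ≤ U) (f : ℳ.Γ W) (q : M) (g : smoothAlg m F) : Prop :=
  ∃ (W' : Opens M) (hW : W' ≤ W), q ∈ W' ∧
    ∀ q' (hq : q' ∈ W'), C.ev W h f ⟨q', hW hq⟩ = g.1 (C.coord q')

variable {C} {W : Opens M} {h : W ≤ U}

theorem exists_isGerm (f : ℳ.Γ W) {q : M} (hq : q ∈ W) : ∃ g, C.IsGerm h f q g := by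
  obtain ⟨g, W', hW, hq', hg⟩ := (C.mem_range_ev W h _).1 ⟨f, rfl⟩ ⟨q, hq⟩
  exact ⟨g, W', hW, hq', hg⟩

theorem IsGerm.ev_eq {f : ℳ.Γ W} {q : M} {g : smoothAlg m F} (hg : C.IsGerm h f q g)
    (hq : q ∈ W) : C.ev W h f ⟨q, hq⟩ = g.1 (C.coord q) := by
  obtain ⟨W', hW, hq', hg⟩ := hg
  exact hg q hq'

theorem IsGerm.mul {f f' : ℳ.Γ W} {q : M} {g g' : smoothAlg m F} (hg : C.IsGerm h f q g)
    (hg' : C.IsGerm h f' q g') : C.IsGerm h (f * f') q (g * g') := by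
  obtain ⟨W₁, hW₁, hq₁, hg₁⟩ := hg
  obtain ⟨W₂, hW₂, hq₂, hg₂⟩ := hg'
  refine ⟨W₁ ⊓ W₂, inf_le_left.trans hW₁, ⟨hq₁, hq₂⟩, fun q' hq' => ?_⟩
  rw [map_mul]
  exact congrArg₂ (· * ·) (hg₁ q' hq'.1) (hg₂ q' hq'.2)

theorem IsGerm.add {f f' : ℳ.Γ W} {q : M} {g g' : smoothAlg m F} (hg : C.IsGerm h f q g)
    (hg' : C.IsGerm h f' q g') : C.IsGerm h (f + f') q (g + g') := by
  obtain ⟨W₁, hW₁, hq₁, hg₁⟩ := hg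
  obtain ⟨W₂, hW₂, hq₂, hg₂⟩ := hg'
  refine ⟨W₁ ⊓ W₂, inf_le_left.trans hW₁, ⟨hq₁, hq₂⟩, fun q' hq' => ?_⟩
  rw [map_add]
  exact congrArg₂ (· + ·) (hg₁ q' hq'.1) (hg₂ q' hq'.2)

theorem IsGerm.res {f : ℳ.Γ W} {q : M} {g : smoothAlg m F} (hg : C.IsGerm h f q g)
    {W' : Opens M} (hW' : W' ≤ W) (hq : q ∈ W') :
    C.IsGerm (hW'.trans h) (ℳ.res hW' f) q g := by
  obtain ⟨W₁, hW₁, hq₁, hg₁⟩ := hg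
  refine ⟨W' ⊓ W₁, inf_le_left, ⟨hq, hq₁⟩, fun q' hq' => ?_⟩
  rw [C.ev_res h hW']
  exact hg₁ q' hq'.2

theorem isOpen_inv_preimage (W' : Opens M) : IsOpen (C.inv ⁻¹' (W' : Set M)) :=
  W'.2.preimage C.continuous_inv

theorem coord_mem_preimage {W' : Opens M} (hU : W' ≤ U) {q : M} (hq : q ∈ W') :
    C.coord q ∈ C.inv ⁻¹' (W' : Set M) := by
  rw [Set.mem_preimage, C.inv_coord q (hU hq)]
  exact hq

theorem IsGerm.eq_on {f : ℳ.Γ W} {q : M} {g g' : smoothAlg m F} (hg : C.IsGerm h f q g)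
    (hg' : C.IsGerm h f q g') : ∃ O : Set (Euc m), IsOpen O ∧ C.coord q ∈ O ∧
      ∀ z ∈ O, g.1 z = g'.1 z := by
  obtain ⟨W₁, hW₁, hq₁, hg₁⟩ := hg
  obtain ⟨W₂, hW₂, hq₂, hg₂⟩ := hg'
  refine ⟨C.inv ⁻¹' (W₁ ⊓ W₂ : Opens M), isOpen_inv_preimage _,
    coord_mem_preimage (inf_le_left.trans (hW₁.trans h)) ⟨hq₁, hq₂⟩, fun z hz => ?_⟩
  have h1 := hg₁ (C.inv z) hz.1
  have h2 := hg₂ (C.inv z) hz.2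
  rw [C.coord_inv] at h1 h2
  exact h1.symm.trans h2

theorem IsGerm.mem_gr {f : ℳ.Γ W} {q : M} {g : smoothAlg m F} (hg : C.IsGerm h f q g)
    {k : ZMod 2} (hf : f ∈ ℳ.gr W k) : ∃ O : Set (Euc m), IsOpen O ∧ C.coord q ∈ O ∧
      ∀ z ∈ O, g.1 z ∈ 𝔐.gr k := by
  obtain ⟨W₁, hW₁, hq₁, hg₁⟩ := hg
  refine ⟨C.inv ⁻¹' (W₁ : Set M), isOpen_inv_preimage _,
    coord_mem_preimage (hW₁.trans h) hq₁, fun z hz => ?_⟩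
  have h1 := hg₁ (C.inv z) hz
  rw [C.coord_inv] at h1
  rw [← h1]
  exact (C.mem_gr_iff W h k f).1 hf _

theorem ext_ev {f f' : ℳ.Γ W} (hf : ∀ q : W, C.ev W h f q = C.ev W h f' q) : f = f' :=
  C.ev_injective W h (funext hf)

variable (C)

/-- The smooth function that represents a section over the whole chart. -/
def rep : ℳ.Γ U →ₐ[ℝ] smoothAlg m F where
  toFun f := ⟨fun z => C.ev U le_rfl f ⟨C.inv z, C.inv_mem z⟩, by
    change ContDiff ℝ ∞ fun z => C.ev U le_rfl f ⟨C.inv z, C.inv_mem z⟩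
    refine contDiff_iff_contDiffAt.2 fun z => ?_
    obtain ⟨g, W', hW, hq, hg⟩ := exists_isGerm (C := C) (h := le_rfl) f (C.inv_mem z)
    have h1 : (fun z => C.ev U le_rfl f ⟨C.inv z, C.inv_mem z⟩) =ᶠ[nhds z] g.1 := by
      filter_upwards [(isOpen_inv_preimage (C := C) W').mem_nhds hq] with y hy
      rw [hg _ hy, C.coord_inv]
    exact (smoothAlg.contDiff g).contDiffAt.congr_of_eventuallyEq h1⟩
  map_one' := Subtype.ext (funext fun z => by simp only [map_one]; rfl)
  map_mul' f g := Subtype.ext (funext fun z => by simp only [map_mul]; rfl)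
  map_zero' := Subtype.ext (funext fun z => by simp only [map_zero]; rfl)
  map_add' f g := Subtype.ext (funext fun z => by simp only [map_add]; rfl)
  commutes' c := Subtype.ext (funext fun z => by simp only [AlgHom.commutes]; rfl)

theorem rep_apply (f : ℳ.Γ U) (z : Euc m) :
    (C.rep f).1 z = C.ev U le_rfl f ⟨C.inv z, C.inv_mem z⟩ := rfl

theorem rep_coord (f : ℳ.Γ U) {q : M} (hq : q ∈ U) :
    (C.rep f).1 (C.coord q) = C.ev U le_rfl f ⟨q, hq⟩ := by
  exact congrArg (C.ev U le_rfl f) (Subtype.ext (C.inv_coord q hq))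

theorem rep_bijective : Function.Bijective C.rep := by
  constructor
  · intro f g hfg
    refine ext_ev (C := C) (h := le_rfl) fun q => ?_
    rw [← C.rep_coord f q.2, ← C.rep_coord g q.2, hfg]
  · intro g
    obtain ⟨f, hf⟩ := (C.mem_range_ev U le_rfl (fun q => g.1 (C.coord q))).2
      fun q => ⟨g, U, le_rfl, q.2, fun _ _ => rfl⟩
    refine ⟨f, Subtype.ext (funext fun z => ?_)⟩
    rw [rep_apply, hf]
    simp only [C.coord_inv]

/-- Sections over a chart are smooth functions on `ℝᵐ`. -/
def repEquiv : ℳ.Γ U ≃ₐ[ℝ] smoothAlg m F := AlgEquiv.ofBijective C.rep C.rep_bijective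

/-- The section represented by a smooth function. -/
def sec : smoothAlg m F →ₐ[ℝ] ℳ.Γ U := C.repEquiv.symm

theorem rep_sec (g : smoothAlg m F) : C.rep (C.sec g) = g := C.repEquiv.apply_symm_apply g

theorem sec_rep (f : ℳ.Γ U) : C.sec (C.rep f) = f := C.repEquiv.symm_apply_apply f

theorem isGerm_rep (f : ℳ.Γ U) {q : M} (hq : q ∈ U) : C.IsGerm le_rfl f q (C.rep f) :=
  ⟨U, le_rfl, hq, fun _ hq' => (C.rep_coord f hq').symm⟩

theorem rep_mem_gr_iff (f : ℳ.Γ U) (k : ZMod 2) :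
    f ∈ ℳ.gr U k ↔ ∀ z, (C.rep f).1 z ∈ 𝔐.gr k := by
  rw [C.mem_gr_iff U le_rfl]
  constructor
  · exact fun h z => h _
  · intro h q
    rw [← C.rep_coord f q.2]
    exact h _

theorem rep_ι (a : P) : C.rep (ℳ.ι U a) = constFn m (𝔐.ι a) :=
  Subtype.ext (funext fun _ => C.ev_ι U le_rfl a _)

/-- The coordinate functions of a chart. -/
def crd (a : Fin m ⊕ Fin n) : ℳ.Γ U := C.sec (𝔐.cfn a)

theorem crd_mem (a : Fin m ⊕ Fin n) : C.crd a ∈ ℳ.gr U (par a) := by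
  rw [C.rep_mem_gr_iff, crd, rep_sec]
  exact 𝔐.cfn_mem a

/-- Every section coincides near a given point with a section over the whole chart. -/
theorem exists_extension (C : SuperChart ℳ 𝔐 m U) {W : Opens M} (f : ℳ.Γ W) {q : M} (hq : q ∈ W)
    (hqU : q ∈ U) :
    ∃ (g : ℳ.Γ U) (W' : Opens M) (h : W' ≤ W) (h' : W' ≤ U), q ∈ W' ∧
      ℳ.res h f = ℳ.res h' g := by
  have h0 : W ⊓ U ≤ U := inf_le_right
  obtain ⟨g, W', hW', hq', hg⟩ := exists_isGerm (C := C) (h := h0) (ℳ.res inf_le_left f)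
    (q := q) ⟨hq, hqU⟩
  refine ⟨C.sec g, W', hW'.trans inf_le_left, hW'.trans h0, hq', ?_⟩
  refine ext_ev (C := C) (h := hW'.trans h0) fun x => ?_
  rw [C.ev_res le_rfl (hW'.trans h0), ← C.rep_coord _ (h0 (hW' x.2)), rep_sec,
    ← hg x.1 x.2, ← C.ev_res h0 hW', ℳ.res_res]

/-- The section obtained by applying a partial derivative. -/
theorem exists_pd (a : Fin m ⊕ Fin n) (W : Opens M) (h : W ≤ U) (f : ℳ.Γ W) :
    ∃ f' : ℳ.Γ W, ∀ q g, C.IsGerm h f q g → C.IsGerm h f' q (𝔐.pd a g) := by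
  choose g hg using fun q : W => exists_isGerm (C := C) (h := h) f q.2
  -- A partial derivative depends only on the germ, so representatives chosen independently at each
  -- point still fit together to a locally smooth function.
  have hloc : ∀ q g', C.IsGerm h f q g' → ∃ (W' : Opens M) (h : W' ≤ W), q ∈ W' ∧
      ∀ q' (hq : q' ∈ W'), (𝔐.pd a (g ⟨q', h hq⟩)).1 (C.coord q')
        = (𝔐.pd a g').1 (C.coord q') := by
    rintro q g' ⟨W', hW', hq', hg'⟩
    refine ⟨W', hW', hq', fun q' hq => ?_⟩
    obtain ⟨O, hO, hqO, hgO⟩ := (hg ⟨q', hW' hq⟩).eq_on ⟨W', hW', hq, hg'⟩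
    exact 𝔐.pd_congr a hO hgO hqO
  obtain ⟨f', hf'⟩ := (C.mem_range_ev W h
    (fun q => (𝔐.pd a (g q)).1 (C.coord q))).2 fun q => by
      obtain ⟨W', hW', hq', hg'⟩ := hloc q _ (hg q)
      exact ⟨_, W', hW', hq', hg'⟩
  refine ⟨f', fun q g' hg' => ?_⟩
  obtain ⟨W', hW', hq', h1⟩ := hloc q g' hg'
  refine ⟨W', hW', hq', fun q' hq => ?_⟩
  rw [hf']
  exact h1 q' hq

/-- Partial derivatives of sections. -/
def pdFun (a : Fin m ⊕ Fin n) (W : Opens M) (h : W ≤ U) (f : ℳ.Γ W) : ℳ.Γ W :=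
  (C.exists_pd a W h f).choose

variable {C}

theorem IsGerm.pdFun {f : ℳ.Γ W} {q : M} {g : smoothAlg m F} (hg : C.IsGerm h f q g)
    (a : Fin m ⊕ Fin n) : C.IsGerm h (C.pdFun a W h f) q (𝔐.pd a g) :=
  (C.exists_pd a W h f).choose_spec q g hg

variable (C)

/-- Partial derivatives of sections as additive maps. -/
def pdHom (a : Fin m ⊕ Fin n) (W : Opens M) (h : W ≤ U) : ℳ.Γ W →+ ℳ.Γ W :=
  AddMonoidHom.mk' (C.pdFun a W h) fun f f' => ext_ev (C := C) (h := h) fun q => by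
    obtain ⟨g, hg⟩ := exists_isGerm (C := C) (h := h) f q.2
    obtain ⟨g', hg'⟩ := exists_isGerm (C := C) (h := h) f' q.2
    rw [((hg.add hg').pdFun a).ev_eq q.2, ((hg.pdFun a).add (hg'.pdFun a)).ev_eq q.2, map_add]

theorem pdHom_apply (a : Fin m ⊕ Fin n) (W : Opens M) (h : W ≤ U) (f : ℳ.Γ W) :
    C.pdHom a W h f = C.pdFun a W h f := rfl

theorem pdFun_res (a : Fin m ⊕ Fin n) {W W' : Opens M} (h : W ≤ U) (hW : W' ≤ W) (f : ℳ.Γ W) :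
    ℳ.res hW (C.pdFun a W h f) = C.pdFun a W' (hW.trans h) (ℳ.res hW f) := by
  refine ext_ev (C := C) (h := hW.trans h) fun q => ?_
  obtain ⟨g, hg⟩ := exists_isGerm (C := C) (h := h) f (hW q.2)
  rw [((hg.pdFun a).res hW q.2).ev_eq q.2, ((hg.res hW q.2).pdFun a).ev_eq q.2]

/-- The coordinate vector fields of a chart. -/
def field (a : Fin m ⊕ Fin n) : VF ℳ U where
  comp k V W hU hV :=
    if k = par a then (C.pdHom a W hU).comp (ℳ.res (le_of_mapsInto_id hV) : ℳ.Γ V →+ ℳ.Γ W) else 0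
  comp_mem k V W hU hV i f hf := by
    split_ifs with hk
    · rw [C.mem_gr_iff W hU]
      intro q
      have hr := ℳ.res_mem (le_of_mapsInto_id hV) i f hf
      obtain ⟨g, hg⟩ := exists_isGerm (C := C) (h := hU) (ℳ.res (le_of_mapsInto_id hV) f) q.2
      obtain ⟨O, hO, hqO, hgO⟩ := hg.mem_gr hr
      have := (hg.pdFun a).ev_eq q.2
      rw [AddMonoidHom.comp_apply, pdHom_apply, hk]
      exact this ▸ 𝔐.pd_mem a hO hgO hqO
    · rw [AddMonoidHom.zero_apply]
      exact zero_mem _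
  leibniz k V W hU hV i f f' hf := by
    split_ifs with hk
    · refine ext_ev (C := C) (h := hU) fun q => ?_
      have hr := ℳ.res_mem (le_of_mapsInto_id hV) i f hf
      obtain ⟨g, hg⟩ := exists_isGerm (C := C) (h := hU) (ℳ.res (le_of_mapsInto_id hV) f) q.2
      obtain ⟨g', hg'⟩ := exists_isGerm (C := C) (h := hU) (ℳ.res (le_of_mapsInto_id hV) f') q.2
      obtain ⟨O, hO, hqO, hgO⟩ := hg.mem_gr hr
      simp only [AddMonoidHom.comp_apply, pdHom_apply, AddMonoidHom.coe_coe, map_mul]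
      have e1 := ((hg.mul hg').pdFun a).ev_eq q.2
      have e2 := (hg.pdFun a).ev_eq q.2
      have e3 := (hg'.pdFun a).ev_eq q.2
      have e4 := hg.ev_eq q.2
      have e5 := hg'.ev_eq q.2
      rw [e1, 𝔐.pd_mul a g g' (hgO _ hqO), map_add, map_zsmul, map_mul, map_mul, hk]
      simp only [Pi.add_apply, Pi.smul_apply, Pi.mul_apply]
      have e6 : ∀ f, (Hom.id ℳ).pull V W hV f = ℳ.res (le_of_mapsInto_id hV) f := fun _ => rfl
      rw [e6, e6, e2, e3, e4, e5]
    · simp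
  comp_ι k V W hU hV b := by
    split_ifs with hk
    · refine ext_ev (C := C) (h := hU) fun q => ?_
      have hg : C.IsGerm hU (ℳ.ι W b) q.1 (constFn m (𝔐.ι b)) :=
        ⟨W, le_rfl, q.2, fun q' hq' => C.ev_ι W hU b _⟩
      have := (hg.pdFun a).ev_eq q.2
      rw [𝔐.pd_const_ι] at this
      simp only [AddMonoidHom.comp_apply, pdHom_apply, AddMonoidHom.coe_coe, ℳ.res_ι, map_zero]
      exact this
    · simp
  res_comp k V V' W W' hU hU' hV hV' hVV hW f := by
    split_ifs with hk
    · simp only [AddMonoidHom.comp_apply, pdHom_apply, AddMonoidHom.coe_coe]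
      rw [C.pdFun_res, ℳ.res_res, ℳ.res_res]
    · simp

theorem field_comp (a : Fin m ⊕ Fin n) (k : ZMod 2) (V W hU hV) (f : ℳ.Γ V) :
    (C.field a).comp k V W hU hV f
      = if k = par a then C.pdFun a W hU (ℳ.res (le_of_mapsInto_id hV) f) else 0 := by
  simp only [field]
  split_ifs <;> rfl

theorem field_isHomogeneous (a : Fin m ⊕ Fin n) : (C.field a).IsHomogeneous (par a) := by
  intro j hj V W hU hV
  simp only [field, if_neg hj]

theorem rep_pdFun (a : Fin m ⊕ Fin n) (f : ℳ.Γ U) :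
    C.rep (C.pdFun a U le_rfl f) = 𝔐.pd a (C.rep f) := by
  refine Subtype.ext (funext fun z => ?_)
  have := ((C.isGerm_rep f (C.inv_mem z)).pdFun a).ev_eq (C.inv_mem z)
  rw [C.coord_inv] at this
  exact this

theorem pdFun_crd (a b : Fin m ⊕ Fin n) :
    C.pdFun a U le_rfl (C.crd b) = if a = b then 1 else 0 := by
  apply C.rep_bijective.1
  rw [rep_pdFun, crd, rep_sec, 𝔐.pd_cfn]
  split_ifs
  · rw [map_one]
  · rw [map_zero]

end SuperChart

end Sections

/-! ### Calculus of super derivations -/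

section Calculus

variable {P : Type w} [Ring P] [Algebra ℝ P] {𝒢 : ZMod 2 → Submodule ℝ P}
variable {M : Type u} [TopologicalSpace M] {N : Type v} [TopologicalSpace N]
variable {ℳ : SuperSpace.{u, w, x} 𝒢 M} {𝒩 : SuperSpace.{v, w, y} 𝒢 N}

theorem SuperSpace.sum_pr (ℳ : SuperSpace.{u, w, x} 𝒢 M) (U : Opens M) (f : ℳ.Γ U) :
    ∑ i : ZMod 2, ℳ.pr U i f = f := by
  classical
  have := DirectSum.sum_support_decompose (ℳ.gr U) f
  refine Eq.trans (Finset.sum_subset (Finset.subset_univ _) fun k _ hk => ?_).symm this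
  have h : (DirectSum.decompose (ℳ.gr U) f k : ℳ.Γ U) = 0 := by simpa using hk
  exact h

theorem SuperSpace.pr_of_mem (ℳ : SuperSpace.{u, w, x} 𝒢 M) {U : Opens M} {i : ZMod 2}
    {f : ℳ.Γ U} (hf : f ∈ ℳ.gr U i) (j : ZMod 2) : ℳ.pr U j f = if j = i then f else 0 := by
  split_ifs with h
  · rw [h]
    exact DirectSum.decompose_of_mem_same _ hf
  · exact DirectSum.decompose_of_mem_ne _ hf (Ne.symm h)

namespace SDer

variable {Φ : Hom ℳ 𝒩} {U : Opens M}

/-- The value of a derivation on a section, as an additive map. -/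
def val (D : SDer Φ U) {V : Opens N} (hV : MapsInto Φ.body U V) : 𝒩.Γ V →+ ℳ.Γ U :=
  AddMonoidHom.mk' (D.apply V U le_rfl hV) fun f g => by
    simp only [apply, map_add, Finset.sum_add_distrib]

theorem val_apply (D : SDer Φ U) {V : Opens N} (hV : MapsInto Φ.body U V) (f : 𝒩.Γ V) :
    D.val hV f = ∑ k : ZMod 2, D.comp k V U le_rfl hV f := rfl

variable {V : Opens N} (hV : MapsInto Φ.body U V)

/-- The evaluation of derivations on a section, as an additive map. -/
def valAt (f : 𝒩.Γ V) : SDer Φ U →+ ℳ.Γ U :=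
  AddMonoidHom.mk' (fun D => D.val hV f) fun D E => by
    simp only [val_apply, add_comp, AddMonoidHom.add_apply, Finset.sum_add_distrib]

theorem val_add (D E : SDer Φ U) (f : 𝒩.Γ V) : (D + E).val hV f = D.val hV f + E.val hV f :=
  map_add (valAt hV f) D E

theorem val_sub (D E : SDer Φ U) (f : 𝒩.Γ V) : (D - E).val hV f = D.val hV f - E.val hV f :=
  map_sub (valAt hV f) D E

theorem val_zsmul (c : ℤ) (D : SDer Φ U) (f : 𝒩.Γ V) : (c • D).val hV f = c • D.val hV f :=
  map_zsmul (valAt hV f) c D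

theorem val_sum {I : Type*} (s : Finset I) (D : I → SDer Φ U) (f : 𝒩.Γ V) :
    (∑ i ∈ s, D i).val hV f = ∑ i ∈ s, (D i).val hV f :=
  map_sum (valAt hV f) D s

theorem smul_comp (a : ℳ.Γ U) (D : SDer Φ U) (k V W hU hV) (f : 𝒩.Γ V) :
    (a • D).comp k V W hU hV f
      = ∑ l : ZMod 2, ℳ.res hU (ℳ.pr U l a) * D.comp (k - l) V W hU hV f := by
  change (∑ l : ZMod 2, (AddMonoidHom.mulLeft (ℳ.res hU (ℳ.pr U l a))).comp
    (D.comp (k - l) V W hU hV)) f = _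
  rw [AddMonoidHom.finsetSum_apply]
  rfl

theorem val_smul (a : ℳ.Γ U) (D : SDer Φ U) (f : 𝒩.Γ V) :
    (a • D).val hV f = a * D.val hV f := by
  simp only [val_apply, smul_comp]
  rw [Finset.sum_comm]
  conv_rhs => rw [← ℳ.sum_pr U a, Finset.sum_mul]
  refine Finset.sum_congr rfl fun l _ => ?_
  rw [ℳ.res_self, ← Finset.mul_sum]
  congr 1
  exact Equiv.sum_comp (Equiv.subRight l) fun k => D.comp k V U le_rfl hV f

theorem IsHomogeneous.val_eq {D : SDer Φ U} {k : ZMod 2} (h : D.IsHomogeneous k) (f : 𝒩.Γ V) :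
    D.val hV f = D.comp k V U le_rfl hV f := by
  rw [val_apply]
  refine Finset.sum_eq_single k (fun j _ hj => ?_) (fun h => absurd (Finset.mem_univ _) h)
  rw [h j hj]
  rfl

theorem IsHomogeneous.val_mem {D : SDer Φ U} {k i : ZMod 2} (h : D.IsHomogeneous k) {f : 𝒩.Γ V}
    (hf : f ∈ 𝒩.gr V i) : D.val hV f ∈ ℳ.gr U (k + i) := by
  rw [h.val_eq]
  exact D.comp_mem k V U le_rfl hV i f hf

theorem IsHomogeneous.val_mul {D : SDer Φ U} {k i : ZMod 2} (h : D.IsHomogeneous k) {f : 𝒩.Γ V}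
    (g : 𝒩.Γ V) (hf : f ∈ 𝒩.gr V i) : D.val hV (f * g) = D.val hV f * Φ.pull V U hV g
      + sgn k i • (Φ.pull V U hV f * D.val hV g) := by
  rw [h.val_eq, h.val_eq, h.val_eq]
  exact D.leibniz k V U le_rfl hV i f g hf

/-- On a homogeneous section the components of `D` have distinct parities, so the total value
determines each of them. This reduces statements about components to statements about `val`. -/
theorem comp_eq_pr (D : SDer Φ U) {i : ZMod 2} {f : 𝒩.Γ V} (hf : f ∈ 𝒩.gr V i) (k : ZMod 2) :
    D.comp k V U le_rfl hV f = ℳ.pr U (k + i) (D.val hV f) := by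
  rw [val_apply, map_sum, Finset.sum_eq_single k]
  · rw [ℳ.pr_of_mem (D.comp_mem k V U le_rfl hV i f hf), if_pos rfl]
  · intro j _ hj
    rw [ℳ.pr_of_mem (D.comp_mem j V U le_rfl hV i f hf), if_neg]
    exact fun h => hj (add_right_cancel h).symm
  · exact fun h => absurd (Finset.mem_univ _) h

theorem res_val (D : SDer Φ U) {V' : Opens N} {U' : Opens M} (hU : U' ≤ U) (hVV : V' ≤ V)
    (hV' : MapsInto Φ.body U' V') (f : 𝒩.Γ V) :
    ℳ.res hU (D.val hV f) = (D.restrict hU).val hV' (𝒩.res hVV f) := by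
  rw [val_apply, val_apply, map_sum]
  exact Finset.sum_congr rfl fun k _ => D.res_comp k le_rfl hU hV hV' hVV hU f

theorem IsHomogeneous.add {D E : SDer Φ U} {k : ZMod 2} (hD : D.IsHomogeneous k)
    (hE : E.IsHomogeneous k) : (D + E).IsHomogeneous k := fun j hj V W hU hV => by
  rw [add_comp, hD j hj, hE j hj, add_zero]

theorem IsHomogeneous.neg {D : SDer Φ U} {k : ZMod 2} (hD : D.IsHomogeneous k) :
    (-D).IsHomogeneous k := fun j hj V W hU hV => by
  rw [neg_comp, hD j hj, neg_zero]

theorem IsHomogeneous.sub {D E : SDer Φ U} {k : ZMod 2} (hD : D.IsHomogeneous k)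
    (hE : E.IsHomogeneous k) : (D - E).IsHomogeneous k := by
  rw [sub_eq_add_neg]
  exact hD.add hE.neg

theorem IsHomogeneous.restrict {D : SDer Φ U} {k : ZMod 2} (hD : D.IsHomogeneous k)
    {U' : Opens M} (h : U' ≤ U) : (D.restrict h).IsHomogeneous k := fun j hj V W hU hV =>
  hD j hj V W (hU.trans h) hV

theorem isHomogeneous_part (D : SDer Φ U) (k : ZMod 2) : (D.part k).IsHomogeneous k :=
  fun _ hj _ _ _ _ => if_neg hj

theorem sum_part (D : SDer Φ U) : ∑ k, D.part k = D := by
  have h2 : (Finset.univ : Finset (ZMod 2)) = {0, 1} := rfl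
  rw [h2, Finset.sum_pair (by decide)]
  refine ext' fun k V W hU hV => ?_
  rw [add_comp]
  rcases eq_zero_or_eq_one k with rfl | rfl <;> simp [part]

/-- Composition of the components of a derivation with the restriction of its domain. -/
theorem comp_res (D : SDer Φ U) (k : ZMod 2) {V V' : Opens N} {W : Opens M} (hU : W ≤ U)
    (h : MapsInto Φ.body W V) (h' : MapsInto Φ.body W V') (hVV : V' ≤ V) (f : 𝒩.Γ V) :
    D.comp k V' W hU h' (𝒩.res hVV f) = D.comp k V W hU h f := by
  have := D.res_comp k hU hU h h' hVV le_rfl f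
  rw [ℳ.res_self] at this
  exact this.symm

end SDer

/-- Composition of the components of a supermorphism with the restriction of its domain. -/
theorem Hom.pull_res (Φ : Hom ℳ 𝒩) {V V' : Opens N} {W : Opens M} (h : MapsInto Φ.body W V)
    (h' : MapsInto Φ.body W V') (hVV : V' ≤ V) (f : 𝒩.Γ V) :
    Φ.pull V' W h' (𝒩.res hVV f) = Φ.pull V W h f := by
  have := Φ.res_pull h h' hVV le_rfl f
  rw [ℳ.res_self] at this
  exact this.symm

/-- The action of a super vector field on superfunctions. -/
def act {U : Opens M} (X : VF ℳ U) : ℳ.Γ U →+ ℳ.Γ U := X.val (mapsInto_id ℳ le_rfl)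

section Act

variable {U : Opens M}

theorem act_def (X : VF ℳ U) (f : ℳ.Γ U) :
    act X f = X.apply U U le_rfl (mapsInto_id ℳ le_rfl) f := rfl

theorem act_mem {X : VF ℳ U} {k i : ZMod 2} (h : X.IsHomogeneous k) {f : ℳ.Γ U}
    (hf : f ∈ ℳ.gr U i) : act X f ∈ ℳ.gr U (k + i) :=
  h.val_mem _ hf

theorem act_mul {X : VF ℳ U} {k i : ZMod 2} (h : X.IsHomogeneous k) {f : ℳ.Γ U} (g : ℳ.Γ U)
    (hf : f ∈ ℳ.gr U i) : act X (f * g) = act X f * g + sgn k i • (f * act X g) := by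
  have := h.val_mul (mapsInto_id ℳ le_rfl) g hf
  have e : ∀ f, (Hom.id ℳ).pull U U (mapsInto_id ℳ le_rfl) f = f := ℳ.res_self U
  rwa [e, e] at this

theorem act_restrict (X : VF ℳ U) {U' : Opens M} (h : U' ≤ U) (f : ℳ.Γ U) :
    act (X.restrict h) (ℳ.res h f) = ℳ.res h (act X f) :=
  (X.res_val (mapsInto_id ℳ le_rfl) h h (mapsInto_id ℳ le_rfl) f).symm

/-- In the double sum over components only the one of `X` in parity `i` and the one of `Y` in parity
`j` survive. -/
theorem act_bracket {X Y : VF ℳ U} {i j : ZMod 2} (hX : X.IsHomogeneous i)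
    (hY : Y.IsHomogeneous j) (f : ℳ.Γ U) :
    act (bracket X Y) f = act X (act Y f) - sgn i j • act Y (act X f) := by
  have h1 : ∀ k, (bracket X Y).comp k U U le_rfl (mapsInto_id ℳ le_rfl) f
      = ∑ l : ZMod 2, (X.comp l U U le_rfl (mapsInto_id ℳ le_rfl)
          (Y.comp (k - l) U U le_rfl (mapsInto_id ℳ le_rfl) f)
        - sgn l (k - l) • Y.comp (k - l) U U le_rfl (mapsInto_id ℳ le_rfl)
          (X.comp l U U le_rfl (mapsInto_id ℳ le_rfl) f)) := fun k => by
    simp only [bracket]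
    rw [AddMonoidHom.finsetSum_apply]
    rfl
  have h2 : act (bracket X Y) f = ∑ k, (bracket X Y).comp k U U le_rfl (mapsInto_id ℳ le_rfl) f :=
    rfl
  rw [h2]
  simp only [h1]
  rw [Finset.sum_comm, Finset.sum_eq_single i, Finset.sum_eq_single (i + j)]
  · rw [add_sub_cancel_left, act, act, hX.val_eq, hY.val_eq, hX.val_eq, hY.val_eq]
  · intro k _ hk
    have hk' : k - i ≠ j := fun h => hk (by rw [← h]; ring)
    rw [hY _ hk']
    simp
  · exact fun h => absurd (Finset.mem_univ _) h
  · intro l _ hl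
    refine Finset.sum_eq_zero fun k _ => ?_
    rw [hX _ hl]
    simp
  · exact fun h => absurd (Finset.mem_univ _) h

theorem bracket_sub_left (X X' Y : VF ℳ U) :
    bracket (X - X') Y = bracket X Y - bracket X' Y := by
  have hadd : ∀ X X' : VF ℳ U, bracket (X + X') Y = bracket X Y + bracket X' Y := by
    intro X X'
    refine SDer.ext' fun k V W hU hV => ?_
    rw [SDer.add_comp]
    simp only [bracket]
    rw [← Finset.sum_add_distrib]
    refine Finset.sum_congr rfl fun l _ => ?_
    ext f
    simp only [SDer.add_comp, AddMonoidHom.sub_apply, AddMonoidHom.add_apply,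
      AddMonoidHom.smul_apply, AddMonoidHom.comp_apply, map_add, smul_add]
    abel
  exact map_sub (AddMonoidHom.mk' (fun X => bracket X Y) hadd) X X'

end Act

variable {Φ : Hom ℳ 𝒩} {U : Opens M} {V : Opens N} (hV : MapsInto Φ.body U V)

theorem val_pullVF (S : VF 𝒩 V) (f : 𝒩.Γ V) :
    (pullVF Φ S U hV).val hV f = Φ.pull V U hV (act S f) := by
  rw [SDer.val_apply, act_def, SDer.apply, map_sum]
  refine Finset.sum_congr rfl fun k _ => ?_
  have h1 := S.res_comp k (le_refl V) (inf_le_left : V ⊓ V ≤ V) (mapsInto_id 𝒩 le_rfl)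
    (mapsInto_id 𝒩 inf_le_right) le_rfl inf_le_left f
  rw [𝒩.res_self] at h1
  change Φ.pull (V ⊓ V) U _ (S.comp k V (V ⊓ V) inf_le_left (mapsInto_id 𝒩 inf_le_right) f) = _
  rw [← h1, Φ.pull_res hV]

theorem val_differential (X : VF ℳ U) (f : 𝒩.Γ V) :
    (differential Φ X).val hV f = act X (Φ.pull V U hV f) := by
  rw [SDer.val_apply, act_def, SDer.apply]
  refine Finset.sum_congr rfl fun k _ => ?_
  change X.comp k (Opens.comap Φ.body V) U le_rfl _ (Φ.pull V (Opens.comap Φ.body V) _ f) = _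
  rw [← X.comp_res k le_rfl _ (mapsInto_id ℳ le_rfl) hV.le_comap,
    Φ.res_pull _ hV le_rfl, 𝒩.res_self]

theorem pullVF_isHomogeneous {S : VF 𝒩 V} {k : ZMod 2} (h : S.IsHomogeneous k) :
    (pullVF Φ S U hV).IsHomogeneous k := fun j hj V' W hU hV' => by
  ext f
  change Φ.pull _ W _ (S.comp j V' _ _ _ f) = 0
  rw [h j hj]
  exact map_zero _

end Calculus

/-! ### Supermorphisms and derivations in charts -/

section InCharts

variable {P : Type w} [Ring P] [Algebra ℝ P] {𝒢 : ZMod 2 → Submodule ℝ P} [GradedAlgebra 𝒢]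
  [IsSmall 𝒢] {n m r s : ℕ}
variable {F : Type} [NormedRing F] [NormedAlgebra ℝ F] [FiniteDimensional ℝ F]
variable {F' : Type} [NormedRing F'] [NormedAlgebra ℝ F'] [FiniteDimensional ℝ F']
variable {M : Type u} [TopologicalSpace M] {N : Type v} [TopologicalSpace N]
variable {ℳ : SuperSpace.{u, w, x} 𝒢 M} {𝒩 : SuperSpace.{v, w, y} 𝒢 N}
variable {𝔐 : FibreModel 𝒢 n F} {𝔑 : FibreModel 𝒢 s F'}
variable {U : Opens M} {V : Opens N}

namespace SuperChart

/-- The value of a section at a point. -/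
def evAt (C : SuperChart ℳ 𝔐 m U) {W : Opens M} (h : W ≤ U) {q : M} (hq : q ∈ W) : ℳ.Γ W →ₐ[ℝ] F :=
  (Pi.evalAlgHom ℝ (fun _ : W => F) ⟨q, hq⟩).comp (C.ev W h)

theorem evAt_res (C : SuperChart ℳ 𝔐 m U) {W W' : Opens M} (h : W ≤ U) (hW : W' ≤ W) {q : M}
    (hq : q ∈ W') (f : ℳ.Γ W) :
    C.evAt (hW.trans h) hq (ℳ.res hW f) = C.evAt h (hW hq) f :=
  C.ev_res h hW f ⟨q, hq⟩

/-- A compatible family of real characters of the algebras of sections near a point is the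
evaluation at that point. -/
theorem character_eq (E : SuperChart 𝒩 𝔑 r V) {q : N} (hq : q ∈ V)
    (χ : ∀ W : Opens N, W ≤ V → q ∈ W → (𝒩.Γ W →ₐ[ℝ] ℝ))
    (hχ : ∀ W (h : W ≤ V) (hqW : q ∈ W) (f : 𝒩.Γ V), χ W h hqW (𝒩.res h f) = χ V le_rfl hq f)
    (g : smoothAlg r ℝ) : χ V le_rfl hq (E.sec (ofReal g)) = g.1 (E.coord q) := by
  by_contra hne
  obtain ⟨c, hc⟩ : ∃ c, c = χ V le_rfl hq (E.sec (ofReal g)) := ⟨_, rfl⟩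
  rw [← hc] at hne
  let O : Set (Euc r) := {z | g.1 z - c ≠ 0}
  have hgc : Continuous g.1 := (smoothAlg.contDiff g).continuous
  have hO : IsOpen O := isOpen_ne_fun (hgc.sub continuous_const) continuous_const
  let W : Opens N := ⟨V ∩ E.coord ⁻¹' O, E.continuousOn_coord.isOpen_inter_preimage V.2 hO⟩
  have hW : W ≤ V := fun x hx => hx.1
  have hqW : q ∈ W := ⟨hq, sub_ne_zero.2 (Ne.symm hne)⟩
  -- If the character had a value `c` other than the value of `g` at `q`, then `g - c` would be
  -- invertible near `q` but sent to zero. The inverse exists only on the smaller set `W`, whence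
  -- the need for a compatible family of characters.
  obtain ⟨k, hk⟩ := (E.mem_range_ev W hW
      (fun x => algebraMap ℝ F' (g.1 (E.coord x) - c)⁻¹)).2 fun x => by
    have hG : ContDiffOn ℝ ∞ (fun z => algebraMap ℝ F' (g.1 z - c)⁻¹) O :=
      (algebraMapCLM ℝ F').contDiff.comp_contDiffOn
        ((((smoothAlg.contDiff g).sub contDiff_const).contDiffOn).inv fun z hz => hz)
    obtain ⟨g', O', hO', hx, hsub, hg'⟩ := exists_contDiff_extension hO x.2.2 hG
    refine ⟨g', ⟨W ∩ E.coord ⁻¹' O',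
      (E.continuousOn_coord.mono hW).isOpen_inter_preimage W.2 hO'⟩, fun y hy => hy.1,
      ⟨x.2, hx⟩, fun y hy => (hg' _ hy.2).symm⟩
  have h1 : k * 𝒩.res hW (E.sec (ofReal g) - algebraMap ℝ _ c) = 1 := by
    refine ext_ev (C := E) (h := hW) fun x => ?_
    have hx : g.1 (E.coord x) - c ≠ 0 := x.2.2
    rw [map_mul, Pi.mul_apply, hk, E.ev_res le_rfl hW, ← E.rep_coord _ (hW x.2), map_sub, rep_sec,
      AlgHom.commutes, map_one]
    change algebraMap ℝ F' _ * (algebraMap ℝ F' (g.1 (E.coord x)) - algebraMap ℝ F' c) = 1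
    rw [← map_sub, ← map_mul, inv_mul_cancel₀ hx, map_one]
  have h2 := congrArg (χ W hW hqW) h1
  rw [map_mul, hχ, map_sub, AlgHom.commutes, ← hc, map_one] at h2
  simp at h2

/-- The homomorphisms of function algebras that represent a supermorphism. -/
def localHom (C : SuperChart ℳ 𝔐 m U) (E : SuperChart 𝒩 𝔑 r V) (Φ : Hom ℳ 𝒩)
    (hV : MapsInto Φ.body U V) : smoothAlg r F' →ₐ[ℝ] smoothAlg m F :=
  (C.rep.comp (Φ.pull V U hV)).comp E.sec

/-- The value of `localHom` at a point. -/
def localHomAt (C : SuperChart ℳ 𝔐 m U) (E : SuperChart 𝒩 𝔑 r V) (Φ : Hom ℳ 𝒩)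
    (hV : MapsInto Φ.body U V) (z : Euc m) : smoothAlg r F' →ₐ[ℝ] F :=
  ((Pi.evalAlgHom ℝ (fun _ => F) z).comp (smoothAlg m F).val).comp (C.localHom E Φ hV)

variable (C : SuperChart ℳ 𝔐 m U) (E : SuperChart 𝒩 𝔑 r V) (Φ : Hom ℳ 𝒩)
  (hV : MapsInto Φ.body U V)

theorem localHomAt_rep (z : Euc m) (f : 𝒩.Γ V) :
    C.localHomAt E Φ hV z (E.rep f) = (C.rep (Φ.pull V U hV f)).1 z := by
  change (C.rep (Φ.pull V U hV (E.sec (E.rep f)))).1 z = _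
  rw [sec_rep]

theorem localHomAt_apply (z : Euc m) (g : smoothAlg r F') :
    C.localHomAt E Φ hV z g = (C.rep (Φ.pull V U hV (E.sec g))).1 z := rfl

/-- The body of the pulled-back value at a point is a character of sections near the image point. It
is defined on every neighbourhood `W` of that point, by pulling back to the part of `U` lying over
`W`, so `character_eq` applies. -/
theorem ε_localHomAt (z : Euc m) (g : smoothAlg r ℝ) :
    𝔐.ε (C.localHomAt E Φ hV z (ofReal g)) = g.1 (E.coord (Φ.body (C.inv z))) := by
  have hq := C.inv_mem z
  have hm : ∀ W : Opens N, MapsInto Φ.body (U ⊓ Opens.comap Φ.body W) W := fun W x hx => hx.2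
  have key : ∀ (W : Opens N) (h : W ≤ V) (hqW : Φ.body (C.inv z) ∈ W) (f : 𝒩.Γ V),
      C.evAt inf_le_left (⟨hq, hqW⟩ : C.inv z ∈ U ⊓ Opens.comap Φ.body W)
        (Φ.pull W _ (hm W) (𝒩.res h f)) = C.evAt le_rfl hq (Φ.pull V U hV f) := by
    intro W h hqW f
    rw [← Φ.res_pull hV (hm W) h inf_le_left]
    exact C.evAt_res le_rfl inf_le_left _ _
  have := E.character_eq (hV _ hq) (fun W _ hqW => (𝔐.ε.comp
      (C.evAt inf_le_left (⟨hq, hqW⟩ : C.inv z ∈ U ⊓ Opens.comap Φ.body W))).comp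
        (Φ.pull W _ (hm W))) (fun W h hqW f => by
      simp only [AlgHom.comp_apply]
      have h1 := key V le_rfl (hV _ hq) f
      rw [𝒩.res_self] at h1
      rw [key W h hqW, h1]) g
  rw [← this]
  simp only [AlgHom.comp_apply]
  have h1 := key V le_rfl (hV _ hq) (E.sec (ofReal g))
  rw [𝒩.res_self] at h1
  rw [h1]
  rfl

theorem sec_const_ι (a : P) : E.sec (constFn r (𝔑.ι a)) = 𝒩.ι V a := by
  rw [← E.rep_ι, sec_rep]

theorem localHomAt_const_ι (z : Euc m) (a : P) :
    C.localHomAt E Φ hV z (constFn r (𝔑.ι a)) = 𝔐.ι a := by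
  rw [localHomAt_apply, sec_const_ι, Φ.pull_ι, rep_ι]
  rfl

theorem sec_mem_gr (g : smoothAlg r F') (k : ZMod 2) (hg : ∀ z, g.1 z ∈ 𝔑.gr k) :
    E.sec g ∈ 𝒩.gr V k := by
  rw [E.rep_mem_gr_iff, rep_sec]
  exact hg

theorem sec_ofReal_mem (g : smoothAlg r ℝ) : E.sec (ofReal g) ∈ 𝒩.gr V 0 := by
  refine E.sec_mem_gr _ _ fun z => ?_
  rw [ofReal_apply, Algebra.algebraMap_eq_smul_one]
  exact Submodule.smul_mem _ _ 𝔑.one_mem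

/-- A derivation along a supermorphism vanishes if it annihilates the coordinates. -/
theorem sder_eq_zero (C : SuperChart ℳ 𝔐 m U) (E : SuperChart 𝒩 𝔑 r V) {Φ : Hom ℳ 𝒩}
    (hV : MapsInto Φ.body U V) (D : SDer Φ U)
    (h : ∀ a, D.val hV (E.crd a) = 0) : D = 0 := by
  have hcrd : ∀ k a, D.comp k V U le_rfl hV (E.crd a) = 0 := fun k a => by
    rw [D.comp_eq_pr hV (E.crd_mem a), h, map_zero]
  have h1 : ∀ k f, D.comp k V U le_rfl hV f = 0 := by
    intro k f
    apply C.rep_bijective.1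
    rw [map_zero]
    refine Subtype.ext (funext fun z => ?_)
    -- The component of parity `k` satisfies a Leibniz rule with signs; `T` absorbs them and makes
    -- the rule valid for inhomogeneous `f`, as `derivation_eq_zero` demands. On real functions,
    -- which are even, `T` is the identity.
    let T : 𝒩.Γ V → 𝒩.Γ V := fun f => ∑ i, sgn k i • 𝒩.pr V i f
    have hD : ∀ f g, D.comp k V U le_rfl hV (f * g) = D.comp k V U le_rfl hV f * Φ.pull V U hV g
        + Φ.pull V U hV (T f) * D.comp k V U le_rfl hV g := by
      intro f g
      have e1 : f * g = ∑ i, 𝒩.pr V i f * g := by rw [← Finset.sum_mul, 𝒩.sum_pr]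
      have e2 : D.comp k V U le_rfl hV f = ∑ i, D.comp k V U le_rfl hV (𝒩.pr V i f) := by
        rw [← map_sum, 𝒩.sum_pr]
      rw [e1, map_sum, e2, Finset.sum_mul, map_sum, Finset.sum_mul, ← Finset.sum_add_distrib]
      refine Finset.sum_congr rfl fun i _ => ?_
      rw [D.leibniz k V U le_rfl hV i _ _ (𝒩.pr_mem V i f), map_zsmul, smul_mul_assoc]
    have e : ∀ g, E.sec (E.rep g) = g := E.sec_rep
    have := derivation_eq_zero 𝔑 𝔐.ker_ε_pow (C.localHomAt E Φ hV z)
      (fun g => (C.rep (Φ.pull V U hV (T (E.sec g)))).1 z) (C.ε_localHomAt E Φ hV z)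
      (fun g => by
        have : T (E.sec (ofReal g)) = E.sec (ofReal g) := by
          simp only [T, 𝒩.pr_of_mem (E.sec_ofReal_mem g)]
          rw [Finset.sum_eq_single 0 (fun j _ hj => by rw [if_neg hj, smul_zero])
            (fun h => absurd (Finset.mem_univ _) h), if_pos rfl, sgn_zero_right, one_smul]
        simp only [this]
        rfl)
      (((Pi.evalAddMonoidHom (fun _ => F) z).comp
        ((smoothAlg m F).val : smoothAlg m F →+ (Euc m → F))).comp
          ((C.rep : ℳ.Γ U →+ smoothAlg m F).comp
            ((D.comp k V U le_rfl hV).comp (E.sec : smoothAlg r F' →+ 𝒩.Γ V))))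
      (fun f g => by
        change (C.rep (D.comp k V U le_rfl hV (E.sec (f * g)))).1 z = _
        rw [map_mul, hD, map_add, map_mul, map_mul]
        rfl)
      (fun a => by
        change (C.rep (D.comp k V U le_rfl hV (E.sec (constFn r (𝔑.ι a))))).1 z = 0
        rw [sec_const_ι, D.comp_ι, map_zero]
        rfl)
      (fun j => by
        change (C.rep (D.comp k V U le_rfl hV (E.crd (Sum.inr j)))).1 z = 0
        rw [hcrd, map_zero]
        rfl)
      (fun i => by
        change (C.rep (D.comp k V U le_rfl hV (E.crd (Sum.inl i)))).1 z = 0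
        rw [hcrd, map_zero]
        rfl) (E.rep f)
    change (C.rep (D.comp k V U le_rfl hV (E.sec (E.rep f)))).1 z = 0 at this
    rw [sec_rep] at this
    exact this
  refine SDer.ext' fun k V' W hU hV' => ?_
  ext f
  rw [SDer.zero_comp, AddMonoidHom.zero_apply]
  -- A section over an arbitrary open set agrees near each point with one over the chart, where the
  -- component is already known to vanish.
  refine ℳ.ext_local fun q hq => ?_
  obtain ⟨g, V₁, hV₁, hV₁', hq₁, hg⟩ := E.exists_extension f (hV' q hq) (hV q (hU hq))
  let W₁ : Opens M := W ⊓ Opens.comap Φ.body V₁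
  have hW₁ : W₁ ≤ W := inf_le_left
  have hm : MapsInto Φ.body W₁ V₁ := fun x hx => hx.2
  refine ⟨W₁, hW₁, ⟨hq, hq₁⟩, ?_⟩
  rw [D.res_comp k hU (hW₁.trans hU) hV' hm hV₁ hW₁, hg,
    ← D.res_comp k le_rfl (hW₁.trans hU) hV hm hV₁' (hW₁.trans hU), h1, map_zero, map_zero]

theorem sder_ext (C : SuperChart ℳ 𝔐 m U) (E : SuperChart 𝒩 𝔑 r V) {Φ : Hom ℳ 𝒩}
    (hV : MapsInto Φ.body U V) {D D' : SDer Φ U}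
    (h : ∀ a, D.val hV (E.crd a) = D'.val hV (E.crd a)) : D = D' := by
  refine sub_eq_zero.1 (C.sder_eq_zero E hV _ fun a => ?_)
  rw [SDer.val_sub, h, sub_self]

theorem act_field (a : Fin m ⊕ Fin n) (f : ℳ.Γ U) :
    act (C.field a) f = C.pdFun a U le_rfl f := by
  rw [act, (C.field_isHomogeneous a).val_eq, field_comp, if_pos rfl, ℳ.res_self]

theorem rep_act_field (a : Fin m ⊕ Fin n) (f : ℳ.Γ U) :
    C.rep (act (C.field a) f) = 𝔐.pd a (C.rep f) := by
  rw [act_field, rep_pdFun]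

theorem act_field_crd (a b : Fin m ⊕ Fin n) :
    act (C.field a) (C.crd b) = if a = b then 1 else 0 := by
  rw [act_field, pdFun_crd]

/-- The expansion of a derivation in terms of coordinate fields. -/
theorem sder_expand (C : SuperChart ℳ 𝔐 m U) (E : SuperChart 𝒩 𝔑 r V) {Φ : Hom ℳ 𝒩}
    (hV : MapsInto Φ.body U V) (D : SDer Φ U) :
    D = ∑ a, D.val hV (E.crd a) • pullVF Φ (E.field a) U hV := by
  refine C.sder_ext E hV fun b => ?_
  rw [SDer.val_sum]
  simp only [SDer.val_smul, val_pullVF, act_field_crd]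
  rw [Finset.sum_eq_single b]
  · rw [if_pos rfl, map_one, mul_one]
  · intro a _ ha
    rw [if_neg ha, map_zero, mul_zero]
  · exact fun h => absurd (Finset.mem_univ _) h

theorem vf_expand (X : VF ℳ U) : X = ∑ a, act X (C.crd a) • C.field a := by
  refine C.sder_ext C (mapsInto_id ℳ le_rfl) fun b => ?_
  rw [SDer.val_sum]
  simp only [SDer.val_smul]
  rw [Finset.sum_eq_single b]
  · have := C.act_field_crd b b
    rw [if_pos rfl] at this
    rw [act] at this
    rw [this, mul_one]
    rfl
  · intro a _ ha
    have := C.act_field_crd a b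
    rw [if_neg ha] at this
    rw [act] at this
    rw [this, mul_zero]
  · exact fun h => absurd (Finset.mem_univ _) h

theorem act_expand (X : VF ℳ U) (f : ℳ.Γ U) :
    act X f = ∑ a, act X (C.crd a) * act (C.field a) f := by
  conv_lhs => rw [C.vf_expand X]
  rw [act, SDer.val_sum]
  exact Finset.sum_congr rfl fun a _ => SDer.val_smul _ _ _ _

theorem vf_ext {X Y : VF ℳ U} (h : ∀ a, act X (C.crd a) = act Y (C.crd a)) : X = Y :=
  C.sder_ext C (mapsInto_id ℳ le_rfl) h

/-- The bracket of two coordinate fields annihilates the coordinates, whose first derivatives are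
the constants zero and one, and hence is zero. -/
theorem act_field_comm (a b : Fin m ⊕ Fin n) (f : ℳ.Γ U) :
    act (C.field a) (act (C.field b) f)
      = sgn (par a) (par b) • act (C.field b) (act (C.field a) f) := by
  have h : bracket (C.field a) (C.field b) = 0 := by
    refine C.vf_ext fun c => ?_
    rw [act_bracket (C.field_isHomogeneous a) (C.field_isHomogeneous b), act_field_crd,
      act_field_crd]
    have h0 : ∀ (X : VF ℳ U) (p : Prop) [Decidable p] (j : ZMod 2), X.IsHomogeneous j →
        act X (if p then 1 else 0) = 0 := by
      intro X p _ j hX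
      split_ifs
      · rw [← map_one (ℳ.ι U), act, hX.val_eq, X.comp_ι]
      · exact map_zero _
    rw [h0 _ _ _ (C.field_isHomogeneous a), h0 _ _ _ (C.field_isHomogeneous b), smul_zero, sub_zero]
    exact (map_zero (SDer.valAt (mapsInto_id ℳ le_rfl) (C.crd c))).symm
  have h1 := act_bracket (C.field_isHomogeneous a) (C.field_isHomogeneous b) f
  rw [h] at h1
  have h2 : act (0 : VF ℳ U) f = 0 := map_zero (SDer.valAt (mapsInto_id ℳ le_rfl) f)
  rw [h2] at h1
  exact (sub_eq_zero.1 h1.symm)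

theorem differential_expand (C : SuperChart ℳ 𝔐 m U) (E : SuperChart 𝒩 𝔑 r V) {Φ : Hom ℳ 𝒩}
    (hV : MapsInto Φ.body U V) (X : VF ℳ U) :
    differential Φ X
      = ∑ a, act X (Φ.pull V U hV (E.crd a)) • pullVF Φ (E.field a) U hV := by
  conv_lhs => rw [C.sder_expand E hV (differential Φ X)]
  simp only [val_differential]

end SuperChart

end InCharts

/-! ### Controlled systems of sections -/

section Systems

/-- The evaluation of functions on the one-point supermanifold. -/
def pointEval {P : Type w} [Ring P] [Algebra ℝ P] (𝒢 : ZMod 2 → Submodule ℝ P) [GradedAlgebra 𝒢]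
    [IsSmall 𝒢] : (pointSpace 𝒢).Γ ⊤ →ₐ[ℝ] P :=
  Pi.evalAlgHom ℝ (fun _ : (⊤ : Opens PUnit.{1}) => P) ⟨PUnit.unit, trivial⟩

variable {P : Type w} [Ring P] [Algebra ℝ P] {𝒢 : ZMod 2 → Submodule ℝ P} [GradedAlgebra 𝒢]
  [IsSmall 𝒢] {n m r s : ℕ}
variable {F : Type} [NormedRing F] [NormedAlgebra ℝ F] [FiniteDimensional ℝ F]
variable {M : Type u} [TopologicalSpace M]
variable {ℳ : SuperSpace.{u, w, x} 𝒢 M} {𝔐 : FibreModel 𝒢 n F} {U : Opens M}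

namespace SuperChart

variable (C : SuperChart ℳ 𝔐 m U)

/-- The functions that represent a family of sections. -/
def repFam {L : Type} (v : L → ℳ.Γ U) (z : Euc m) (l : L) : F := (C.rep (v l)).1 z

/-- A section is controlled by a family of sections. -/
def SecControlled {L : Type} [Fintype L] (v : L → ℳ.Γ U) (f : ℳ.Γ U) : Prop :=
  Controlled 𝔐.ε (C.repFam v) fun z => (C.rep f).1 z

variable {C} in
theorem SecControlled.of_eq {L : Type} [Fintype L] {v : L → ℳ.Γ U} {f f' : ℳ.Γ U}
    (h : C.SecControlled v f) (e : f = f') : C.SecControlled v f' := e ▸ h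

variable {L : Type} [Fintype L] {v : L → ℳ.Γ U}

/-- A controlled system of sections that vanishes at one point of the chart vanishes. -/
theorem system_eq_zero (h : ∀ a l, C.SecControlled v (act (C.field a) (v l))) {q : M} (hq : q ∈ U)
    (h0 : ∀ l, C.evAt le_rfl hq (v l) = 0) (l : L) : v l = 0 := by
  apply C.rep_bijective.1
  rw [map_zero]
  refine Subtype.ext (funext fun z => ?_)
  -- The case of the zero ideal. At an ordinary point, where the full fibre value is known to
  -- vanish, the even directions suffice.
  have hbot : IsTwoSided (⊥ : Submodule ℝ F) := fun a f hf => by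
    rw [Submodule.mem_bot] at hf ⊢
    rw [hf, mul_zero, zero_mul]
    simp
  have := mem_of_controlled (ε := 𝔐.ε) (u := C.repFam v)
    (fun l => smoothAlg.contDiff (C.rep (v l)))
    (fun i l => by
      have := h (Sum.inl i) l
      rw [SecControlled] at this
      simp only [rep_act_field] at this
      exact this) hbot bot_le (z₀ := C.coord q)
    (fun l => (Submodule.mem_bot ℝ).2 ((C.rep_coord (v l) hq).trans (h0 l))) z l
  exact (Submodule.mem_bot ℝ).1 this

/-- A controlled system of homogeneous sections that vanishes at a `P`-point vanishes. -/
theorem system_eq_zero_of_point (h : ∀ a l, C.SecControlled v (act (C.field a) (v l)))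
    (hv : ∀ l, ∃ k, v l ∈ ℳ.gr U k) (p : PPoint ℳ) (hp : p.pt ∈ U)
    (h0 : ∀ l, p.pull U ⊤ (p.mapsInto hp) (v l) = 0) (l : L) : v l = 0 := by
  let e := pointEval 𝒢
  let χ : smoothAlg m F →ₐ[ℝ] P := (e.comp (p.pull U ⊤ (p.mapsInto hp))).comp C.sec
  have hx : ∀ g, bodyMap 𝒢 (χ (ofReal g)) = g.1 (C.coord p.pt) := by
    intro g
    exact C.character_eq hp (fun W _ hW => (bodyMap 𝒢).comp (e.comp (p.pull W ⊤ (p.mapsInto hW))))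
      (fun W h hW f => by
        simp only [AlgHom.comp_apply]
        rw [p.pull_res (p.mapsInto hp) (p.mapsInto hW) h]) g
  have h1 : ∀ a, χ (constFn m (𝔐.ι a)) = a := fun a => by
    simp only [χ, AlgHom.comp_apply]
    rw [C.sec_const_ι, p.pull_ι]
    rfl
  have h2 : ∀ j, bodyMap 𝒢 (χ (constFn m (𝔐.θ j))) = 0 := fun j => by
    have h3 : p.pull U ⊤ (p.mapsInto hp) (C.crd (Sum.inr j)) ∈ (pointSpace 𝒢).gr ⊤ 1 :=
      p.pull_mem U ⊤ (p.mapsInto hp) 1 _ (C.crd_mem (Sum.inr j))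
    exact bodyMap_of_mem_odd 𝒢 (h3 ⟨PUnit.unit, trivial⟩)
  apply C.rep_bijective.1
  rw [map_zero]
  refine eq_zero_of_point 𝔐 χ hx h1 h2 (fun l => C.rep (v l)) (fun l z => ?_) (fun i l => ?_)
    (fun j l => ?_) (fun l => ?_) l
  · obtain ⟨k, hk⟩ := hv l
    exact ⟨_, 𝔐.γ_of_mem k _ ((C.rep_mem_gr_iff _ _).1 hk z)⟩
  · have := h (Sum.inl i) l
    rw [SecControlled] at this
    simp only [rep_act_field] at this
    exact this
  · have := h (Sum.inr j) l
    rw [SecControlled] at this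
    simp only [rep_act_field] at this
    exact this
  · simp only [χ, AlgHom.comp_apply]
    rw [sec_rep, h0, map_zero]

/-- A family of sections together with its first derivatives. -/
def jet {I : Type} (v : I → ℳ.Γ U) : I ⊕ ((Fin m ⊕ Fin n) × I) → ℳ.Γ U :=
  Sum.elim v fun p => act (C.field p.1) (v p.2)

variable {I : Type} [Fintype I] {v : I → ℳ.Γ U}

/-- Derivatives of the original sections are themselves entries of the jet, so a second-order system
becomes a first-order one once the second derivatives are controlled. -/
theorem jet_system (h : ∀ a b c, C.SecControlled (C.jet v) (act (C.field a) (act (C.field b)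
    (v c))))
    (a : Fin m ⊕ Fin n) (l : I ⊕ ((Fin m ⊕ Fin n) × I)) :
    C.SecControlled (C.jet v) (act (C.field a) (C.jet v l)) := by
  rcases l with c | ⟨b, c⟩
  · exact controlled_coord (Sum.inr (a, c) : I ⊕ ((Fin m ⊕ Fin n) × I))
  · exact h a b c

theorem jet_mem {k : I → ZMod 2} (h : ∀ c, v c ∈ ℳ.gr U (k c)) (l : I ⊕ ((Fin m ⊕ Fin n) × I)) :
    ∃ k, C.jet v l ∈ ℳ.gr U k := by
  rcases l with c | ⟨b, c⟩
  · exact ⟨_, h c⟩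
  · exact ⟨_, act_mem (C.field_isHomogeneous b) (h c)⟩

end SuperChart

end Systems

/-! ### Uniqueness for supermorphisms -/

section HomUnique

variable {P : Type w} [Ring P] [Algebra ℝ P] {𝒢 : ZMod 2 → Submodule ℝ P} [GradedAlgebra 𝒢]
  [IsSmall 𝒢] {n m r s : ℕ}
variable {F : Type} [NormedRing F] [NormedAlgebra ℝ F] [FiniteDimensional ℝ F]
variable {F' : Type} [NormedRing F'] [NormedAlgebra ℝ F'] [FiniteDimensional ℝ F']
variable {M : Type u} [TopologicalSpace M] {N : Type v} [TopologicalSpace N]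
variable {ℳ : SuperSpace.{u, w, x} 𝒢 M} {𝒩 : SuperSpace.{v, w, y} 𝒢 N}
variable {𝔐 : FibreModel 𝒢 n F} {𝔑 : FibreModel 𝒢 s F'}

/-- Two supermorphisms coincide on an open set. -/
def AgreeOn (Ξ Ψ : Hom ℳ 𝒩) (U : Opens M) : Prop :=
  (∀ q ∈ U, Ξ.body q = Ψ.body q) ∧ ∀ (V : Opens N) (W : Opens M), W ≤ U →
    ∀ (h : MapsInto Ξ.body W V) (h' : MapsInto Ψ.body W V) (f : 𝒩.Γ V),
      Ξ.pull V W h f = Ψ.pull V W h' f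

theorem hom_eq_of_agreeOn {Ξ Ψ : Hom ℳ 𝒩} (h : ∀ q, ∃ U : Opens M, q ∈ U ∧ AgreeOn Ξ Ψ U) :
    Ξ = Ψ := by
  have hb : Ξ.body = Ψ.body := ContinuousMap.ext fun q => by
    obtain ⟨U, hq, hU⟩ := h q
    exact hU.1 q hq
  have hp : ∀ V W (h1 : MapsInto Ξ.body W V) (h2 : MapsInto Ψ.body W V) (f : 𝒩.Γ V),
      Ξ.pull V W h1 f = Ψ.pull V W h2 f := by
    intro V W h1 h2 f
    refine ℳ.ext_local fun q hq => ?_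
    obtain ⟨U, hqU, hU⟩ := h q
    have hm : W ⊓ U ≤ W := inf_le_left
    refine ⟨W ⊓ U, hm, ⟨hq, hqU⟩, ?_⟩
    rw [Ξ.res_pull h1 (h1.mono hm) le_rfl, Ψ.res_pull h2 (h2.mono hm) le_rfl]
    exact hU.2 _ _ inf_le_right _ _ _
  cases Ξ with
  | mk body pull _ _ _ =>
    cases Ψ with
    | mk body' pull' _ _ _ =>
      simp only at hb hp
      subst hb
      have : pull = pull' := by
        funext V W h
        exact AlgHom.ext fun f => hp V W h h f
      subst this
      rfl

variable {U : Opens M} {V : Opens N}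

namespace SuperChart

variable (C : SuperChart ℳ 𝔐 m U) (E : SuperChart 𝒩 𝔑 r V)

/-- The differences of the coordinates of two supermorphisms. -/
def homDiff (Ξ Ψ : Hom ℳ 𝒩) (hΞ : MapsInto Ξ.body U V) (hΨ : MapsInto Ψ.body U V)
    (c : Fin r ⊕ Fin s) : ℳ.Γ U := Ξ.pull V U hΞ (E.crd c) - Ψ.pull V U hΨ (E.crd c)

theorem homDiff_mem (Ξ Ψ : Hom ℳ 𝒩) (hΞ : MapsInto Ξ.body U V) (hΨ : MapsInto Ψ.body U V)
    (c : Fin r ⊕ Fin s) : E.homDiff Ξ Ψ hΞ hΨ c ∈ ℳ.gr U (par c) :=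
  sub_mem (Ξ.pull_mem V U hΞ _ _ (E.crd_mem c)) (Ψ.pull_mem V U hΨ _ _ (E.crd_mem c))

/-- Supermorphisms whose coordinates are close are close on all sections. -/
theorem pull_close {L : Type} [Fintype L] {v : L → ℳ.Γ U} {Ξ Ψ : Hom ℳ 𝒩}
    (hΞ : MapsInto Ξ.body U V) (hΨ : MapsInto Ψ.body U V)
    (h : ∀ c, C.SecControlled v (E.homDiff Ξ Ψ hΞ hΨ c)) (f : 𝒩.Γ V) :
    Close 𝔐.ε (C.repFam v) (fun z => (C.rep (Ξ.pull V U hΞ f)).1 z)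
      (fun z => (C.rep (Ψ.pull V U hΨ f)).1 z) := by
  have hc : ∀ c, Controlled 𝔐.ε (C.repFam v) fun z =>
      C.localHomAt E Ξ hΞ z (𝔑.cfn c) - C.localHomAt E Ψ hΨ z (𝔑.cfn c) := fun c => by
    have := h c
    rw [SecControlled, homDiff] at this
    simp only [map_sub] at this
    exact this
  have := close_of_coord 𝔑 𝔐.ker_ε_pow (C.localHomAt E Ξ hΞ) (C.localHomAt E Ψ hΨ) 𝔐.ι
    (C.ε_localHomAt E Ξ hΞ) (C.ε_localHomAt E Ψ hΨ)
    (fun f => (smoothAlg.contDiff (C.localHom E Ξ hΞ f)).continuous)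
    (fun f => (smoothAlg.contDiff (C.localHom E Ψ hΨ f)).continuous)
    (C.localHomAt_const_ι E Ξ hΞ) (C.localHomAt_const_ι E Ψ hΨ)
    (fun j => hc (Sum.inr j)) (fun i => hc (Sum.inl i)) (E.rep f)
  simpa only [localHomAt_rep] using this

/-- All pullback differences are controlled by the coordinate differences, hence vanish with them.
The bodies agree because their coordinates are the bodies of the pulled-back coordinates, and
sections over other open sets are extended locally to the chart. -/
theorem agreeOn_of_homDiff_eq_zero (C : SuperChart ℳ 𝔐 m U) (E : SuperChart 𝒩 𝔑 r V)
    {Ξ Ψ : Hom ℳ 𝒩} (hΞ : MapsInto Ξ.body U V)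
    (hΨ : MapsInto Ψ.body U V) (h : ∀ c, E.homDiff Ξ Ψ hΞ hΨ c = 0) : AgreeOn Ξ Ψ U := by
  have hpull : ∀ f, Ξ.pull V U hΞ f = Ψ.pull V U hΨ f := by
    intro f
    apply C.rep_bijective.1
    refine Subtype.ext (funext fun z => ?_)
    have := C.pull_close (v := E.homDiff Ξ Ψ hΞ hΨ) E hΞ hΨ (fun c => controlled_coord c) f
    refine sub_eq_zero.1 (this.diff.eq_zero (funext fun c => ?_))
    rw [repFam, h, map_zero]
    rfl
  have hb : ∀ q ∈ U, Ξ.body q = Ψ.body q := by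
    intro q hq
    have h1 : E.coord (Ξ.body q) = E.coord (Ψ.body q) := by
      ext i
      have h2 := C.ε_localHomAt E Ξ hΞ (C.coord q) (coordFn i)
      have h3 := C.ε_localHomAt E Ψ hΨ (C.coord q) (coordFn i)
      rw [localHomAt_apply, C.inv_coord q hq] at h2 h3
      rw [hpull] at h2
      exact h2.symm.trans h3
    rw [← E.inv_coord _ (hΞ q hq), h1, E.inv_coord _ (hΨ q hq)]
  refine ⟨hb, fun V' W hW h1 h2 f => ?_⟩
  refine ℳ.ext_local fun q hq => ?_
  obtain ⟨g, V₁, hV₁, hV₁', hq₁, hg⟩ := E.exists_extension f (h1 q hq) (hΞ q (hW hq))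
  let W₁ : Opens M := W ⊓ Opens.comap Ξ.body V₁
  have hW₁ : W₁ ≤ W := inf_le_left
  have hm : MapsInto Ξ.body W₁ V₁ := fun x hx => hx.2
  have hm' : MapsInto Ψ.body W₁ V₁ := fun x hx => by
    rw [← hb x (hW hx.1)]
    exact hx.2
  refine ⟨W₁, hW₁, ⟨hq, hq₁⟩, ?_⟩
  rw [Ξ.res_pull h1 hm hV₁ hW₁, Ψ.res_pull h2 hm' hV₁ hW₁, hg,
    ← Ξ.res_pull hΞ hm hV₁' (hW₁.trans hW), ← Ψ.res_pull hΨ hm' hV₁' (hW₁.trans hW), hpull]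

end SuperChart

theorem pull_eq_of_linearization {p : PPoint ℳ} {Ξ Ψ : Hom ℳ 𝒩}
    (h : linearization p Ξ = linearization p Ψ) (hp : p.pt ∈ U) (hΞ : MapsInto Ξ.body U V)
    (hΨ : MapsInto Ψ.body U V) (f : 𝒩.Γ V) :
    p.pull U ⊤ (p.mapsInto hp) (Ξ.pull V U hΞ f) =
      p.pull U ⊤ (p.mapsInto hp) (Ψ.pull V U hΨ f) := by
  have h1 : Ξ.comp p = Ψ.comp p := congrArg Sigma.fst h
  -- Stating the comparison for arbitrary equal points lets the equality be eliminated, although the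
  -- domains of the pullbacks depend on it.
  have h2 : ∀ (q q' : PPoint 𝒩), q = q' → ∀ (hq : MapsInto q.body ⊤ V)
      (hq' : MapsInto q'.body ⊤ V), q.pull V ⊤ hq f = q'.pull V ⊤ hq' f := by
    rintro q _ rfl hq hq'
    rfl
  have h3 : ∀ (Φ : Hom ℳ 𝒩) (hΦ : MapsInto Φ.body U V) (hq : MapsInto (Φ.comp p).body ⊤ V),
      (Φ.comp p).pull V ⊤ hq f = p.pull U ⊤ (p.mapsInto hp) (Φ.pull V U hΦ f) := by
    intro Φ hΦ hq
    change p.pull (Opens.comap Φ.body V) ⊤ _ (Φ.pull V _ _ f) = _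
    rw [← p.pull_res (hq.of_comp) (p.mapsInto hp) hΦ.le_comap,
      Φ.res_pull _ hΦ le_rfl, 𝒩.res_self]
  rw [← h3 Ξ hΞ (fun _ _ => hΞ _ hp), ← h3 Ψ hΨ (fun _ _ => hΨ _ hp)]
  exact h2 _ _ h1 _ _

theorem pull_act_eq_of_linearization {p : PPoint ℳ} {Ξ Ψ : Hom ℳ 𝒩}
    (h : linearization p Ξ = linearization p Ψ) (hp : p.pt ∈ U) (hΞ : MapsInto Ξ.body U V)
    (hΨ : MapsInto Ψ.body U V) {X : VF ℳ U} {k : ZMod 2} (hX : X.IsHomogeneous k) (f : 𝒩.Γ V) :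
    p.pull U ⊤ (p.mapsInto hp) (act X (Ξ.pull V U hΞ f))
      = p.pull U ⊤ (p.mapsInto hp) (act X (Ψ.pull V U hΨ f)) := by
  let v : TangentSpaceAt p := valueAt X p hp
  have h2 : ∀ (τ τ' : Σ q : PPoint 𝒩, (TangentSpaceAt p → TangentSpaceAt q)), τ = τ' →
      ∀ (hq : MapsInto τ.1.body ⊤ V) (hq' : MapsInto τ'.1.body ⊤ V),
        (τ.2 v).comp k V ⊤ le_rfl hq f = (τ'.2 v).comp k V ⊤ le_rfl hq' f := by
    rintro τ _ rfl hq hq'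
    rfl
  have h3 : ∀ (Φ : Hom ℳ 𝒩) (hΦ : MapsInto Φ.body U V) (hq : MapsInto (Φ.comp p).body ⊤ V),
      (differentialAt Φ p v).comp k V ⊤ le_rfl hq f
        = p.pull U ⊤ (p.mapsInto hp) (act X (Φ.pull V U hΦ f)) := by
    intro Φ hΦ hq
    change p.pull (U ⊓ Opens.comap Φ.body V) ⊤ _ (X.comp k (Opens.comap Φ.body V)
      (U ⊓ Opens.comap Φ.body V) inf_le_left _ (Φ.pull V _ _ f)) = _
    rw [act, hX.val_eq, ← p.pull_res (p.mapsInto hp)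
      (p.mapsInto (show p.pt ∈ U ⊓ Opens.comap Φ.body V from ⟨hp, hΦ _ hp⟩)) inf_le_left]
    congr 1
    rw [X.res_comp k le_rfl inf_le_left _ (mapsInto_id ℳ le_rfl) inf_le_left inf_le_left,
      Φ.res_pull _ (hΦ.mono inf_le_left) le_rfl, 𝒩.res_self,
      ← X.comp_res k inf_le_left _ (mapsInto_id ℳ le_rfl) inf_le_right,
      Φ.res_pull _ (hΦ.mono inf_le_left) le_rfl, 𝒩.res_self]
  rw [← h3 Ξ hΞ (fun _ _ => hΞ _ hp), ← h3 Ψ hΨ (fun _ _ => hΨ _ hp)]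
  exact h2 _ _ h _ _

/-- Two supermorphisms with the same linearization at a `P`-point are equal if the second
derivatives of their difference are controlled by the difference and its first derivatives. -/
theorem hom_eq_of_linearization [T2Space N] [ConnectedSpace M]
    (hM : ∀ (q : M) (U₀ : Opens M), q ∈ U₀ → ∃ U : Opens M, q ∈ U ∧ U ≤ U₀ ∧
      Nonempty (SuperChart ℳ 𝔐 m U))
    (hN : ∀ (q : N) (U₀ : Opens N), q ∈ U₀ → ∃ U : Opens N, q ∈ U ∧ U ≤ U₀ ∧
      Nonempty (SuperChart 𝒩 𝔑 r U))
    {p : PPoint ℳ} {Ξ Ψ : Hom ℳ 𝒩} (h : linearization p Ξ = linearization p Ψ)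
    (hc : ∀ (U : Opens M) (V : Opens N) (C : SuperChart ℳ 𝔐 m U) (E : SuperChart 𝒩 𝔑 r V)
      (hΞ : MapsInto Ξ.body U V) (hΨ : MapsInto Ψ.body U V) (a b : Fin m ⊕ Fin n)
      (c : Fin r ⊕ Fin s), C.SecControlled (C.jet (E.homDiff Ξ Ψ hΞ hΨ))
        (act (C.field a) (act (C.field b) (E.homDiff Ξ Ψ hΞ hΨ c)))) : Ξ = Ψ := by
  have hchart : ∀ q, Ξ.body q = Ψ.body q → ∃ (U : Opens M) (V : Opens N), q ∈ U ∧
      MapsInto Ξ.body U V ∧ MapsInto Ψ.body U V ∧ Nonempty (SuperChart ℳ 𝔐 m U) ∧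
      Nonempty (SuperChart 𝒩 𝔑 r V) := by
    intro q hq
    obtain ⟨V, hqV, -, hV⟩ := hN (Ξ.body q) ⊤ trivial
    obtain ⟨U, hqU, hU, hU'⟩ := hM q (Opens.comap Ξ.body V ⊓ Opens.comap Ψ.body V)
      ⟨hqV, by rw [hq] at hqV; exact hqV⟩
    exact ⟨U, V, hqU, fun x hx => (hU hx).1, fun x hx => (hU hx).2, hU', hV⟩
  let S : Set M := {q | ∃ U : Opens M, q ∈ U ∧ AgreeOn Ξ Ψ U}
  have hopen : IsOpen S := isOpen_iff_mem_nhds.2 fun q ⟨U, hq, hU⟩ =>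
    Filter.mem_of_superset (U.2.mem_nhds hq) fun q' hq' => ⟨U, hq', hU⟩
  have hclosed : IsClosed S := by
    -- At a limit point the bodies agree since `N` is Hausdorff, so both morphisms have common
    -- charts there. Such a chart meets the set of agreement, and at a common point the full jet of
    -- the difference vanishes.
    refine isClosed_of_closure_subset fun q hq => ?_
    have hb : Ξ.body q = Ψ.body q := by
      have h1 : IsClosed {q | Ξ.body q = Ψ.body q} :=
        isClosed_eq Ξ.body.continuous Ψ.body.continuous
      refine closure_minimal ?_ h1 hq
      rintro q' ⟨U, hq', hU⟩
      exact hU.1 q' hq'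
    obtain ⟨U, V, hqU, hΞ, hΨ, ⟨C⟩, ⟨E⟩⟩ := hchart q hb
    obtain ⟨q', hq'U, U', hq', hU'⟩ := mem_closure_iff.1 hq U U.2 hqU
    have hW : U ⊓ U' ≤ U := inf_le_left
    have hres : ∀ c, ℳ.res hW (E.homDiff Ξ Ψ hΞ hΨ c) = 0 := fun c => by
      rw [SuperChart.homDiff, map_sub, Ξ.res_pull hΞ (hΞ.mono hW) le_rfl,
        Ψ.res_pull hΨ (hΨ.mono hW) le_rfl, hU'.2 V _ inf_le_right (hΞ.mono hW) (hΨ.mono hW),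
        sub_self]
    have hz := C.system_eq_zero (C.jet_system (hc U V C E hΞ hΨ)) hq'U (fun l => by
      rw [← C.evAt_res le_rfl hW (⟨hq'U, hq'⟩ : q' ∈ U ⊓ U')]
      have : ℳ.res hW (C.jet (E.homDiff Ξ Ψ hΞ hΨ) l) = 0 := by
        rcases l with c | ⟨b, c⟩
        · exact hres c
        · change ℳ.res hW (act (C.field b) _) = 0
          rw [← act_restrict, hres, map_zero]
      rw [this, map_zero])
    exact ⟨U, hqU, C.agreeOn_of_homDiff_eq_zero E hΞ hΨ fun c => hz (Sum.inl c)⟩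
  have hne : S.Nonempty := by
    have hb : Ξ.body p.pt = Ψ.body p.pt := by
      have h1 : Ξ.comp p = Ψ.comp p := congrArg Sigma.fst h
      exact DFunLike.congr_fun (congrArg Hom.body h1) PUnit.unit
    obtain ⟨U, V, hqU, hΞ, hΨ, ⟨C⟩, ⟨E⟩⟩ := hchart p.pt hb
    -- Equal linearizations at `p` say exactly what is needed here: the coordinate differences and
    -- their first derivatives pull back to zero at the `P`-point.
    have hz := C.system_eq_zero_of_point (C.jet_system (hc U V C E hΞ hΨ))
      (C.jet_mem (E.homDiff_mem Ξ Ψ hΞ hΨ)) p hqU (fun l => by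
        rcases l with c | ⟨b, c⟩
        · change p.pull U ⊤ _ (_ - _) = 0
          rw [map_sub, pull_eq_of_linearization h hqU hΞ hΨ, sub_self]
        · change p.pull U ⊤ _ (act (C.field b) (_ - _)) = 0
          rw [map_sub, map_sub, pull_act_eq_of_linearization h hqU hΞ hΨ
            (C.field_isHomogeneous b), sub_self])
    exact ⟨p.pt, U, hqU, C.agreeOn_of_homDiff_eq_zero E hΞ hΨ fun c => hz (Sum.inl c)⟩
  have huniv : S = Set.univ := IsClopen.eq_univ ⟨hclosed, hopen⟩ hne
  exact hom_eq_of_agreeOn fun q => (huniv ▸ Set.mem_univ q : q ∈ S)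

/-- A super vector field vanishes if its components and their first derivatives vanish at a
`P`-point and control their second derivatives. -/
theorem vf_eq_zero_of_point [ConnectedSpace M]
    (hM : ∀ (q : M) (U₀ : Opens M), q ∈ U₀ → ∃ U : Opens M, q ∈ U ∧ U ≤ U₀ ∧
      Nonempty (SuperChart ℳ 𝔐 m U))
    {p : PPoint ℳ} {Z : VF ℳ ⊤} {k : ZMod 2} (hk : Z.IsHomogeneous k)
    (hp : ∀ (U : Opens M) (C : SuperChart ℳ 𝔐 m U) (hU : p.pt ∈ U) (c : Fin m ⊕ Fin n),
      p.pull U ⊤ (p.mapsInto hU) (act (Z.restrict le_top) (C.crd c)) = 0 ∧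
      ∀ b, p.pull U ⊤ (p.mapsInto hU)
        (act (C.field b) (act (Z.restrict le_top) (C.crd c))) = 0)
    (hc : ∀ (U : Opens M) (C : SuperChart ℳ 𝔐 m U) (a b c : Fin m ⊕ Fin n),
      C.SecControlled (C.jet fun c => act (Z.restrict le_top) (C.crd c))
        (act (C.field a) (act (C.field b) (act (Z.restrict le_top) (C.crd c))))) : Z = 0 := by
  let S : Set M := {q | ∃ U : Opens M, q ∈ U ∧ Z.restrict (le_top : U ≤ ⊤) = 0}
  have hopen : IsOpen S := isOpen_iff_mem_nhds.2 fun q ⟨U, hq, hU⟩ =>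
    Filter.mem_of_superset (U.2.mem_nhds hq) fun q' hq' => ⟨U, hq', hU⟩
  have hzero : ∀ (U : Opens M) (C : SuperChart ℳ 𝔐 m U),
      (∀ c, act (Z.restrict (le_top : U ≤ ⊤)) (C.crd c) = 0) →
        Z.restrict (le_top : U ≤ ⊤) = 0 := fun U C h => by
    refine C.vf_ext fun c => ?_
    rw [h]
    exact (map_zero (SDer.valAt (mapsInto_id ℳ le_rfl) (C.crd c))).symm
  have hclosed : IsClosed S := by
    refine isClosed_of_closure_subset fun q hq => ?_
    obtain ⟨U, hqU, -, ⟨C⟩⟩ := hM q ⊤ trivial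
    obtain ⟨q', hq'U, U', hq', hU'⟩ := mem_closure_iff.1 hq U U.2 hqU
    have hW : U ⊓ U' ≤ U := inf_le_left
    have hres : ∀ c, ℳ.res hW (act (Z.restrict (le_top : U ≤ ⊤)) (C.crd c)) = 0 := fun c => by
      rw [← act_restrict]
      have h1 : (Z.restrict (le_top : U ≤ ⊤)).restrict hW
          = (Z.restrict (le_top : U' ≤ ⊤)).restrict (inf_le_right : U ⊓ U' ≤ U') := rfl
      rw [h1, hU']
      exact map_zero (SDer.valAt (mapsInto_id ℳ le_rfl) _)
    have hz := C.system_eq_zero (C.jet_system (hc U C)) hq'U (fun l => by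
      rw [← C.evAt_res le_rfl hW (⟨hq'U, hq'⟩ : q' ∈ U ⊓ U')]
      have : ℳ.res hW (C.jet (fun c => act (Z.restrict le_top) (C.crd c)) l) = 0 := by
        rcases l with c | ⟨b, c⟩
        · exact hres c
        · change ℳ.res hW (act (C.field b) _) = 0
          rw [← act_restrict, hres, map_zero]
      rw [this, map_zero])
    exact ⟨U, hqU, hzero U C fun c => hz (Sum.inl c)⟩
  have hne : S.Nonempty := by
    obtain ⟨U, hqU, -, ⟨C⟩⟩ := hM p.pt ⊤ trivial
    have hz := C.system_eq_zero_of_point (C.jet_system (hc U C))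
      (C.jet_mem fun c => act_mem (hk.restrict _) (C.crd_mem c)) p hqU (fun l => by
        rcases l with c | ⟨b, c⟩
        · exact (hp U C hqU c).1
        · exact (hp U C hqU c).2 b)
    exact ⟨p.pt, U, hqU, hzero U C fun c => hz (Sum.inl c)⟩
  have huniv : S = Set.univ := IsClopen.eq_univ ⟨hclosed, hopen⟩ hne
  refine SDer.ext' fun k V W hU hV => ?_
  ext f
  rw [SDer.zero_comp, AddMonoidHom.zero_apply]
  refine ℳ.ext_local fun q hq => ?_
  obtain ⟨U, hqU, hU'⟩ : q ∈ S := huniv ▸ Set.mem_univ q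
  refine ⟨W ⊓ U, inf_le_left, ⟨hq, hqU⟩, ?_⟩
  rw [map_zero, Z.res_comp k hU le_top hV (hV.mono inf_le_left) le_rfl inf_le_left]
  have h1 : ∀ f, (Z.restrict (le_top : U ≤ ⊤)).comp k V (W ⊓ U) inf_le_right
      (hV.mono inf_le_left) f = 0 := fun f => by
    rw [hU', SDer.zero_comp, AddMonoidHom.zero_apply]
  exact h1 _

end HomUnique

/-! ### Calculus of controlled sections -/

section SecCalculus

variable {P : Type w} [Ring P] [Algebra ℝ P] {𝒢 : ZMod 2 → Submodule ℝ P} [GradedAlgebra 𝒢]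
  [IsSmall 𝒢] {n m : ℕ}
variable {F : Type} [NormedRing F] [NormedAlgebra ℝ F] [FiniteDimensional ℝ F]
variable {M : Type u} [TopologicalSpace M]
variable {ℳ : SuperSpace.{u, w, x} 𝒢 M} {𝔐 : FibreModel 𝒢 n F} {U : Opens M}

namespace SuperChart

variable {C : SuperChart ℳ 𝔐 m U} {L : Type} [Fintype L] {v : L → ℳ.Γ U} {f g f' g' : ℳ.Γ U}

theorem continuous_rep (C : SuperChart ℳ 𝔐 m U) (f : ℳ.Γ U) : Continuous fun z => (C.rep f).1 z :=
  (smoothAlg.contDiff (C.rep f)).continuous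

theorem secControlled_apply (l : L) : C.SecControlled v (v l) := controlled_coord l

theorem SecControlled.add (hf : C.SecControlled v f) (hg : C.SecControlled v g) :
    C.SecControlled v (f + g) := by
  rw [SecControlled, map_add]
  exact Controlled.add hf hg

theorem SecControlled.sub (hf : C.SecControlled v f) (hg : C.SecControlled v g) :
    C.SecControlled v (f - g) := by
  rw [SecControlled, map_sub]
  exact Controlled.sub hf hg

theorem SecControlled.neg (hf : C.SecControlled v f) : C.SecControlled v (-f) := by
  rw [SecControlled, map_neg]
  exact Controlled.neg hf

theorem SecControlled.zsmul (c : ℤ) (hf : C.SecControlled v f) : C.SecControlled v (c • f) := by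
  rw [SecControlled, map_zsmul]
  exact Controlled.zsmul c hf

theorem SecControlled.mul_left (a : ℳ.Γ U) (hf : C.SecControlled v f) :
    C.SecControlled v (a * f) := by
  rw [SecControlled, map_mul]
  exact Controlled.mul_left (C.continuous_rep a) hf

theorem SecControlled.mul_right (a : ℳ.Γ U) (hf : C.SecControlled v f) :
    C.SecControlled v (f * a) := by
  rw [SecControlled, map_mul]
  exact Controlled.mul_right (C.continuous_rep a) hf

theorem SecControlled.sum {ι : Type*} {s : Finset ι} {f : ι → ℳ.Γ U}
    (h : ∀ i ∈ s, C.SecControlled v (f i)) : C.SecControlled v (∑ i ∈ s, f i) := by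
  rw [SecControlled, map_sum]
  have := Controlled.sum h
  convert this using 2 with z
  rw [AddSubmonoidClass.coe_finsetSum, Finset.sum_apply]

theorem SecControlled.of_sgn {i j : ZMod 2} (h : C.SecControlled v (sgn i j • f)) :
    C.SecControlled v f := by
  have := h.zsmul (sgn i j)
  rwa [smul_smul, sgn_mul_self, one_smul] at this

variable (C v) in
/-- Sections with controlled difference. -/
def SecClose (f g : ℳ.Γ U) : Prop := C.SecControlled v (f - g)

theorem SecClose.refl (f : ℳ.Γ U) : C.SecClose v f f := by
  rw [SecClose, sub_self, SecControlled, map_zero]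
  exact controlled_zero

theorem SecClose.sub (h : C.SecClose v f g) (h' : C.SecClose v f' g') :
    C.SecClose v (f - f') (g - g') :=
  SecControlled.of_eq (SecControlled.sub h h') (by abel)

theorem SecClose.mul (h : C.SecClose v f g) (h' : C.SecClose v f' g') :
    C.SecClose v (f * f') (g * g') :=
  SecControlled.of_eq (SecControlled.add (SecControlled.mul_left f h') (SecControlled.mul_right g' h))
    (by rw [mul_sub, sub_mul]; abel)

theorem SecClose.zsmul (c : ℤ) (h : C.SecClose v f g) : C.SecClose v (c • f) (c • g) :=
  SecControlled.of_eq (SecControlled.zsmul c h) (smul_sub c f g)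

theorem SecClose.sum {ι : Type*} {s : Finset ι} {f g : ι → ℳ.Γ U}
    (h : ∀ i ∈ s, C.SecClose v (f i) (g i)) : C.SecClose v (∑ i ∈ s, f i) (∑ i ∈ s, g i) :=
  SecControlled.of_eq (SecControlled.sum h) (Finset.sum_sub_distrib _ _)

end SuperChart

end SecCalculus

/-! ### Additivity of the action of vector fields -/

section ActLinear

variable {P : Type w} [Ring P] [Algebra ℝ P] {𝒢 : ZMod 2 → Submodule ℝ P}
variable {M : Type u} [TopologicalSpace M] {ℳ : SuperSpace.{u, w, x} 𝒢 M} {U : Opens M}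

theorem add_act (X Y : VF ℳ U) (f : ℳ.Γ U) : act (X + Y) f = act X f + act Y f :=
  SDer.val_add _ _ _ _

theorem zsmul_act (c : ℤ) (X : VF ℳ U) (f : ℳ.Γ U) : act (c • X) f = c • act X f :=
  SDer.val_zsmul _ _ _ _

theorem sum_act {I : Type*} (s : Finset I) (X : I → VF ℳ U) (f : ℳ.Γ U) :
    act (∑ i ∈ s, X i) f = ∑ i ∈ s, act (X i) f :=
  SDer.val_sum _ _ _ _

theorem smul_act (a : ℳ.Γ U) (X : VF ℳ U) (f : ℳ.Γ U) : act (a • X) f = a * act X f :=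
  SDer.val_smul _ _ _ _

end ActLinear

/-! ### Connections -/

section Nabla

variable {P : Type w} [Ring P] [Algebra ℝ P] {𝒢 : ZMod 2 → Submodule ℝ P}
variable {M : Type u} [TopologicalSpace M] {N : Type v} [TopologicalSpace N]
variable {ℳ : SuperSpace.{u, w, x} 𝒢 M} {𝒩 : SuperSpace.{v, w, y} 𝒢 N}
variable {Φ : Hom ℳ 𝒩}

namespace Connection

variable (nab : Connection Φ) {U : Opens M}

/-- The covariant derivative in a fixed direction as an additive map. -/
def hom (X : VF ℳ U) : SDer Φ U →+ SDer Φ U :=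
  AddMonoidHom.mk' (nab.nabla U X) (nab.add_right U X)

/-- The covariant derivative of a fixed section as an additive map. -/
def homLeft (S : SDer Φ U) : VF ℳ U →+ SDer Φ U :=
  AddMonoidHom.mk' (fun X => nab.nabla U X S) fun X Y => nab.add_left U X Y S

theorem nabla_sum {I : Type*} (s : Finset I) (X : VF ℳ U) (S : I → SDer Φ U) :
    nab.nabla U X (∑ i ∈ s, S i) = ∑ i ∈ s, nab.nabla U X (S i) :=
  map_sum (nab.hom X) S s

theorem nabla_sum_left {I : Type*} (s : Finset I) (X : I → VF ℳ U) (S : SDer Φ U) :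
    nab.nabla U (∑ i ∈ s, X i) S = ∑ i ∈ s, nab.nabla U (X i) S :=
  map_sum (nab.homLeft S) X s

theorem nabla_sub (X : VF ℳ U) (S T : SDer Φ U) :
    nab.nabla U X (S - T) = nab.nabla U X S - nab.nabla U X T :=
  map_sub (nab.hom X) S T

theorem nabla_sub_left (X Y : VF ℳ U) (S : SDer Φ U) :
    nab.nabla U (X - Y) S = nab.nabla U X S - nab.nabla U Y S :=
  map_sub (nab.homLeft S) X Y

theorem nabla_zsmul (c : ℤ) (X : VF ℳ U) (S : SDer Φ U) :
    nab.nabla U X (c • S) = c • nab.nabla U X S :=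
  map_zsmul (nab.hom X) c S

theorem nabla_zsmul_left (c : ℤ) (X : VF ℳ U) (S : SDer Φ U) :
    nab.nabla U (c • X) S = c • nab.nabla U X S :=
  map_zsmul (nab.homLeft S) c X

end Connection

end Nabla

/-! ### Affine supermorphisms -/

section Affine

variable {P : Type w} [Ring P] [Algebra ℝ P] {𝒢 : ZMod 2 → Submodule ℝ P} [GradedAlgebra 𝒢]
  [IsSmall 𝒢] {n m r s : ℕ}
variable {F : Type} [NormedRing F] [NormedAlgebra ℝ F] [FiniteDimensional ℝ F]
variable {F' : Type} [NormedRing F'] [NormedAlgebra ℝ F'] [FiniteDimensional ℝ F']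
variable {M : Type u} [TopologicalSpace M] {N : Type v} [TopologicalSpace N]
variable {ℳ : SuperSpace.{u, w, x} 𝒢 M} {𝒩 : SuperSpace.{v, w, y} 𝒢 N}
variable {𝔐 : FibreModel 𝒢 n F} {𝔑 : FibreModel 𝒢 s F'} {U : Opens M} {V : Opens N}

namespace SuperChart

variable (C : SuperChart ℳ 𝔐 m U) (E : SuperChart 𝒩 𝔑 r V)

/-- The pullback connection in the direction of a vector field, on the pullback of a vector
field, in terms of coordinates. -/
theorem pullbackConnection_apply (C : SuperChart ℳ 𝔐 m U) (E : SuperChart 𝒩 𝔑 r V) {Ξ : Hom ℳ 𝒩}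
    (hV : MapsInto Ξ.body U V)
    {nabN : AffineConnection 𝒩} {nab' : Connection Ξ} (h : IsPullbackConnection nabN nab')
    (X : VF ℳ U) (S : VF 𝒩 V) : nab'.nabla U X (pullVF Ξ S U hV)
      = ∑ b, act X (Ξ.pull V U hV (E.crd b)) • pullVF Ξ (nabN.nabla V (E.field b) S) U hV := by
  -- The definition of the pullback connection uses expansions indexed by `Fin`, so the even and odd
  -- indices are merged.
  let e : Fin (r + s) ≃ Fin r ⊕ Fin s := finSumFinEquiv.symm
  have h1 := C.differential_expand E hV X
  rw [← Equiv.sum_comp e] at h1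
  rw [h V U hV X S (r + s) _ _ h1]
  exact Equiv.sum_comp e fun b =>
    act X (Ξ.pull V U hV (E.crd b)) • pullVF Ξ (nabN.nabla V (E.field b) S) U hV

/-- The second derivatives of the coordinates of an affine supermorphism. -/
theorem affine_second {Ξ : Hom ℳ 𝒩} (hV : MapsInto Ξ.body U V) {nabM : AffineConnection ℳ}
    {nabN : AffineConnection 𝒩} (h : IsAffine nabM nabN Ξ) (i j : Fin m ⊕ Fin n)
    (c : Fin r ⊕ Fin s) :
    act (C.field i) (act (C.field j) (Ξ.pull V U hV (E.crd c)))
      = ∑ k, act (nabM.nabla U (C.field i) (C.field j)) (C.crd k)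
          * act (C.field k) (Ξ.pull V U hV (E.crd c))
        - ∑ a, sgn (par i) (par j + par a) • (act (C.field j) (Ξ.pull V U hV (E.crd a))
          * ∑ b, act (C.field i) (Ξ.pull V U hV (E.crd b))
            * Ξ.pull V U hV (act (nabN.nabla V (E.field b) (E.field a)) (E.crd c))) := by
  obtain ⟨nab', h1, h2⟩ := h
  have h3 := congrArg (fun D => D.val hV (E.crd c)) (h2 U (C.field i) (C.field j))
  rw [val_differential, C.act_expand, C.differential_expand E hV (C.field j), nab'.nabla_sum,
    SDer.val_sum] at h3
  -- The Leibniz rule for one summand of the expanded differential: the derivative of its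
  -- coefficient contributes to coordinate `c` only for `a = c`, and the rest is a Christoffel term.
  have h4 : ∀ a, (nab'.nabla U (C.field i) (act (C.field j) (Ξ.pull V U hV (E.crd a))
      • pullVF Ξ (E.field a) U hV)).val hV (E.crd c)
      = (if a = c then act (C.field i) (act (C.field j) (Ξ.pull V U hV (E.crd a))) else 0)
        + sgn (par i) (par j + par a) • (act (C.field j) (Ξ.pull V U hV (E.crd a))
          * ∑ b, act (C.field i) (Ξ.pull V U hV (E.crd b))
            * Ξ.pull V U hV (act (nabN.nabla V (E.field b) (E.field a)) (E.crd c))) := by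
    intro a
    rw [nab'.leibniz U (par i) (par j + par a) (C.field i) _ _ (C.field_isHomogeneous i)
      (act_mem (C.field_isHomogeneous j) (Ξ.pull_mem V U hV _ _ (E.crd_mem a))), SDer.val_add,
      SDer.val_zsmul, SDer.val_smul, SDer.val_smul, C.pullbackConnection_apply E hV h1,
      SDer.val_sum, ← act_def, val_pullVF, act_field_crd]
    simp only [SDer.val_smul, val_pullVF]
    split_ifs
    · rw [map_one, mul_one]
    · rw [map_zero, mul_zero]
  simp only [h4] at h3
  rw [Finset.sum_add_distrib, Finset.sum_ite_eq' Finset.univ c, if_pos (Finset.mem_univ _)] at h3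
  exact eq_sub_of_add_eq h3.symm

theorem pull_secClose {Ξ Ψ : Hom ℳ 𝒩} (hΞ : MapsInto Ξ.body U V) (hΨ : MapsInto Ψ.body U V)
    (f : 𝒩.Γ V) : C.SecClose (C.jet (E.homDiff Ξ Ψ hΞ hΨ)) (Ξ.pull V U hΞ f) (Ψ.pull V U hΨ f) := by
  have := (C.pull_close (v := C.jet (E.homDiff Ξ Ψ hΞ hΨ)) E hΞ hΨ
    (fun c => secControlled_apply (C := C) (v := C.jet (E.homDiff Ξ Ψ hΞ hΨ)) (Sum.inl c)) f).diff
  rw [SecClose, SecControlled, map_sub]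
  exact this

theorem act_pull_secClose {Ξ Ψ : Hom ℳ 𝒩} (hΞ : MapsInto Ξ.body U V) (hΨ : MapsInto Ψ.body U V)
    (b : Fin m ⊕ Fin n) (c : Fin r ⊕ Fin s) : C.SecClose (C.jet (E.homDiff Ξ Ψ hΞ hΨ))
      (act (C.field b) (Ξ.pull V U hΞ (E.crd c))) (act (C.field b) (Ψ.pull V U hΨ (E.crd c))) := by
  refine SecControlled.of_eq (secControlled_apply (C := C) (v := C.jet (E.homDiff Ξ Ψ hΞ hΨ))
    (Sum.inr (b, c))) ?_
  change act (C.field b) (_ - _) = _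
  rw [map_sub]

/-- The right-hand side of `affine_second` is a sum of products of fixed sections, first
derivatives, and pullbacks of Christoffel symbols. Each factor is close for `Ξ` and `Ψ`, so the
second derivatives are. -/
theorem affine_controlled {Ξ Ψ : Hom ℳ 𝒩} (hΞ : MapsInto Ξ.body U V) (hΨ : MapsInto Ψ.body U V)
    {nabM : AffineConnection ℳ} {nabN : AffineConnection 𝒩} (h : IsAffine nabM nabN Ξ)
    (h' : IsAffine nabM nabN Ψ) (i j : Fin m ⊕ Fin n) (c : Fin r ⊕ Fin s) :
    C.SecControlled (C.jet (E.homDiff Ξ Ψ hΞ hΨ))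
      (act (C.field i) (act (C.field j) (E.homDiff Ξ Ψ hΞ hΨ c))) := by
  rw [homDiff, map_sub, map_sub, C.affine_second E hΞ h, C.affine_second E hΨ h']
  have h1 := C.act_pull_secClose E hΞ hΨ
  refine SecClose.sub (SecClose.sum fun k _ => (SecClose.refl _).mul (h1 k c))
    (SecClose.sum fun a _ => ((h1 j a).mul (SecClose.sum fun b _ =>
      (h1 i b).mul (C.pull_secClose E hΞ hΨ _))).zsmul _)

end SuperChart

end Affine

/-! ### Infinitesimally affine vector fields -/

section Infinitesimal

variable {P : Type w} [Ring P] [Algebra ℝ P] {𝒢 : ZMod 2 → Submodule ℝ P} [GradedAlgebra 𝒢]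
  [IsSmall 𝒢] {n m : ℕ}
variable {F : Type} [NormedRing F] [NormedAlgebra ℝ F] [FiniteDimensional ℝ F]
variable {M : Type u} [TopologicalSpace M]
variable {ℳ : SuperSpace.{u, w, x} 𝒢 M} {𝔐 : FibreModel 𝒢 n F} {U : Opens M}

namespace SuperChart

variable (C : SuperChart ℳ 𝔐 m U)

theorem act_field_crd_const (Z : VF ℳ U) {k : ZMod 2} (hZ : Z.IsHomogeneous k)
    (a b : Fin m ⊕ Fin n) : act Z (act (C.field a) (C.crd b)) = 0 := by
  rw [act_field_crd]
  split_ifs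
  · rw [← map_one (ℳ.ι U), act, hZ.val_eq, Z.comp_ι]
  · exact map_zero _

/-- Evaluated on coordinates, the term in which `Z` acts second drops out, since the derivatives of
coordinates are constants. -/
theorem bracket_field {Z : VF ℳ U} {k : ZMod 2} (hZ : Z.IsHomogeneous k) (b : Fin m ⊕ Fin n) :
    bracket Z (C.field b)
      = (-sgn k (par b)) • ∑ d, act (C.field b) (act Z (C.crd d)) • C.field d := by
  refine C.vf_ext fun c => ?_
  rw [act_bracket hZ (C.field_isHomogeneous b), C.act_field_crd_const Z hZ, zero_sub,
    ← neg_smul]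
  rw [zsmul_act, sum_act]
  congr 1
  simp only [smul_act, act_field_crd]
  rw [Finset.sum_eq_single c]
  · rw [if_pos rfl, mul_one]
  · intro a _ ha
    rw [if_neg ha, mul_zero]
  · exact fun h => absurd (Finset.mem_univ _) h

theorem nabla_smul_field_act (nab : AffineConnection ℳ) (a d c : Fin m ⊕ Fin n) {f : ℳ.Γ U}
    {k : ZMod 2} (hf : f ∈ ℳ.gr U k) :
    act (nab.nabla U (C.field a) (f • C.field d)) (C.crd c)
      = (if d = c then act (C.field a) f else 0)
        + sgn (par a) k • (f * act (nab.nabla U (C.field a) (C.field d)) (C.crd c)) := by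
  rw [nab.leibniz U (par a) k (C.field a) f _ (C.field_isHomogeneous a) hf, ← act_def]
  rw [add_act, zsmul_act, smul_act, smul_act, C.act_field_crd]
  split_ifs
  · rw [mul_one]
  · rw [mul_zero]

/-- The second derivatives of the components of an infinitesimally affine vector field. -/
theorem infinitesimal_controlled {nab : AffineConnection ℳ} {Z : VF ℳ U} {k : ZMod 2}
    (hZ : Z.IsHomogeneous k) (h : ∀ (j : ZMod 2) (Y W : VF ℳ U), Y.IsHomogeneous j →
      bracket Z (nab.nabla U Y W)
        = nab.nabla U (bracket Z Y) W + sgn k j • nab.nabla U Y (bracket Z W))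
    (a b c : Fin m ⊕ Fin n) : C.SecControlled (C.jet fun c => act Z (C.crd c))
      (act (C.field a) (act (C.field b) (act Z (C.crd c)))) := by
  have h0 : ∀ d, C.SecControlled (C.jet fun c => act Z (C.crd c)) (act Z (C.crd d)) := fun d =>
    secControlled_apply (C := C) (v := C.jet fun c => act Z (C.crd c)) (Sum.inl d)
  have h1 : ∀ b d, C.SecControlled (C.jet fun c => act Z (C.crd c))
      (act (C.field b) (act Z (C.crd d))) := fun b d =>
    secControlled_apply (C := C) (v := C.jet fun c => act Z (C.crd c)) (Sum.inr (b, d))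
  have hN := nab.even U (par a) (par b) (C.field a) (C.field b) (C.field_isHomogeneous a)
    (C.field_isHomogeneous b)
  have e := congrArg (fun X => act X (C.crd c)) (h (par a) (C.field a) (C.field b)
    (C.field_isHomogeneous a))
  change act _ _ = act _ _ at e
  -- The bracket with `∇_a ∂_b` and the term with `[Z, ∂_a]` involve only the components of `Z` and
  -- their first derivatives; hence the third term of the identity is controlled.
  have eA : C.SecControlled (C.jet fun c => act Z (C.crd c))
      (act (bracket Z (nab.nabla U (C.field a) (C.field b))) (C.crd c)) := by
    rw [act_bracket hZ hN, C.act_expand Z,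
      C.act_expand (nab.nabla U (C.field a) (C.field b)) (act Z (C.crd c))]
    exact (SecControlled.sum fun d _ => (h0 d).mul_right _).sub
      ((SecControlled.sum fun d _ => (h1 d c).mul_left _).zsmul _)
  have eB : C.SecControlled (C.jet fun c => act Z (C.crd c))
      (act (nab.nabla U (bracket Z (C.field a)) (C.field b)) (C.crd c)) := by
    rw [C.bracket_field hZ, nab.nabla_zsmul_left, nab.nabla_sum_left, zsmul_act,
      sum_act]
    refine (SecControlled.sum fun d _ => ?_).zsmul _
    rw [nab.smul_left, smul_act]
    exact (h1 a d).mul_right _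
  have hsplit : act (nab.nabla U (bracket Z (C.field a)) (C.field b)
      + sgn k (par a) • nab.nabla U (C.field a) (bracket Z (C.field b))) (C.crd c)
      = act (nab.nabla U (bracket Z (C.field a)) (C.field b)) (C.crd c)
        + sgn k (par a) • act (nab.nabla U (C.field a) (bracket Z (C.field b))) (C.crd c) := by
    rw [add_act, zsmul_act]
  rw [hsplit] at e
  have eC : C.SecControlled (C.jet fun c => act Z (C.crd c))
      (act (nab.nabla U (C.field a) (bracket Z (C.field b))) (C.crd c)) :=
    ((eA.sub eB).of_eq (by rw [e, add_sub_cancel_left])).of_sgn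
  -- The third term contains the second derivative of the component `c` of `Z`, up to sign, plus
  -- terms with first derivatives only.
  have e3 : act (nab.nabla U (C.field a) (bracket Z (C.field b))) (C.crd c)
      = (-sgn k (par b)) • (act (C.field a) (act (C.field b) (act Z (C.crd c)))
        + ∑ d, sgn (par a) (par b + (k + par d)) • (act (C.field b) (act Z (C.crd d))
          * act (nab.nabla U (C.field a) (C.field d)) (C.crd c))) := by
    rw [C.bracket_field hZ, nab.nabla_zsmul, nab.nabla_sum, zsmul_act, sum_act]
    congr 1
    have h5 : ∀ d, act (nab.nabla U (C.field a) (act (C.field b) (act Z (C.crd d)) • C.field d))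
        (C.crd c) = _ := fun d =>
      C.nabla_smul_field_act nab a d c (act_mem (C.field_isHomogeneous b) (act_mem hZ (C.crd_mem d)))
    simp only [h5]
    rw [Finset.sum_add_distrib, Finset.sum_ite_eq' Finset.univ c, if_pos (Finset.mem_univ _)]
  rw [e3, neg_smul] at eC
  have e6 := eC.neg
  rw [neg_neg] at e6
  have e7 := e6.of_sgn.sub (SecControlled.sum (s := Finset.univ)
    (f := fun d => sgn (par a) (par b + (k + par d)) • (act (C.field b) (act Z (C.crd d))
      * act (nab.nabla U (C.field a) (C.field d)) (C.crd c)))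
    fun d _ => ((h1 b d).mul_right _).zsmul _)
  rwa [add_sub_cancel_right] at e7

end SuperChart

/-- The components of the value at a `P`-point of a vector field. -/
theorem valueAt_comp {U₀ : Opens M} (Y : VF ℳ U₀) (p : PPoint ℳ) (h₀ : p.pt ∈ U₀) (hU : U ≤ U₀)
    (hp : p.pt ∈ U) (k : ZMod 2) (f : ℳ.Γ U) :
    (valueAt Y p h₀).comp k U ⊤ le_rfl (p.mapsInto hp) f
      = p.pull U ⊤ (p.mapsInto hp) (Y.comp k U U hU (mapsInto_id ℳ le_rfl) f) := by
  have h1 := Y.res_comp k hU inf_le_left (mapsInto_id ℳ le_rfl) (mapsInto_id ℳ inf_le_right)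
    le_rfl (inf_le_right : U₀ ⊓ U ≤ U) f
  rw [ℳ.res_self] at h1
  change p.pull (U₀ ⊓ U) ⊤ _ (Y.comp k U (U₀ ⊓ U) inf_le_left (mapsInto_id ℳ inf_le_right) f) = _
  rw [← h1, p.pull_res (p.mapsInto hp)]

/-- The evaluation of a component of a derivation, as an additive map. -/
def compAt {N : Type v} [TopologicalSpace N] {𝒩 : SuperSpace.{v, w, y} 𝒢 N} {Φ : Hom ℳ 𝒩}
    {V : Opens N} (hV : MapsInto Φ.body U V) (k : ZMod 2) (f : 𝒩.Γ V) : SDer Φ U →+ ℳ.Γ U :=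
  AddMonoidHom.mk' (fun D => D.comp k V U le_rfl hV f) fun _ _ => rfl

theorem restrict_sub {U' : Opens M} (X Y : VF ℳ U) (h : U' ≤ U) :
    (X - Y).restrict h = X.restrict h - Y.restrict h := by
  rw [sub_eq_add_neg, sub_eq_add_neg]
  rfl

/-- The defining equation is additive in the field, so the difference of corresponding homogeneous
parts satisfies it too. Once its value at `p` vanishes, its covariant derivatives there reduce to
the partial derivatives of its components. -/
theorem vf_eq_of_infinitesimallyAffine [ConnectedSpace M]
    (hM : ∀ (q : M) (U₀ : Opens M), q ∈ U₀ → ∃ U : Opens M, q ∈ U ∧ U ≤ U₀ ∧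
      Nonempty (SuperChart ℳ 𝔐 m U))
    {nab : AffineConnection ℳ} {p : PPoint ℳ} {X X' : VF ℳ ⊤}
    (hX : IsInfinitesimallyAffine nab X) (hX' : IsInfinitesimallyAffine nab X')
    (h0 : valueAt X p trivial = valueAt X' p trivial)
    (h1 : nablaAt nab X p = nablaAt nab X' p) : X = X' := by
  suffices h : ∀ k, X.part k - X'.part k = 0 by
    rw [← X.sum_part, ← X'.sum_part]
    exact Finset.sum_congr rfl fun k _ => sub_eq_zero.1 (h k)
  have hhom : ∀ k, (X.part k - X'.part k).IsHomogeneous k := fun k =>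
    (X.isHomogeneous_part k).sub (X'.isHomogeneous_part k)
  have hsub : ∀ k (U : Opens M), (X.part k - X'.part k).restrict (le_top : U ≤ ⊤)
      = (X.part k).restrict le_top - (X'.part k).restrict le_top := fun k U => restrict_sub _ _ _
  intro k
  refine vf_eq_zero_of_point (p := p) hM (hhom k) ?_ ?_
  · intro U C hU c
    have e0 : ∀ k d, p.pull U ⊤ (p.mapsInto hU)
        (act ((X.part k - X'.part k).restrict le_top) (C.crd d)) = 0 := by
      intro k d
      rw [act, ((hhom k).restrict _).val_eq]
      have h2 : ∀ Y : VF ℳ ⊤, (Y.part k).comp k U U le_top (mapsInto_id ℳ le_rfl) (C.crd d)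
          = Y.comp k U U le_top (mapsInto_id ℳ le_rfl) (C.crd d) := fun Y => by
        simp [SDer.part]
      have h3 : ((X.part k - X'.part k).restrict (le_top : U ≤ ⊤)).comp k U U le_rfl
          (mapsInto_id ℳ le_rfl) (C.crd d)
          = (X.part k).comp k U U le_top (mapsInto_id ℳ le_rfl) (C.crd d)
            - (X'.part k).comp k U U le_top (mapsInto_id ℳ le_rfl) (C.crd d) := by
        rw [hsub]
        exact map_sub (compAt (mapsInto_id ℳ le_rfl) k (C.crd d)) _ _
      rw [h3, h2, h2, map_sub, ← valueAt_comp X p trivial le_top hU,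
        ← valueAt_comp X' p trivial le_top hU, h0, sub_self]
    refine ⟨e0 k c, fun b => ?_⟩
    have h2 : nab.nabla U (C.field b) (X.restrict le_top) - nab.nabla U (C.field b)
        (X'.restrict le_top) = ∑ k, nab.nabla U (C.field b)
          ((X.part k - X'.part k).restrict (le_top : U ≤ ⊤)) := by
      rw [← nab.nabla_sub, ← nab.nabla_sum, ← restrict_sub]
      congr 1
      have h2 : (Finset.univ : Finset (ZMod 2)) = {0, 1} := rfl
      have h3 : X - X' = ∑ k, (X.part k - X'.part k) := by
        rw [Finset.sum_sub_distrib, X.sum_part, X'.sum_part]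
      rw [h3, h2, Finset.sum_pair (by decide), Finset.sum_pair (by decide)]
      rfl
    -- Since the connection is even, the component of parity `par b + k` sees only the part of
    -- parity `k` of the difference.
    have h3 := congrArg (compAt (mapsInto_id ℳ le_rfl) (par b + k) (C.crd c)) h2
    rw [map_sub, map_sum, Finset.sum_eq_single k] at h3
    · have h4 : p.pull U ⊤ (p.mapsInto hU) (act (nab.nabla U (C.field b)
          ((X.part k - X'.part k).restrict (le_top : U ≤ ⊤))) (C.crd c)) = 0 := by
        rw [act, (nab.even U (par b) k _ _ (C.field_isHomogeneous b)
          ((hhom k).restrict _)).val_eq]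
        have h5 := congrArg (p.pull U ⊤ (p.mapsInto hU)) h3
        refine h5.symm.trans ?_
        rw [map_sub]
        have h6 := congrFun (congrFun (congrFun h1 U) hU) (C.field b)
        have h7 := congrArg (fun v => v.comp (par b + k) U ⊤ le_rfl (p.mapsInto hU) (C.crd c)) h6
        simp only [nablaAt] at h7
        rw [valueAt_comp _ p hU le_rfl hU, valueAt_comp _ p hU le_rfl hU] at h7
        exact sub_eq_zero.2 h7
      -- After expansion in coordinate fields, the Christoffel terms carry components of the field
      -- as factors and vanish at `p` by `e0`; only the partial derivative remains.
      have h8 := C.vf_expand ((X.part k - X'.part k).restrict (le_top : U ≤ ⊤))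
      rw [h8, nab.nabla_sum, sum_act] at h4
      have h9 : ∀ d, act (nab.nabla U (C.field b)
          (act ((X.part k - X'.part k).restrict (le_top : U ≤ ⊤)) (C.crd d) • C.field d))
          (C.crd c) = _ := fun d =>
        C.nabla_smul_field_act nab b d c (act_mem ((hhom k).restrict _) (C.crd_mem d))
      simp only [h9] at h4
      rw [Finset.sum_add_distrib, Finset.sum_ite_eq' Finset.univ c, if_pos (Finset.mem_univ _),
        map_add, map_sum, Finset.sum_eq_zero, add_zero] at h4
      · exact h4
      · intro d _
        rw [map_zsmul, map_mul, e0, zero_mul, smul_zero]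
    · intro l _ hl
      have h5 := nab.even U (par b) l _ _ (C.field_isHomogeneous b)
        ((hhom l).restrict (le_top : U ≤ ⊤))
      have h6 := h5 (par b + k) (fun h => hl (add_left_cancel h).symm) U U le_rfl
        (mapsInto_id ℳ le_rfl)
      exact DFunLike.congr_fun h6 (C.crd c)
    · exact fun h => absurd (Finset.mem_univ _) h
  · intro U C a b c
    refine C.infinitesimal_controlled ((hhom k).restrict _) (nab := nab) (fun j Y W hY => ?_) a b c
    rw [hsub, bracket_sub_left, bracket_sub_left, bracket_sub_left, hX k j U Y W hY,
      hX' k j U Y W hY, nab.nabla_sub, nab.nabla_sub_left, smul_sub]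
    abel

end Infinitesimal

/-! ### Bilinear forms -/

section Forms

variable {P : Type w} [Ring P] [Algebra ℝ P] {𝒢 : ZMod 2 → Submodule ℝ P}
variable {M : Type u} [TopologicalSpace M] {N : Type v} [TopologicalSpace N]
variable {ℳ : SuperSpace.{u, w, x} 𝒢 M} {𝒩 : SuperSpace.{v, w, y} 𝒢 N}
variable {Φ : Hom ℳ 𝒩}

theorem BilinForm.form_sum_left (β : BilinForm Φ) {U : Opens M} {I : Type*} (s : Finset I)
    (S : I → SDer Φ U) (T : SDer Φ U) :
    β.form U (∑ i ∈ s, S i) T = ∑ i ∈ s, β.form U (S i) T :=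
  map_sum (AddMonoidHom.mk' (fun S => β.form U S T) fun S S' => β.add_left U S S' T) S s

theorem BilinForm.form_sum_right (β : BilinForm Φ) {U : Opens M} {I : Type*} (s : Finset I)
    (S : SDer Φ U) (T : I → SDer Φ U) :
    β.form U S (∑ i ∈ s, T i) = ∑ i ∈ s, β.form U S (T i) :=
  map_sum (AddMonoidHom.mk' (fun T => β.form U S T) fun T T' => β.add_right U S T T') T s

/-- A function with both parities can be moved out of the right slot of a bilinear form. -/
theorem BilinForm.form_smul_right (β : BilinForm Φ) {U : Opens M} {S T : SDer Φ U} {i j : ZMod 2}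
    (hS : S.IsHomogeneous i) (hT : T.IsHomogeneous j) (f : ℳ.Γ U) :
    β.form U S (f • T) = β.form U S T * ∑ l : ZMod 2, sgn l j • ℳ.pr U l f := by
  have h1 : f • T = ∑ l : ZMod 2, ℳ.pr U l f • T := by
    refine SDer.ext' fun k V W hU hV => ?_
    ext h
    have h2 : (∑ l : ZMod 2, ℳ.pr U l f • T).comp k V W hU hV h
        = ∑ l : ZMod 2, (ℳ.pr U l f • T).comp k V W hU hV h :=
      map_sum (AddMonoidHom.mk' (fun D : SDer Φ U => D.comp k V W hU hV h) fun _ _ => rfl)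
        (fun l => ℳ.pr U l f • T) Finset.univ
    rw [h2]
    simp only [SDer.smul_comp]
    rw [Finset.sum_comm]
    refine Finset.sum_congr rfl fun l _ => ?_
    rw [← Finset.sum_mul, ← map_sum, ← map_sum, ℳ.sum_pr]
  rw [h1, β.form_sum_right, Finset.mul_sum]
  refine Finset.sum_congr rfl fun l _ => ?_
  rw [β.smul_right U i l _ S T hS (ℳ.pr_mem U l f),
    ℳ.comm U l (i + j) _ _ (ℳ.pr_mem U l f) (β.even U i j S T hS hT), smul_smul, mul_smul_comm,
    sgn_add_right, ← mul_assoc, sgn_comm i l, sgn_mul_self, one_mul]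

/-- The differential of a superfunction. -/
def dform {U : Opens M} (f : ℳ.Γ U) : OneForm ℳ U where
  pair W h := AddMonoidHom.mk' (fun X => act X (ℳ.res h f)) fun X Y => add_act X Y _
  smul W h a X := smul_act a X _
  restrict h h' X := by
    change ℳ.res h' (act X (ℳ.res h f)) = act (X.restrict h') (ℳ.res (h'.trans h) f)
    rw [← ℳ.res_res h h', act_restrict]

end Forms

/-! ### Isometric supermorphisms -/

section Isometric

variable {P : Type w} [Ring P] [Algebra ℝ P] {𝒢 : ZMod 2 → Submodule ℝ P} [GradedAlgebra 𝒢]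
  [IsSmall 𝒢] {n m r s : ℕ}
variable {F : Type} [NormedRing F] [NormedAlgebra ℝ F] [FiniteDimensional ℝ F]
variable {F' : Type} [NormedRing F'] [NormedAlgebra ℝ F'] [FiniteDimensional ℝ F']
variable {M : Type u} [TopologicalSpace M] {N : Type v} [TopologicalSpace N]
variable {ℳ : SuperSpace.{u, w, x} 𝒢 M} {𝒩 : SuperSpace.{v, w, y} 𝒢 N}
variable {𝔐 : FibreModel 𝒢 n F} {𝔑 : FibreModel 𝒢 s F'} {U : Opens M} {V : Opens N}

namespace SuperChart

/-- The rings of sections over charts are stably finite. -/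
theorem isStablyFiniteRing (C : SuperChart ℳ 𝔐 m U) : IsStablyFiniteRing (ℳ.Γ U) := by
  -- One-sided inverses of square matrices over `F` are two-sided because `F` is Noetherian. This
  -- passes pointwise to functions and then to the subring of sections.
  have : IsNoetherianRing F := IsNoetherianRing.of_finite ℝ F
  have : IsStablyFiniteRing (Euc m → F) := ⟨fun k => ⟨fun {A B} hAB => by
    have h : ∀ z, (Pi.evalRingHom (fun _ : Euc m => F) z).mapMatrix (B * A) = 1 := fun z => by
      rw [map_mul, mul_eq_one_comm, ← map_mul, hAB, map_one]
    ext i j z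
    have h1 := congrFun (congrFun (h z) i) j
    rw [← map_one (Pi.evalRingHom (fun _ : Euc m => F) z).mapMatrix] at h1
    exact h1⟩⟩
  exact IsStablyFiniteRing.of_injective ((smoothAlg m F).val.comp C.rep)
    (Subtype.val_injective.comp C.rep_bijective.1)

/-- The Gram matrix of a supermetric in a chart has a right inverse. -/
theorem exists_gram_inverse (C : SuperChart ℳ 𝔐 m U) (g : SuperMetric ℳ) :
    ∃ W : Matrix (Fin m ⊕ Fin n) (Fin m ⊕ Fin n) (ℳ.Γ U),
      Matrix.of (fun i j => g.form U (C.field i) (C.field j)) * W = 1 := by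
  -- The vector field `T` is the gradient of the coordinate `c`, obtained from nondegeneracy; the
  -- components of the gradients form the inverse matrix, up to signs.
  have h : ∀ c, ∃ T : VF ℳ U, ∀ i, act (C.field i) (C.crd c) = g.form U (C.field i) T := by
    intro c
    obtain ⟨T, hT, -⟩ := g.nondegenerate U (dform (C.crd c))
    refine ⟨T.restrict le_rfl, fun i => ?_⟩
    rw [← hT U le_rfl]
    exact congrArg (act (C.field i)) (ℳ.res_self U _).symm
  choose T hT using h
  -- The signs arise from moving the components of the gradient out of the right slot, to the right
  -- of the Gram entry.
  refine ⟨Matrix.of fun j c => ∑ l : ZMod 2, sgn l (par j) • ℳ.pr U l (act (T c) (C.crd j)), ?_⟩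
  ext i c
  have h1 := hT c i
  rw [C.act_field_crd, C.vf_expand (T c), g.form_sum_right] at h1
  rw [Matrix.one_apply, h1, Matrix.mul_apply]
  refine Finset.sum_congr rfl fun j _ => ?_
  rw [g.form_smul_right (C.field_isHomogeneous i) (C.field_isHomogeneous j)]
  rfl

variable (C : SuperChart ℳ 𝔐 m U) (E : SuperChart 𝒩 𝔑 r V)
variable {Ξ Ψ : Hom ℳ 𝒩} (hV : MapsInto Ξ.body U V)

/-- The Jacobian matrix of a supermorphism in charts. -/
def jac (i : Fin m ⊕ Fin n) (a : Fin r ⊕ Fin s) : ℳ.Γ U :=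
  act (C.field i) (Ξ.pull V U hV (E.crd a))

/-- The pullback of the Gram matrix of a supermetric. -/
def gramPull (h : SuperMetric 𝒩) (a b : Fin r ⊕ Fin s) : ℳ.Γ U :=
  Ξ.pull V U hV (h.form V (E.field a) (E.field b))

/-- The product of the pullback of the Gram matrix and the transposed Jacobian matrix. -/
def gramJac (h : SuperMetric 𝒩) (a : Fin r ⊕ Fin s) (j : Fin m ⊕ Fin n) : ℳ.Γ U :=
  ∑ b, sgn (par a) (par j + par b) • (jac C E hV j b * gramPull E hV h a b)

/-- The second derivatives of a supermorphism, with one index lowered. -/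
def hessLow (h : SuperMetric 𝒩) (k i j : Fin m ⊕ Fin n) : ℳ.Γ U :=
  ∑ a, act (C.field k) (jac C E hV i a) * gramJac C E hV h a j

/-- The part of the derivative of the pullback metric that comes from the derivative of the
metric. -/
def metricDeriv (h : SuperMetric 𝒩) (k i j : Fin m ⊕ Fin n) : ℳ.Γ U :=
  ∑ a, sgn (par k) (par i + par a) • (jac C E hV i a * ∑ b, sgn (par a) (par j + par b) •
    sgn (par k) (par j + par b) • (jac C E hV j b * act (C.field k) (gramPull E hV h a b)))

theorem jac_mem (i : Fin m ⊕ Fin n) (a : Fin r ⊕ Fin s) :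
    jac C E hV i a ∈ ℳ.gr U (par i + par a) :=
  act_mem (C.field_isHomogeneous i) (Ξ.pull_mem V U hV _ _ (E.crd_mem a))

theorem gramPull_symm (h : SuperMetric 𝒩) (a b : Fin r ⊕ Fin s) :
    gramPull (ℳ := ℳ) E hV h a b = sgn (par a) (par b) • gramPull E hV h b a := by
  rw [gramPull, h.symm V _ _ _ _ (E.field_isHomogeneous a) (E.field_isHomogeneous b), map_zsmul]
  rfl

/-- An isometric supermorphism in charts. -/
theorem isometric_gram {g : SuperMetric ℳ} {h : SuperMetric 𝒩} (hI : IsIsometric g h Ξ)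
    (i j : Fin m ⊕ Fin n) :
    g.form U (C.field i) (C.field j) = ∑ a, jac C E hV i a * gramJac C E hV h a j := by
  obtain ⟨h', h1, h2⟩ := hI
  rw [← h2, C.differential_expand E hV (C.field i), h'.form_sum_left]
  refine Finset.sum_congr rfl fun a _ => ?_
  rw [h'.smul_left, C.differential_expand E hV (C.field j), h'.form_sum_right]
  congr 1
  refine Finset.sum_congr rfl fun b _ => ?_
  change h'.form U _ (jac C E hV j b • _) = _
  rw [h'.smul_right U (par a) (par j + par b) _ _ _
    (pullVF_isHomogeneous hV (E.field_isHomogeneous a)) (C.jac_mem E hV j b), h1]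
  rfl

/-- Balances the signs when the two Jacobian factors are exchanged and the metric is transposed in
`act_isometric_gram`. -/
theorem sgn_swap (i j k a b : ZMod 2) :
    sgn k (i + a) * (sgn a (j + b) * (sgn (i + a) (k + (j + b)) * sgn a b))
      = sgn i j * sgn b (i + a) := by
  revert i j k a b
  decide

theorem sgn_cycle (i j k : ZMod 2) :
    sgn i j * sgn k j * (sgn k i * sgn j i) * sgn j k = sgn k i := by
  revert i j k
  decide

/-- By the Leibniz rule the derivative falls on the left Jacobian factor, on the right one, or on
the pulled-back metric. Graded symmetry of the metric brings the second contribution to the form of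
the first with `i` and `j` exchanged. -/
theorem act_isometric_gram {g : SuperMetric ℳ} {h : SuperMetric 𝒩} (hI : IsIsometric g h Ξ)
    (k i j : Fin m ⊕ Fin n) :
    act (C.field k) (g.form U (C.field i) (C.field j))
      = hessLow C E hV h k i j + sgn (par i) (par j) • hessLow C E hV h k j i
        + metricDeriv C E hV h k i j := by
  rw [C.isometric_gram E hV hI, map_sum, add_assoc, hessLow]
  simp only [act_mul (C.field_isHomogeneous k) _ (C.jac_mem E hV i _)]
  rw [Finset.sum_add_distrib]
  congr 1
  have h1 : ∀ a, act (C.field k) (gramJac C E hV h a j)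
      = (∑ b, sgn (par a) (par j + par b) •
          (act (C.field k) (jac C E hV j b) * gramPull E hV h a b))
        + ∑ b, sgn (par a) (par j + par b) • sgn (par k) (par j + par b) •
          (jac C E hV j b * act (C.field k) (gramPull E hV h a b)) := by
    intro a
    rw [gramJac, map_sum, ← Finset.sum_add_distrib]
    refine Finset.sum_congr rfl fun b _ => ?_
    rw [map_zsmul, act_mul (C.field_isHomogeneous k) _ (C.jac_mem E hV j b), smul_add]
  simp only [h1, mul_add, smul_add]
  rw [Finset.sum_add_distrib]
  congr 1
  simp only [hessLow, gramJac, Finset.mul_sum, Finset.smul_sum]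
  rw [Finset.sum_comm]
  refine Finset.sum_congr rfl fun b _ => Finset.sum_congr rfl fun a _ => ?_
  have h2 := ℳ.comm U _ _ _ _ (C.jac_mem E hV i a)
    (act_mem (C.field_isHomogeneous k) (C.jac_mem E hV j b))
  rw [gramPull_symm, mul_smul_comm, mul_smul_comm, mul_smul_comm, mul_smul_comm, ← mul_assoc,
    ← mul_assoc, h2, smul_mul_assoc]
  simp only [smul_smul]
  rw [← sgn_swap (par i) (par j) (par k) (par a) (par b)]
  congr 1
  ring

/-- The first two indices are those of a second derivative, and coordinate fields supercommute. -/
theorem hessLow_comm (h : SuperMetric 𝒩) (k i j : Fin m ⊕ Fin n) :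
    hessLow C E hV h k i j = sgn (par k) (par i) • hessLow C E hV h i k j := by
  rw [hessLow, hessLow, Finset.smul_sum]
  refine Finset.sum_congr rfl fun a _ => ?_
  rw [jac, C.act_field_comm, smul_mul_assoc]
  rfl

variable (hΞ : MapsInto Ξ.body U V) (hΨ : MapsInto Ψ.body U V)

theorem jac_secClose (i : Fin m ⊕ Fin n) (a : Fin r ⊕ Fin s) :
    C.SecClose (C.jet (E.homDiff Ξ Ψ hΞ hΨ)) (jac C E hΞ i a) (jac C E hΨ i a) :=
  C.act_pull_secClose E hΞ hΨ i a

theorem gramJac_secClose (h : SuperMetric 𝒩) (a : Fin r ⊕ Fin s) (j : Fin m ⊕ Fin n) :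
    C.SecClose (C.jet (E.homDiff Ξ Ψ hΞ hΨ)) (gramJac C E hΞ h a j) (gramJac C E hΨ h a j) :=
  SecClose.sum fun b _ => ((C.jac_secClose E hΞ hΨ j b).mul (C.pull_secClose E hΞ hΨ _)).zsmul _

theorem act_gramPull_secClose (h : SuperMetric 𝒩) (k : Fin m ⊕ Fin n) (a b : Fin r ⊕ Fin s) :
    C.SecClose (C.jet (E.homDiff Ξ Ψ hΞ hΨ)) (act (C.field k) (gramPull E hΞ h a b))
      (act (C.field k) (gramPull E hΨ h a b)) := by
  -- The chain rule: differentiating the pulled-back metric produces only first derivatives of the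
  -- supermorphism.
  have e : ∀ {Φ : Hom ℳ 𝒩} (hΦ : MapsInto Φ.body U V), act (C.field k) (gramPull E hΦ h a b)
      = ∑ c, jac C E hΦ k c
        * Φ.pull V U hΦ (act (E.field c) (h.form V (E.field a) (E.field b))) := by
    intro Φ hΦ
    rw [gramPull, ← val_differential, C.differential_expand E hΦ, SDer.val_sum]
    refine Finset.sum_congr rfl fun c _ => ?_
    rw [SDer.val_smul, val_pullVF]
    rfl
  rw [e, e]
  exact SecClose.sum fun c _ => (C.jac_secClose E hΞ hΨ k c).mul (C.pull_secClose E hΞ hΨ _)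

theorem metricDeriv_secClose (h : SuperMetric 𝒩) (k i j : Fin m ⊕ Fin n) :
    C.SecClose (C.jet (E.homDiff Ξ Ψ hΞ hΨ)) (metricDeriv C E hΞ h k i j)
      (metricDeriv C E hΨ h k i j) :=
  SecClose.sum fun a _ => ((C.jac_secClose E hΞ hΨ i a).mul (SecClose.sum fun b _ =>
    (((C.jac_secClose E hΞ hΨ j b).mul
      (C.act_gramPull_secClose E hΞ hΨ h k a b)).zsmul _).zsmul _)).zsmul _

theorem SecControlled.of_two {L : Type} [Fintype L] {C : SuperChart ℳ 𝔐 m U} {v : L → ℳ.Γ U}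
    {f : ℳ.Γ U} (h : C.SecControlled v (f + f)) : C.SecControlled v f := by
  refine (SecControlled.mul_left (algebraMap ℝ (ℳ.Γ U) (1 / 2)) h).of_eq ?_
  rw [← Algebra.smul_def, ← two_smul ℝ f, smul_smul]
  norm_num

/-- The difference `t` of the lowered Hessians is graded symmetric in its first two indices, and
modulo controlled terms graded antisymmetric in the last two, because the metric on `ℳ` is the same
for both isometries. As for the uniqueness of the Levi-Civita connection, these symmetries force `t`
to be controlled. -/
theorem hessLow_controlled {g : SuperMetric ℳ} {h : SuperMetric 𝒩} (hI : IsIsometric g h Ξ)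
    (hI' : IsIsometric g h Ψ) (k i j : Fin m ⊕ Fin n) :
    C.SecClose (C.jet (E.homDiff Ξ Ψ hΞ hΨ)) (hessLow C E hΞ h k i j)
      (hessLow C E hΨ h k i j) := by
  let t := fun k i j => hessLow C E hΞ h k i j - hessLow C E hΨ h k i j
  have ht : ∀ k i j, t k i j = sgn (par k) (par i) • t i k j := fun k i j => by
    change _ - _ = _
    rw [hessLow_comm, hessLow_comm C E hΨ, ← smul_sub]
  have hc : ∀ k i j, C.SecControlled (C.jet (E.homDiff Ξ Ψ hΞ hΨ))
      (t k i j + sgn (par i) (par j) • t k j i) := by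
    intro k i j
    refine (SecControlled.neg (C.metricDeriv_secClose E hΞ hΨ h k i j)).of_eq ?_
    have e := (C.act_isometric_gram E hΞ hI k i j).symm.trans (C.act_isometric_gram E hΨ hI' k i j)
    have e' : hessLow C E hΞ h k i j + sgn (par i) (par j) • hessLow C E hΞ h k j i
        - (hessLow C E hΨ h k i j + sgn (par i) (par j) • hessLow C E hΨ h k j i)
        = metricDeriv C E hΨ h k i j - metricDeriv C E hΞ h k i j := by
      rw [sub_eq_sub_iff_add_eq_add, e]
      abel
    rw [neg_sub, ← e']
    simp only [t, smul_sub]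
    abel
  change C.SecControlled _ (t k i j)
  refine SecControlled.of_two ?_
  -- An alternating sum over the three cyclic permutations of the indices: symmetry in the first two
  -- slots cancels four of the six terms, and the other two add up to twice `t k i j`.
  have e1 := hc k i j
  have e2 := (hc j k i).zsmul (sgn (par i) (par j) * sgn (par k) (par j))
  have e3 := (hc i j k).zsmul (sgn (par i) (par j) * sgn (par k) (par j) * (sgn (par k) (par i) * sgn (par j) (par i)))
  refine ((e1.sub e2).add e3).of_eq ?_
  rw [ht k i j, ht k j i, ht j i k]
  simp only [smul_add, smul_smul]
  rw [sgn_cycle]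
  abel

end SuperChart

end Isometric

/-! ### Isometric supermorphisms in equal super dimension -/

section IsometricEq

variable {P : Type w} [Ring P] [Algebra ℝ P] {𝒢 : ZMod 2 → Submodule ℝ P} [GradedAlgebra 𝒢]
  [IsSmall 𝒢] {n m : ℕ}
variable {F : Type} [NormedRing F] [NormedAlgebra ℝ F] [FiniteDimensional ℝ F]
variable {F' : Type} [NormedRing F'] [NormedAlgebra ℝ F'] [FiniteDimensional ℝ F']
variable {M : Type u} [TopologicalSpace M] {N : Type v} [TopologicalSpace N]
variable {ℳ : SuperSpace.{u, w, x} 𝒢 M} {𝒩 : SuperSpace.{v, w, y} 𝒢 N}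
variable {𝔐 : FibreModel 𝒢 n F} {𝔑 : FibreModel 𝒢 n F'} {U : Opens M} {V : Opens N}
variable (C : SuperChart ℳ 𝔐 m U) (E : SuperChart 𝒩 𝔑 m V)
variable {Ξ Ψ : Hom ℳ 𝒩} (hΞ : MapsInto Ξ.body U V) (hΨ : MapsInto Ψ.body U V)

namespace SuperChart

/-- The lowered Hessians are close by `hessLow_controlled`. To raise the index again, the matrix
`gramJac` must be invertible; equal super dimension makes it square, and stable finiteness gives a
right inverse. -/
theorem isometric_controlled {g : SuperMetric ℳ} {h : SuperMetric 𝒩} (hI : IsIsometric g h Ξ)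
    (hI' : IsIsometric g h Ψ) (k i c : Fin m ⊕ Fin n) :
    C.SecControlled (C.jet (E.homDiff Ξ Ψ hΞ hΨ))
      (act (C.field k) (act (C.field i) (E.homDiff Ξ Ψ hΞ hΨ c))) := by
  have := C.isStablyFiniteRing
  obtain ⟨W, hW⟩ := C.exists_gram_inverse g
  -- The Gram matrix is the product of the Jacobian and `gramJac`, and `W` is its right inverse.
  -- Thus `gramJac * W` is a right inverse of the Jacobian, hence also a left inverse, so `W` times
  -- the Jacobian is a right inverse of `gramJac`.
  have hQ : ∃ Q : Matrix (Fin m ⊕ Fin n) (Fin m ⊕ Fin n) (ℳ.Γ U),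
      Matrix.of (gramJac C E hΞ h) * Q = 1 := by
    refine ⟨W * Matrix.of (jac C E hΞ), ?_⟩
    rw [← Matrix.mul_assoc, mul_eq_one_comm, ← Matrix.mul_assoc, ← hW]
    congr 1
    ext i j
    rw [Matrix.of_apply, C.isometric_gram E hΞ hI, Matrix.mul_apply]
    rfl
  obtain ⟨Q, hQ⟩ := hQ
  -- The difference of the unlowered Hessians. Lowering it with the matrix of `Ξ` alone gives the
  -- difference of the lowered Hessians up to the difference of the two matrices, which is
  -- controlled.
  let d := fun a => act (C.field k) (jac C E hΞ i a) - act (C.field k) (jac C E hΨ i a)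
  have h1 : ∀ j, C.SecControlled (C.jet (E.homDiff Ξ Ψ hΞ hΨ))
      (∑ a, d a * gramJac C E hΞ h a j) := by
    intro j
    refine (SecControlled.sub (C.hessLow_controlled E hΞ hΨ hI hI' k i j)
      (SecControlled.sum (s := Finset.univ) fun a _ => SecControlled.mul_left
        (act (C.field k) (jac C E hΨ i a)) (C.gramJac_secClose E hΞ hΨ h a j))).of_eq ?_
    simp only [d, hessLow, sub_mul, mul_sub, Finset.sum_sub_distrib]
    abel
  have h2 : act (C.field k) (act (C.field i) (E.homDiff Ξ Ψ hΞ hΨ c))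
      = ∑ j, (∑ a, d a * gramJac C E hΞ h a j) * Q j c := by
    have h3 : Matrix.vecMul (Matrix.vecMul d (Matrix.of (gramJac C E hΞ h))) Q c = d c := by
      rw [Matrix.vecMul_vecMul, hQ, Matrix.vecMul_one]
    refine Eq.trans ?_ h3.symm
    rw [homDiff, map_sub, map_sub]
    rfl
  rw [h2]
  exact SecControlled.sum fun j _ => (h1 j).mul_right _

end SuperChart

end IsometricEq

end

end PSuper

theorem corollary4p11 {P : Type*} [Ring P] [Algebra ℝ P] {𝒢 : ZMod 2 → Submodule ℝ P}
    [GradedAlgebra 𝒢] [PSuper.IsSmall 𝒢]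
    {m n r s : ℕ}
    {M : Type*} [TopologicalSpace M] [T2Space M] [SecondCountableTopology M]
    [ChartedSpace (EuclideanSpace ℝ (Fin m)) M] [IsManifold (𝓡 m) ∞ M] [ConnectedSpace M]
    {N : Type*} [TopologicalSpace N] [T2Space N] [SecondCountableTopology N]
    [ChartedSpace (EuclideanSpace ℝ (Fin r)) N] [IsManifold (𝓡 r) ∞ N]
    (ℳ : PSuper.PSupermanifold 𝒢 m n M) (𝒩 : PSuper.PSupermanifold 𝒢 r s N)
    (p : PSuper.PPoint ℳ.toSuperSpace) :
    -- (i) affine supermorphisms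
    (∀ (nabM : PSuper.AffineConnection ℳ.toSuperSpace)
        (nabN : PSuper.AffineConnection 𝒩.toSuperSpace),
      Set.InjOn (PSuper.linearization p)
        {Ξ : PSuper.Hom ℳ.toSuperSpace 𝒩.toSuperSpace | PSuper.IsAffine nabM nabN Ξ}) ∧
    -- (ii) infinitesimally affine super vector fields
    (∀ nabM : PSuper.AffineConnection ℳ.toSuperSpace,
      Set.InjOn (fun X : PSuper.VF ℳ.toSuperSpace ⊤ =>
          (PSuper.valueAt X p trivial, PSuper.nablaAt nabM X p))
        {X | PSuper.IsInfinitesimallyAffine nabM X}) ∧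
    -- (iii) isometric supermorphisms
    (∀ (g : PSuper.SuperMetric ℳ.toSuperSpace) (h : PSuper.SuperMetric 𝒩.toSuperSpace),
      m = r → n = s →
      Set.InjOn (PSuper.linearization p)
        {Ξ : PSuper.Hom ℳ.toSuperSpace 𝒩.toSuperSpace | PSuper.IsIsometric g h Ξ}) := by
  -- The norm on the fibre is auxiliary; it serves only to state bounds and to differentiate
  -- functions with values in the fibre.
  obtain ⟨F, _, _, _, 𝔐, e, he, he'⟩ := PSuper.exists_normed_model (𝒢 := 𝒢) (n := n)
  obtain ⟨F', _, _, _, 𝔑, d, hd, hd'⟩ := PSuper.exists_normed_model (𝒢 := 𝒢) (n := s)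
  have hM := fun (q : M) (U₀ : TopologicalSpace.Opens M) (hq : q ∈ U₀) =>
    PSuper.exists_superChart 𝔐 e he he' ℳ q hq
  have hN := fun (q : N) (U₀ : TopologicalSpace.Opens N) (hq : q ∈ U₀) =>
    PSuper.exists_superChart 𝔑 d hd hd' 𝒩 q hq
  refine ⟨fun nabM nabN Ξ hΞ Ψ hΨ h => ?_, fun nabM X hX X' hX' h => ?_,
    fun g h hmr hns Ξ hΞ Ψ hΨ hl => ?_⟩
  · exact PSuper.hom_eq_of_linearization hM hN h fun U V C E h1 h2 a b c =>
      C.affine_controlled E h1 h2 hΞ hΨ a b c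
  · exact PSuper.vf_eq_of_infinitesimallyAffine hM hX hX' (congrArg Prod.fst h)
      (congrArg Prod.snd h)
  · subst hmr hns
    exact PSuper.hom_eq_of_linearization hM hN hl fun U V C E h1 h2 a b c =>
      C.isometric_controlled E h1 h2 hΞ hΨ a b c
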